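/- All representations are complex. For a finite monoid $M$, write $E(M)$ for its set of idempotents; call $M$ semisimple if $\mathbb{C}[M]$ is a semisimple algebra. A submonoid $N\subseteq M$ (with the same identity) is centric if $mN=Nm$ for all $m\in M$; then $M/N$ denotes the quotient of $M$ by the congruence $x\sim y\iff Nx=Ny$, and $[x]$ the class of $x$. An idempotent $e\in E(M)$ is an apex of a representation $V$ of $M$ if $\{m\in M: mV=0\}=\{m\in M: e\notin MmM\}$. For a submonoid $N$ of $M$ and a representation $(\rho,W)$ of $N$, $\mathrm{Ind}_N^M\rho$ is the space of functions $\varphi:M\to W$ with $\varphi(nm)=\rho(n)\varphi(m)$ for $n\in N$, $m\in M$, with $M$ acting by right translation. Let $(\Pi,V)$ be a finite-dimensional representation of a product $A\times B$ of finite monoids. For an irreducible representation $\sigma$ of $A$, let $V_\sigma=V/\bigcap_{h\in\mathrm{Hom}_A(V,\sigma)}\ker h$, and write $V_\sigma\simeq\sigma\otimes\Theta_\sigma$ with $\Theta_\sigma$ a representation of $B$; define $\Theta_\tau$ symmetrically for an irreducible representation $\tau$ of $B$. Then $\Pi$ is a theta representation of $A\times B$ if (1) $\dim\mathrm{Hom}_{A\times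 B}(\Pi,\sigma\otimes\tau)\le 1$ for all irreducible $\sigma,\tau$, and (2) each $\Theta_\sigma$, and each $\Theta_\tau$, is zero or has (up to isomorphism) a unique irreducible quotient. It is a theta representation with respect to a class $S$ of irreducible representations of $A\times B$ if (1) holds whenever $\sigma\otimes\tau\in S$; for each irreducible $\sigma$ of $A$, $\Theta_\sigma$ has, up to isomorphism, at most one irreducible quotient $\tau$ with $\sigma\otimes\tau\in S$; and for each irreducible $\tau$ of $B$, $\Theta_\tau$ has, up to isomorphism, at most one irreducible quotient $\sigma$ with $\sigma\otimes\tau\in S$. **Proposition.** Let $M_1,M_2$ be finite semisimple monoids such that, for $i=1,2$, $M_i$ is a centric submonoid of itself ($mM_i=M_im$ for all $m\in M_i$). Let $N_i\subseteq M_i$ be a centric submonoid which is a subgroup (containing the identity of $M_i$), and let $\iota:M_1/N_1\to M_2/N_2$ be an isomorphism of monoids. Let $\Gamma=\{(m_1,m_2)\in M_1\times M_2:\iota([m_1])=[m_2]\}$, which contains $N_1\times N_2$. Let $\mathrm{Irr}^{E}(M_1\times M_2)$ be the class of irreducible representations of $M_1\times M_2$ having an apex of the form $(f_1',f_2')$ with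 $f_i'\in E(M_i)$ and $\iota([f_1'])=[f_2']$. Fix $f_i\in E(M_i)$ with $\iota([f_1])=[f_2]$, and let $\rho$ be a finite-dimensional representation of $\Gamma$ all of whose irreducible components have apex $(f_1,f_2)$. Then $\mathrm{Res}^{\Gamma}_{N_1\times N_2}\rho$ is a theta representation of $N_1\times N_2$ if and only if $\mathrm{Ind}_{\Gamma}^{M_1\times M_2}\rho$ is a theta representation of $M_1\times M_2$ with respect to $\mathrm{Irr}^{E}(M_1\times M_2)$. -/

import Mathlib

open scoped TensorProduct

noncomputable section

namespace ThetaMonoid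

/-! ### Centric submonoids and quotient monoids -/

section Monoids

variable {M : Type*} [Monoid M]

/-- `M` is a semisimple monoid: its complex monoid algebra is semisimple. -/
def IsSemisimpleMonoid (M : Type*) [Monoid M] : Prop :=
  IsSemisimpleRing (MonoidAlgebra ℂ M)

/-- `N` is a centric submonoid of `M`: `mN = Nm` for all `m` in `M`. -/
def IsCentric (N : Submonoid M) : Prop :=
  ∀ m : M, (fun n => m * n) '' (N : Set M) = (fun n => n * m) '' (N : Set M)

/-- The submonoid `N` is a subgroup of `M` (with the same identity element). -/
def IsSubgroup (N : Submonoid M) : Prop :=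
  ∀ n ∈ N, ∃ n' ∈ N, n * n' = 1 ∧ n' * n = 1

/-- The congruence `x ~ y ↔ Nx = Ny` attached to a centric submonoid. -/
def centricCon (N : Submonoid M) (hN : IsCentric N) : Con M where
  r x y := (fun n => n * x) '' (N : Set M) = (fun n => n * y) '' (N : Set M)
  iseqv := ⟨fun _ => rfl, fun h => h.symm, fun h h' => h.trans h'⟩
  mul' := by
    have key : ∀ {w x y z : M},
        (fun n => n * w) '' (N : Set M) = (fun n => n * x) '' (N : Set M) →
        (fun n => n * y) '' (N : Set M) = (fun n => n * z) '' (N : Set M) →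
        (fun n => n * (w * y)) '' (N : Set M) ⊆ (fun n => n * (x * z)) '' (N : Set M) := by
      rintro w x y z h₁ h₂ _ ⟨n, hn, rfl⟩
      obtain ⟨a, ha, hax⟩ : n * w ∈ (fun n => n * x) '' (N : Set M) := h₁ ▸ ⟨n, hn, rfl⟩
      obtain ⟨b, hb, hbz⟩ : y ∈ (fun n => n * z) '' (N : Set M) :=
        h₂ ▸ ⟨1, N.one_mem, one_mul y⟩
      obtain ⟨c, hc, hcx⟩ : x * b ∈ (fun n => n * x) '' (N : Set M) := hN x ▸ ⟨b, hb, rfl⟩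
      refine ⟨a * c, N.mul_mem ha hc, ?_⟩
      dsimp only at hax hbz hcx ⊢
      calc a * c * (x * z) = a * (c * x) * z := by simp only [mul_assoc]
        _ = a * x * (b * z) := by rw [hcx]; simp only [mul_assoc]
        _ = n * (w * y) := by rw [hax, hbz, mul_assoc]
    intro w x y z h₁ h₂
    exact Set.Subset.antisymm (key h₁ h₂) (key h₁.symm h₂.symm)

/-- The quotient monoid `M / N` by a centric submonoid. -/
abbrev CentricQuotient (N : Submonoid M) (hN : IsCentric N) : Type _ :=
  (centricCon N hN).Quotient

/-- The canonical homomorphism `M → M / N`, `m ↦ [m]`. -/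
abbrev toQuotient (N : Submonoid M) (hN : IsCentric N) : M →* CentricQuotient N hN :=
  (centricCon N hN).mk'

lemma toQuotient_eq_one {N : Submonoid M} (hN : IsCentric N) (hg : IsSubgroup N)
    {n : M} (hn : n ∈ N) : toQuotient N hN n = 1 := by
  rw [← map_one (toQuotient N hN)]
  refine (Con.eq _).2 (Set.Subset.antisymm ?_ ?_)
  · rintro _ ⟨a, ha, rfl⟩
    exact ⟨a * n, N.mul_mem ha hn, mul_one _⟩
  · rintro _ ⟨a, ha, rfl⟩
    obtain ⟨n', hn', -, h⟩ := hg n hn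
    refine ⟨a * n', N.mul_mem ha hn', ?_⟩
    dsimp only
    rw [mul_assoc, h]

end Monoids

section Graph

variable {M₁ M₂ : Type*} [Monoid M₁] [Monoid M₂]
  {N₁ : Submonoid M₁} {N₂ : Submonoid M₂} {h₁ : IsCentric N₁} {h₂ : IsCentric N₂}

/-- `Γ`: the preimage in `M₁ × M₂` of the graph of `ι : M₁/N₁ ≃ M₂/N₂`. -/
def graphPreimage (ι : CentricQuotient N₁ h₁ ≃* CentricQuotient N₂ h₂) :
    Submonoid (M₁ × M₂) :=
  (ι.toMonoidHom.mgraph).comap ((toQuotient N₁ h₁).prodMap (toQuotient N₂ h₂))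

/-- The inclusion of `N₁ × N₂` into `Γ`, for subgroups `N₁`, `N₂`. -/
def inclGraphPreimage (ι : CentricQuotient N₁ h₁ ≃* CentricQuotient N₂ h₂)
    (g₁ : IsSubgroup N₁) (g₂ : IsSubgroup N₂) : N₁ × N₂ →* graphPreimage ι :=
  (N₁.subtype.prodMap N₂.subtype).codRestrict (graphPreimage ι) (by
    rintro ⟨⟨a, ha⟩, ⟨b, hb⟩⟩
    change ι (toQuotient N₁ h₁ a) = toQuotient N₂ h₂ b
    rw [toQuotient_eq_one h₁ g₁ ha, toQuotient_eq_one h₂ g₂ hb, map_one])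

end Graph

/-! ### Representations -/

section Apex

variable {M V : Type*} [Monoid M] [AddCommGroup V] [Module ℂ V]

/-- The idempotent `e` is an apex of `π`: the annihilator of `π` in `M` is the set of all `m`
such that `MmM` does not contain (the `J`-class of) `e`. -/
def IsApex (π : Representation ℂ M V) (e : M) : Prop :=
  IsIdempotentElem e ∧ ∀ m : M, π m = 0 ↔ ¬ ∃ a b : M, e = a * m * b

end Apex

section Theta

variable {A B V U T : Type*} [Monoid A] [Monoid B] [AddCommGroup V] [Module ℂ V]
  [AddCommGroup U] [Module ℂ U] [AddCommGroup T] [Module ℂ T]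

/-- The external tensor product `σ ⊗ τ` of representations of `A` and `B`, a representation
of `A × B`. -/
def extTensor (σ : Representation ℂ A U) (τ : Representation ℂ B T) :
    Representation ℂ (A × B) (U ⊗[ℂ] T) :=
  Representation.tprod (σ.comp (MonoidHom.fst A B)) (τ.comp (MonoidHom.snd A B))

/-- The restriction of a representation of `A × B` to `A`. -/
def resLeft (Ω : Representation ℂ (A × B) V) : Representation ℂ A V :=
  Ω.comp (MonoidHom.inl A B)

/-- A representation of `A × B`, viewed as a representation of `B × A`. -/
def swapRep (Ω : Representation ℂ (A × B) V) : Representation ℂ (B × A) V :=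
  Ω.comp (MulEquiv.prodComm : B × A ≃* A × B).toMonoidHom

/-- `V[σ]`: the intersection of the kernels of all `A`-homomorphisms from `V` to `σ`. -/
def isotypicKer (Ω : Representation ℂ (A × B) V) (σ : Representation ℂ A U) :
    Submodule ℂ V :=
  ⨅ f : (resLeft Ω).IntertwiningMap σ, LinearMap.ker f.toLinearMap

lemma isotypicKer_le_comap (Ω : Representation ℂ (A × B) V) (σ : Representation ℂ A U)
    (g : A × B) : isotypicKer Ω σ ≤ (isotypicKer Ω σ).comap (Ω g) := by
  intro v hv
  rw [Submodule.mem_comap]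
  unfold isotypicKer at hv ⊢
  rw [Submodule.mem_iInf] at hv ⊢
  intro f
  let f' : (resLeft Ω).IntertwiningMap σ :=
    { toLinearMap := f.toLinearMap ∘ₗ Ω (1, g.2)
      isIntertwining' := fun a => by
        have h : Ω (1, g.2) ∘ₗ resLeft Ω a = resLeft Ω a ∘ₗ Ω (1, g.2) := by
          change Ω (1, g.2) * Ω (a, 1) = Ω (a, 1) * Ω (1, g.2)
          rw [← map_mul, ← map_mul]
          simp
        rw [LinearMap.comp_assoc, h, ← LinearMap.comp_assoc, f.isIntertwining',
          LinearMap.comp_assoc] }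
  have h1 : f.toLinearMap (Ω (1, g.2) v) = 0 := hv f'
  have h2 : Ω g v = resLeft Ω g.1 (Ω (1, g.2) v) := by
    change Ω g v = (Ω (g.1, 1) * Ω (1, g.2)) v
    rw [← map_mul]
    simp
  rw [LinearMap.mem_ker, h2]
  have h3 := LinearMap.congr_fun (f.isIntertwining' g.1) (Ω (1, g.2) v)
  simp only [LinearMap.comp_apply] at h3
  rw [h3, h1, map_zero]

/-- `V_σ = V / V[σ]`: the greatest `σ`-isotypic quotient of `V`, as a representation of
`A × B`. -/
def isotypicQuotient (Ω : Representation ℂ (A × B) V) (σ : Representation ℂ A U) :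
    Representation ℂ (A × B) (V ⧸ isotypicKer Ω σ) :=
  Representation.quotient Ω (isotypicKer Ω σ) (isotypicKer_le_comap Ω σ)

/-- `Θ` is the representation `Θ_σ` of `B` attached to the representation `σ` of `A`:
`V_σ ≃ σ ⊗ Θ`. -/
def IsBigTheta (Ω : Representation ℂ (A × B) V) (σ : Representation ℂ A U)
    (Θ : Representation ℂ B T) : Prop :=
  Nonempty ((isotypicQuotient Ω σ).Equiv (extTensor σ Θ))

/-- `τ` is an irreducible quotient of `Θ`. -/
def IsIrreducibleQuotient (Θ : Representation ℂ B T) (τ : Representation ℂ B U) : Prop :=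
  τ.IsIrreducible ∧ ∃ q : Θ.IntertwiningMap τ, Function.Surjective q

/-- Up to isomorphism, `Θ` has exactly one irreducible quotient satisfying `P`. -/
def HasUniqueIrreducibleQuotient (Θ : Representation ℂ B T)
    (P : ∀ {X : Type} [AddCommGroup X] [Module ℂ X], Representation ℂ B X → Prop) : Prop :=
  ∃ (X : Type) (_ : AddCommGroup X) (_ : Module ℂ X) (τ : Representation ℂ B X),
    (IsIrreducibleQuotient Θ τ ∧ P τ) ∧
    ∀ (Y : Type) [AddCommGroup Y] [Module ℂ Y] (τ' : Representation ℂ B Y),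
      IsIrreducibleQuotient Θ τ' → P τ' → Nonempty (τ'.Equiv τ)

/-- `Θ` has no irreducible quotient satisfying `P`. -/
def HasNoIrreducibleQuotient (Θ : Representation ℂ B T)
    (P : ∀ {X : Type} [AddCommGroup X] [Module ℂ X], Representation ℂ B X → Prop) : Prop :=
  ∀ (X : Type) [AddCommGroup X] [Module ℂ X] (τ : Representation ℂ B X),
    IsIrreducibleQuotient Θ τ → ¬ P τ

/-- `Ω` is a theta representation of `A × B`. Irreducible representations of finite monoids are
finite-dimensional, so all of them have models with underlying space in `Type`. -/
structure IsTheta (Ω : Representation ℂ (A × B) V) : Prop where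
  multiplicity : ∀ (X Y : Type) [AddCommGroup X] [Module ℂ X] [AddCommGroup Y] [Module ℂ Y]
    (σ : Representation ℂ A X) (τ : Representation ℂ B Y),
    σ.IsIrreducible → τ.IsIrreducible →
      Module.rank ℂ (Ω.IntertwiningMap (extTensor σ τ)) ≤ 1
  theta_left : ∀ (X : Type) [AddCommGroup X] [Module ℂ X] (σ : Representation ℂ A X),
    σ.IsIrreducible →
      ∃ (T : Type) (_ : AddCommGroup T) (_ : Module ℂ T) (Θ : Representation ℂ B T),
        IsBigTheta Ω σ Θ ∧
          (Subsingleton T ∨ HasUniqueIrreducibleQuotient Θ (fun _ => True))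
  theta_right : ∀ (Y : Type) [AddCommGroup Y] [Module ℂ Y] (τ : Representation ℂ B Y),
    τ.IsIrreducible →
      ∃ (T : Type) (_ : AddCommGroup T) (_ : Module ℂ T) (Θ : Representation ℂ A T),
        IsBigTheta (swapRep Ω) τ Θ ∧
          (Subsingleton T ∨ HasUniqueIrreducibleQuotient Θ (fun _ => True))

/-- `Ω` is a theta representation of `A × B` with respect to a class `S` of irreducible
representations of `A × B`: the two defining conditions are only imposed on pairs `(σ, τ)`
with `σ ⊗ τ` in `S`. -/
structure IsThetaWithRespectTo (Ω : Representation ℂ (A × B) V)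
    (S : ∀ {X : Type} [AddCommGroup X] [Module ℂ X],
      Representation ℂ (A × B) X → Prop) : Prop where
  multiplicity : ∀ (X Y : Type) [AddCommGroup X] [Module ℂ X] [AddCommGroup Y] [Module ℂ Y]
    (σ : Representation ℂ A X) (τ : Representation ℂ B Y),
    σ.IsIrreducible → τ.IsIrreducible → S (extTensor σ τ) →
      Module.rank ℂ (Ω.IntertwiningMap (extTensor σ τ)) ≤ 1
  theta_left : ∀ (X : Type) [AddCommGroup X] [Module ℂ X] (σ : Representation ℂ A X),
    σ.IsIrreducible →
      ∃ (T : Type) (_ : AddCommGroup T) (_ : Module ℂ T) (Θ : Representation ℂ B T),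
        IsBigTheta Ω σ Θ ∧
          (HasNoIrreducibleQuotient Θ (fun τ => S (extTensor σ τ)) ∨
            HasUniqueIrreducibleQuotient Θ (fun τ => S (extTensor σ τ)))
  theta_right : ∀ (Y : Type) [AddCommGroup Y] [Module ℂ Y] (τ : Representation ℂ B Y),
    τ.IsIrreducible →
      ∃ (T : Type) (_ : AddCommGroup T) (_ : Module ℂ T) (Θ : Representation ℂ A T),
        IsBigTheta (swapRep Ω) τ Θ ∧
          (HasNoIrreducibleQuotient Θ (fun σ => S (extTensor σ τ)) ∨
            HasUniqueIrreducibleQuotient Θ (fun σ => S (extTensor σ τ)))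

end Theta

section IrrE

variable {M₁ M₂ : Type*} [Monoid M₁] [Monoid M₂]
  {N₁ : Submonoid M₁} {N₂ : Submonoid M₂} {h₁ : IsCentric N₁} {h₂ : IsCentric N₂}

/-- `IrrE ι π`: the representation `π` of `M₁ × M₂` is irreducible and has an apex of the form
`(f, f)`, that is `(f₁, f₂)` with `f₁ ∈ E(M₁)` and `f₂ ∈ E(M₂)` corresponding to each other
under `ι`. -/
def IrrE (ι : CentricQuotient N₁ h₁ ≃* CentricQuotient N₂ h₂)
    {X : Type} [AddCommGroup X] [Module ℂ X] (π : Representation ℂ (M₁ × M₂) X) : Prop :=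
  π.IsIrreducible ∧ ∃ (f₁ : M₁) (f₂ : M₂), IsIdempotentElem f₁ ∧ IsIdempotentElem f₂ ∧
    ι (toQuotient N₁ h₁ f₁) = toQuotient N₂ h₂ f₂ ∧ IsApex π (f₁, f₂)

/-- The induced representation `Ind_Γ^M ρ` on the space of functions `φ : M → W` with
`φ (γ m) = ρ γ (φ m)`, where `M` acts by right translation. -/
abbrev Ind {M W : Type*} [Monoid M] [AddCommGroup W] [Module ℂ W] (Γ : Submonoid M)
    (ρ : Representation ℂ Γ W) :
    Representation ℂ M (Representation.coindV Γ.subtype ρ) :=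
  Representation.coind Γ.subtype ρ

end IrrE

end ThetaMonoid

end

noncomputable section

namespace ThetaMonoid

/-! ### Generalities on representations -/

section General

variable {M V V' X : Type*} [Monoid M] [AddCommGroup V] [Module ℂ V] [AddCommGroup V']
  [Module ℂ V'] [AddCommGroup X] [Module ℂ X]

open Representation

/-! The proof reduces the statement to finite groups, and the theta condition to a commutation
property of endomorphism algebras.

Semisimplicity makes each monoid von Neumann regular, and `mM = Mm` then yields a uniform `k` with
`m ^ (k + 1) = m` and makes all idempotents central (`exists_isCliffordWithExponent`). At an
idempotent `e` the elements with `m ^ k = e` form a group `G`, and `m ↦ m * e`, replaced by `0`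
outside `G`, is multiplicative (`exists_maximalSubgroup`). Put `f = (f₁, f₂)`, with groups `G₁`,
`G₂`, and `H = Γ ∩ (G₁ × G₂)`. The apex condition forces `ρ f = 1` and `ρ γ = 0` unless `f` lies in
the two-sided ideal of `γ`, so `ρ` amounts to a representation of `H`. A constituent of the induced
representation lying in the class has apex exactly `f`. The idempotents strictly below `f` vanish on
it, so its multiplicity can be computed on functions on `G₁ × G₂`, that is, in the inflation of the
representation coinduced from `H` (`nonempty_linearEquiv_of_vanish`).

A semisimple representation of `A × B` is theta exactly when its irreducible constituents `σ ⊗ τ`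
have multiplicity one and `σ` and `τ` determine each other. This is equivalent to the commutants of
`A` and `B` commuting (`leftMultiplicityFree_and_swap_iff`), a criterion free of any classification
of irreducibles.

The isomorphism `ι` makes `H` project onto both `G₁` and `G₂`, as in Goursat's lemma, and `N₁`, `N₂`
map onto `H ∩ G₁`, `H ∩ G₂`. It remains to compare commutants on `W` and on the coinduced space
(`kernelCommutantsCommute_iff_coind`). An operator commuting with `G₁` is a sum of translations in
the second variable with coefficients commuting with `H ∩ G₁`, and symmetrically for `G₂`.
Translations in different variables commute, so only the coefficients matter. Conversely, a
coefficient extends to an operator by conjugating it along a section of the projection. -/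

lemma IsIrreducible.eq_bot_or_eq_top_of_submodule {π : Representation ℂ M X} (h : π.IsIrreducible)
    (K : Submodule ℂ X) (hK : ∀ m, ∀ x ∈ K, π m x ∈ K) : K = ⊥ ∨ K = ⊤ := by
  rcases h.eq_bot_or_eq_top ⟨K, fun m x hx => hK m x hx⟩ with h | h
  · exact Or.inl (congrArg Subrepresentation.toSubmodule h)
  · exact Or.inr (congrArg Subrepresentation.toSubmodule h)

lemma isIrreducible_iff_submodule (π : Representation ℂ M X) :
    π.IsIrreducible ↔ Nontrivial X ∧
      ∀ K : Submodule ℂ X, (∀ m, ∀ x ∈ K, π m x ∈ K) → K = ⊥ ∨ K = ⊤ := by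
  constructor
  · intro h
    refine ⟨?_, IsIrreducible.eq_bot_or_eq_top_of_submodule h⟩
    by_contra hX
    rw [not_nontrivial_iff_subsingleton] at hX
    refine (bot_ne_top (α := Subrepresentation π)) ?_
    exact Subrepresentation.toSubmodule_injective (Subsingleton.elim _ _)
  · rintro ⟨hX, h⟩
    have : Nontrivial (Subrepresentation π) :=
      ⟨⊥, ⊤, fun e => bot_ne_top (α := Submodule ℂ X)
        (congrArg Subrepresentation.toSubmodule e)⟩
    refine ⟨fun K => ?_⟩
    rcases h K.toSubmodule (fun m x hx => K.apply_mem_toSubmodule m hx) with h | h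
    · exact Or.inl (Subrepresentation.toSubmodule_injective h)
    · exact Or.inr (Subrepresentation.toSubmodule_injective h)

lemma IsIrreducible.nontrivial {π : Representation ℂ M X} (h : π.IsIrreducible) :
    Nontrivial X := ((isIrreducible_iff_submodule π).1 h).1

/-- The finite orbit of a nonzero vector spans an invariant subspace. -/
lemma IsIrreducible.finiteDimensional [Finite M] {π : Representation ℂ M X}
    (h : π.IsIrreducible) : FiniteDimensional ℂ X := by
  have := IsIrreducible.nontrivial h
  obtain ⟨x, hx⟩ := exists_ne (0 : X)
  rcases IsIrreducible.eq_bot_or_eq_top_of_submodule h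
    (Submodule.span ℂ (Set.range fun m => π m x)) (by
      intro m y hy
      have : Submodule.span ℂ (Set.range fun m => π m x) ≤
          (Submodule.span ℂ (Set.range fun m => π m x)).comap (π m) := by
        rw [Submodule.span_le]
        rintro _ ⟨n, rfl⟩
        refine Submodule.subset_span ⟨m * n, ?_⟩
        simp
      exact this hy) with h' | h'
  · exfalso
    apply hx
    rw [← Submodule.mem_bot ℂ, ← h']
    exact Submodule.subset_span ⟨1, by simp⟩
  · rw [FiniteDimensional, Module.finite_def, ← h']
    exact Submodule.fg_span (Set.finite_range _)

lemma isIrreducible_of_equiv {π : Representation ℂ M X} {π' : Representation ℂ M V}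
    (e : π.Equiv π') (h : π.IsIrreducible) : π'.IsIrreducible := by
  rw [isIrreducible_iff_submodule] at h ⊢
  obtain ⟨h0, h⟩ := h
  refine ⟨e.toLinearEquiv.symm.toEquiv.nontrivial, fun K hK => ?_⟩
  rcases h (K.comap e.toLinearMap) (fun m x hx => by
      rw [Submodule.mem_comap] at hx ⊢
      have : e.toLinearMap (π m x) = π' m (e.toLinearMap x) :=
        e.toIntertwiningMap.isIntertwining _ _ m x
      exact this ▸ hK m _ hx) with h | h
  · left
    rw [eq_bot_iff]
    intro x hx
    have : e.toLinearEquiv.symm x ∈ K.comap e.toLinearMap := by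
      rw [Submodule.mem_comap]
      exact (e.toLinearEquiv.apply_symm_apply x).symm ▸ hx
    rw [h, Submodule.mem_bot] at this
    exact (LinearEquiv.map_eq_zero_iff _).1 this
  · right
    rw [eq_top_iff]
    intro x _
    have : e.toLinearEquiv.symm x ∈ K.comap e.toLinearMap := by rw [h]; trivial
    rw [Submodule.mem_comap] at this
    exact (e.toLinearEquiv.apply_symm_apply x) ▸ this

/-- Transport of a representation along a linear equivalence. -/
def transport (π : Representation ℂ M V) (e : V ≃ₗ[ℂ] X) : Representation ℂ M X :=
  (e.conjRingEquiv : Module.End ℂ V →* Module.End ℂ X).comp π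

def transportEquiv (π : Representation ℂ M V) (e : V ≃ₗ[ℂ] X) : π.Equiv (transport π e) :=
  Representation.Equiv.mk e (by
    intro g
    ext v
    simp [transport])


lemma intertwiningMap_ne_zero {π : Representation ℂ M V} {π' : Representation ℂ M X}
    {f : π.IntertwiningMap π'} : f ≠ 0 ↔ ∃ v, f v ≠ 0 := by
  rw [ne_eq, ← not_forall_not]
  simp only [not_not]
  refine not_congr ⟨fun h v => by rw [h]; rfl, fun h => ?_⟩
  ext v
  exact h v

/-- A nontrivial finite-dimensional representation has a minimal nonzero invariant subspace in
every nonzero invariant subspace. -/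
lemma exists_minimal_submodule [FiniteDimensional ℂ V] (π : Representation ℂ M V)
    (J : Submodule ℂ V) (hJ : ∀ m, ∀ v ∈ J, π m v ∈ J) (hJ0 : J ≠ ⊥) :
    ∃ U : Subrepresentation π, U.toRepresentation.IsIrreducible ∧ U.toSubmodule ≤ J := by
  obtain ⟨K, ⟨⟨hK, hK0⟩, hKJ⟩, hmin⟩ := WellFounded.has_min
    (wellFounded_lt (α := Submodule ℂ V))
    {K | ((∀ m, ∀ v ∈ K, π m v ∈ K) ∧ K ≠ ⊥) ∧ K ≤ J} ⟨J, ⟨hJ, hJ0⟩, le_rfl⟩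
  refine ⟨⟨K, fun m v hv => hK m v hv⟩, ?_, hKJ⟩
  rw [isIrreducible_iff_submodule]
  refine ⟨Submodule.nontrivial_iff_ne_bot.2 hK0, fun L hL => ?_⟩
  by_cases h0 : L = ⊥
  · exact Or.inl h0
  right
  have hle : L.map K.subtype ≤ K := Submodule.map_subtype_le K L
  have hnl : ¬ L.map K.subtype < K := by
    refine hmin _ ⟨⟨?_, ?_⟩, hle.trans hKJ⟩
    · rintro m _ ⟨x, hx, rfl⟩
      exact ⟨_, hL m x hx, rfl⟩
    · intro h
      apply h0
      rwa [← LinearMap.le_ker_iff_map, Submodule.ker_subtype, le_bot_iff] at h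
  have heq : L.map K.subtype = K := eq_of_le_of_not_lt hle hnl
  rw [eq_top_iff]
  rintro x -
  have : (x : V) ∈ L.map K.subtype := heq.symm ▸ x.2
  obtain ⟨y, hy, hyx⟩ := this
  exact (Subtype.ext hyx : y = x) ▸ hy

/-- A nontrivial finite-dimensional representation has an irreducible quotient. -/
lemma exists_irreducible_quotient [FiniteDimensional ℂ V] [Nontrivial V]
    (π : Representation ℂ M V) :
    ∃ (K : Submodule ℂ V) (hK : ∀ m, K ≤ K.comap (π m)), (π.quotient K hK).IsIrreducible := by
  obtain ⟨K, ⟨hK, hK1⟩, hmax⟩ := WellFounded.has_min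
    (wellFounded_gt (α := Submodule ℂ V))
    {K | (∀ m, K ≤ K.comap (π m)) ∧ K ≠ ⊤} ⟨⊥, fun m v hv => by
      rw [Submodule.mem_bot] at hv; simp [hv], bot_ne_top⟩
  refine ⟨K, hK, ?_⟩
  rw [isIrreducible_iff_submodule]
  refine ⟨Submodule.Quotient.nontrivial_iff.2 hK1, fun L hL => ?_⟩
  by_cases h1 : L = ⊤
  · exact Or.inr h1
  left
  have hle : K ≤ L.comap K.mkQ := by
    intro v hv
    rw [Submodule.mem_comap, (Submodule.Quotient.mk_eq_zero K (x := v)).2 hv |>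
      fun h => (h : K.mkQ v = 0)]
    exact L.zero_mem
  have hnl : ¬ K < L.comap K.mkQ := by
    refine hmax _ ⟨?_, ?_⟩
    · intro m v hv
      exact hL m _ hv
    · intro h
      apply h1
      rw [eq_top_iff]
      rintro x -
      obtain ⟨v, rfl⟩ := K.mkQ_surjective x
      have : v ∈ L.comap K.mkQ := h ▸ Submodule.mem_top
      exact this
  have heq : K = L.comap K.mkQ := eq_of_le_of_not_lt hle hnl
  rw [eq_bot_iff]
  intro x hx
  obtain ⟨v, rfl⟩ := K.mkQ_surjective x
  have : v ∈ K := heq.symm ▸ hx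
  exact (Submodule.Quotient.mk_eq_zero K).2 this

/-- Schur's lemma for linear maps. -/
lemma IsIrreducible.exists_eq_smul {π : Representation ℂ M X} (h : π.IsIrreducible)
    [FiniteDimensional ℂ X] (F : X →ₗ[ℂ] X) (hF : ∀ m x, F (π m x) = π m (F x)) :
    ∃ c : ℂ, ∀ x, F x = c • x := by
  let f : π.IntertwiningMap π := ⟨F, fun m => LinearMap.ext fun x => hF m x⟩
  obtain ⟨c, hc⟩ :=
    (IsIrreducible.algebraMap_intertwiningMap_bijective_of_isAlgClosed (ρ := π)).2 f
  refine ⟨c, fun x => ?_⟩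
  have := congrArg (fun g : π.IntertwiningMap π => g x) hc
  simp only [IntertwiningMap.algebraMap_apply] at this
  exact this.symm

lemma IsSemisimple.exists_rightInverse {π : Representation ℂ M V} {π' : Representation ℂ M X}
    (h : π.IsSemisimpleRepresentation) (f : π.IntertwiningMap π') (hf : Function.Surjective f) :
    ∃ s : π'.IntertwiningMap π, ∀ x, f (s x) = x := by
  have := (isSemisimpleRepresentation_iff_isSemisimpleModule_asModule π).1 h
  obtain ⟨s, hs⟩ := IsSemisimpleModule.lifting_property
    (IntertwiningMap.equivLinearMapAsModule π π' f) hf LinearMap.id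
  refine ⟨(IntertwiningMap.equivLinearMapAsModule π' π).symm s, fun x => ?_⟩
  exact LinearMap.congr_fun hs x

lemma IsSemisimple.exists_leftInverse {π : Representation ℂ M V} {π' : Representation ℂ M X}
    (h : π.IsSemisimpleRepresentation) (f : π'.IntertwiningMap π) (hf : Function.Injective f) :
    ∃ s : π.IntertwiningMap π', ∀ x, s (f x) = x := by
  have := (isSemisimpleRepresentation_iff_isSemisimpleModule_asModule π).1 h
  obtain ⟨s, hs⟩ := IsSemisimpleModule.extension_property
    (IntertwiningMap.equivLinearMapAsModule π' π f) hf LinearMap.id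
  refine ⟨(IntertwiningMap.equivLinearMapAsModule π π').symm s, fun x => ?_⟩
  exact LinearMap.congr_fun hs x

/-- In a finite-dimensional semisimple representation every nonzero invariant subspace contains an
irreducible direct summand. -/
lemma IsSemisimple.exists_summand [FiniteDimensional ℂ V] {π : Representation ℂ M V}
    (h : π.IsSemisimpleRepresentation) (J : Submodule ℂ V) (hJ : ∀ m, ∀ v ∈ J, π m v ∈ J)
    (hJ0 : J ≠ ⊥) :
    ∃ (n : ℕ) (π' : Representation ℂ M (Fin n → ℂ)) (i : π'.IntertwiningMap π)
      (p : π.IntertwiningMap π'), π'.IsIrreducible ∧ (∀ x, i x ∈ J) ∧ ∀ x, p (i x) = x := by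
  obtain ⟨U, hU, hUJ⟩ := exists_minimal_submodule π J hJ hJ0
  -- Coordinates give a model in `Type`, whatever the universe of `V`; the conditions quantified
  -- over `Type`, such as `KernelRigid`, can then be applied to the summand.
  let e : U.toSubmodule ≃ₗ[ℂ] (Fin (Module.finrank ℂ U.toSubmodule) → ℂ) :=
    (Module.finBasis ℂ U.toSubmodule).equivFun
  let E := transportEquiv U.toRepresentation e
  let i₀ : U.toRepresentation.IntertwiningMap π := ⟨U.toSubmodule.subtype, fun m => rfl⟩
  let i := i₀.comp E.symm.toIntertwiningMap
  obtain ⟨p, hp⟩ := IsSemisimple.exists_leftInverse h i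
    (fun x y hxy => EquivLike.injective E.symm (U.toSubmodule.injective_subtype hxy))
  exact ⟨_, _, i, p, isIrreducible_of_equiv E hU,
    fun x => hUJ (E.symm x).2, hp⟩

end General
end ThetaMonoid
namespace ThetaMonoid

/-! ### External tensor products -/

section Tensor

variable {A B U T T' V X : Type*} [Monoid A] [Monoid B] [AddCommGroup U] [Module ℂ U]
  [AddCommGroup T] [Module ℂ T] [AddCommGroup T'] [Module ℂ T'] [AddCommGroup V] [Module ℂ V]
  [AddCommGroup X] [Module ℂ X]

open Representation

@[simp] lemma extTensor_tmul (σ : Representation ℂ A U) (τ : Representation ℂ B T) (g : A × B)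
    (x : U) (y : T) : extTensor σ τ g (x ⊗ₜ y) = σ g.1 x ⊗ₜ[ℂ] τ g.2 y := rfl

/-- Contraction of the left factor of a tensor product against a linear form. -/
def contractLeft (T : Type*) [AddCommGroup T] [Module ℂ T] (l : U →ₗ[ℂ] ℂ) : U ⊗[ℂ] T →ₗ[ℂ] T :=
  (TensorProduct.lid ℂ T).toLinearMap ∘ₗ l.rTensor T

@[simp] lemma contractLeft_tmul (l : U →ₗ[ℂ] ℂ) (x : U) (y : T) :
    contractLeft T l (x ⊗ₜ y) = l x • y := by
  simp [contractLeft]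

/-- Contraction of the right factor of a tensor product against a linear form. -/
def contractRight (U : Type*) [AddCommGroup U] [Module ℂ U] (l : T →ₗ[ℂ] ℂ) :
    U ⊗[ℂ] T →ₗ[ℂ] U :=
  (TensorProduct.rid ℂ U).toLinearMap ∘ₗ l.lTensor U

@[simp] lemma contractRight_tmul (l : T →ₗ[ℂ] ℂ) (x : U) (y : T) :
    contractRight U l (x ⊗ₜ y) = l y • x := by
  simp [contractRight]

lemma exists_dual_eq_one {x : U} (hx : x ≠ 0) : ∃ l : U →ₗ[ℂ] ℂ, l x = 1 := by
  obtain ⟨l, hl⟩ : ∃ l : Module.Dual ℂ U, l x ≠ 0 := by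
    by_contra! h
    exact hx ((Module.forall_dual_apply_eq_zero_iff ℂ x).1 h)
  exact ⟨(l x)⁻¹ • l, by simp [hl]⟩

lemma tmul_right_injective {x : U} (hx : x ≠ 0) :
    Function.Injective fun y : T => x ⊗ₜ[ℂ] y := by
  obtain ⟨l, hl⟩ := exists_dual_eq_one hx
  intro y y' h
  have := congrArg (contractLeft T l) h
  simpa [hl] using this

lemma contractLeft_lTensor (l : U →ₗ[ℂ] ℂ) (t : T →ₗ[ℂ] T') (z : U ⊗[ℂ] T) :
    contractLeft T' l (t.lTensor U z) = t (contractLeft T l z) := by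
  induction z with
  | zero => simp
  | tmul x y => simp
  | add x y hx hy => simp [hx, hy]

lemma eq_sum_tmul_basis {ι : Type*} [Fintype ι] (b : Module.Basis ι ℂ T)
    (z : U ⊗[ℂ] T) : z = ∑ i, contractRight U (b.coord i) z ⊗ₜ[ℂ] b i := by
  induction z with
  | zero => simp
  | tmul x y =>
    simp only [contractRight_tmul, TensorProduct.smul_tmul, ← TensorProduct.tmul_sum]
    congr 1
    exact (b.sum_repr y).symm
  | add x y hx hy =>
    simp only [map_add, TensorProduct.add_tmul, Finset.sum_add_distrib]
    rw [← hx, ← hy]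

lemma eq_zero_of_contractRight [FiniteDimensional ℂ T] {z : U ⊗[ℂ] T}
    (h : ∀ l : T →ₗ[ℂ] ℂ, contractRight U l z = 0) : z = 0 := by
  rw [eq_sum_tmul_basis (Module.finBasis ℂ T) z]
  simp [h]

lemma extTensor_inl_apply (σ : Representation ℂ A U) (τ : Representation ℂ B T) (a : A)
    (z : U ⊗[ℂ] T) : extTensor σ τ (a, 1) z = (σ a).rTensor T z := by
  induction z with
  | zero => simp
  | tmul x y => simp
  | add x y hx hy => simp [hx, hy]

lemma extTensor_inr_apply (σ : Representation ℂ A U) (τ : Representation ℂ B T) (b : B)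
    (z : U ⊗[ℂ] T) : extTensor σ τ (1, b) z = (τ b).lTensor U z := by
  induction z with
  | zero => simp
  | tmul x y => simp
  | add x y hx hy => simp [hx, hy]

lemma contractRight_extTensor (σ : Representation ℂ A U) (τ : Representation ℂ B T)
    (l : T →ₗ[ℂ] ℂ) (a : A) (z : U ⊗[ℂ] T) :
    contractRight U l (extTensor σ τ (a, 1) z) = σ a (contractRight U l z) := by
  induction z with
  | zero => simp
  | tmul x y => simp
  | add x y hx hy => simp [hx, hy]

/-- A linear map `U → U ⊗ T` commuting with an irreducible action on `U` is of the form
`x ↦ x ⊗ y`. -/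
lemma IsIrreducible.exists_eq_tmul {σ : Representation ℂ A U} (h : σ.IsIrreducible)
    [FiniteDimensional ℂ U] [FiniteDimensional ℂ T] (F : U →ₗ[ℂ] U ⊗[ℂ] T)
    (hF : ∀ a x, F (σ a x) = (σ a).rTensor T (F x)) : ∃ y : T, ∀ x, F x = x ⊗ₜ y := by
  let b := Module.finBasis ℂ T
  -- Each coordinate of `F` along a basis of `T` is an endomorphism of `σ`, hence a scalar; these
  -- scalars are the coordinates of `y`.
  have key : ∀ i, ∃ c : ℂ, ∀ x, contractRight U (b.coord i) (F x) = c • x := by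
    intro i
    refine IsIrreducible.exists_eq_smul h (contractRight U (b.coord i) ∘ₗ F) fun a x => ?_
    rw [LinearMap.comp_apply, LinearMap.comp_apply, hF]
    exact contractRight_extTensor (B := Unit) σ 1 _ a (F x)
  choose c hc using key
  refine ⟨∑ i, c i • b i, fun x => ?_⟩
  rw [eq_sum_tmul_basis b (F x), TensorProduct.tmul_sum]
  refine Finset.sum_congr rfl fun i _ => ?_
  rw [hc, TensorProduct.smul_tmul]

/-- A linear map `U ⊗ T → U ⊗ T'` commuting with an irreducible action on `U` is of the form
`1 ⊗ t`. -/
lemma IsIrreducible.exists_eq_lTensor {σ : Representation ℂ A U} (h : σ.IsIrreducible)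
    [FiniteDimensional ℂ U] [FiniteDimensional ℂ T'] (F : U ⊗[ℂ] T →ₗ[ℂ] U ⊗[ℂ] T')
    (hF : ∀ a z, F ((σ a).rTensor T z) = (σ a).rTensor T' (F z)) :
    ∃ t : T →ₗ[ℂ] T', ∀ z, F z = t.lTensor U z := by
  have := IsIrreducible.nontrivial h
  obtain ⟨x₀, hx₀⟩ := exists_ne (0 : U)
  obtain ⟨l, hl⟩ := exists_dual_eq_one hx₀
  -- If `F = 1 ⊗ t`, then inserting `x₀` and contracting with `l`, where `l x₀ = 1`, recovers `t`.
  refine ⟨contractLeft T' l ∘ₗ F ∘ₗ TensorProduct.mk ℂ U T x₀, fun z => ?_⟩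
  induction z with
  | zero => simp
  | add x y hx hy => simp [hx, hy]
  | tmul x y =>
    obtain ⟨w, hw⟩ := IsIrreducible.exists_eq_tmul h (F ∘ₗ (TensorProduct.mk ℂ U T).flip y)
      (fun a x => by
        have := hF a (x ⊗ₜ y)
        simpa using this)
    simp only [LinearMap.comp_apply, LinearMap.flip_apply, TensorProduct.mk_apply] at hw
    simp [hw, hl]

lemma lTensor_rTensor_comm {U' : Type*} [AddCommGroup U'] [Module ℂ U'] (t : T →ₗ[ℂ] T')
    (s : U →ₗ[ℂ] U') (z : U ⊗[ℂ] T) :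
    t.lTensor U' (s.rTensor T z) = s.rTensor T' (t.lTensor U z) := by
  induction z with
  | zero => simp
  | tmul x y => simp
  | add x y hx hy => simp only [map_add, hx, hy]

lemma comm_lTensor (t : T →ₗ[ℂ] T') (z : U ⊗[ℂ] T) :
    TensorProduct.comm ℂ U T' (t.lTensor U z) = t.rTensor U (TensorProduct.comm ℂ U T z) := by
  induction z with
  | zero => simp
  | tmul x y => simp
  | add x y hx hy => simp only [map_add, hx, hy]

lemma comm_rTensor (t : T →ₗ[ℂ] T') (z : T ⊗[ℂ] U) :
    TensorProduct.comm ℂ T' U (t.rTensor U z) = t.lTensor U (TensorProduct.comm ℂ T U z) := by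
  induction z with
  | zero => simp
  | tmul x y => simp
  | add x y hx hy => simp only [map_add, hx, hy]

/-- A linear map `U ⊗ T → U' ⊗ T` commuting with an irreducible action on `T` is of the form
`s ⊗ 1`. -/
lemma IsIrreducible.exists_eq_rTensor {U' : Type*} [AddCommGroup U'] [Module ℂ U']
    {τ : Representation ℂ B T} (h : τ.IsIrreducible)
    [FiniteDimensional ℂ T] [FiniteDimensional ℂ U'] (F : U ⊗[ℂ] T →ₗ[ℂ] U' ⊗[ℂ] T)
    (hF : ∀ b z, F ((τ b).lTensor U z) = (τ b).lTensor U' (F z)) :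
    ∃ s : U →ₗ[ℂ] U', ∀ z, F z = s.rTensor T z := by
  obtain ⟨s, hs⟩ := IsIrreducible.exists_eq_lTensor h
    ((TensorProduct.comm ℂ U' T).toLinearMap ∘ₗ F ∘ₗ (TensorProduct.comm ℂ T U).toLinearMap)
    (fun b z => by
      change TensorProduct.comm ℂ U' T (F (TensorProduct.comm ℂ T U _)) =
        (τ b).rTensor U' (TensorProduct.comm ℂ U' T (F (TensorProduct.comm ℂ T U z)))
      rw [comm_rTensor, hF, comm_lTensor])
  refine ⟨s, fun z => (TensorProduct.comm ℂ U' T).injective ?_⟩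
  rw [comm_rTensor, ← hs]
  change _ = TensorProduct.comm ℂ U' T (F (TensorProduct.comm ℂ T U (TensorProduct.comm ℂ U T z)))
  rw [TensorProduct.comm_comm]

lemma isIrreducible_extTensor {σ : Representation ℂ A U} {τ : Representation ℂ B T}
    (hσ : σ.IsIrreducible) (hτ : τ.IsIrreducible) [FiniteDimensional ℂ U]
    [FiniteDimensional ℂ T] : (extTensor σ τ).IsIrreducible := by
  have hU := IsIrreducible.nontrivial hσ
  have hT := IsIrreducible.nontrivial hτ
  obtain ⟨x₀, hx₀⟩ := exists_ne (0 : U)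
  obtain ⟨y₀, hy₀⟩ := exists_ne (0 : T)
  rw [isIrreducible_iff_submodule]
  refine ⟨⟨x₀ ⊗ₜ y₀, 0, fun e => hy₀ (tmul_right_injective hx₀ (by simpa using e))⟩,
    fun K hK => ?_⟩
  by_cases hK0 : K = ⊥
  · exact Or.inl hK0
  right
  -- A suitable contraction identifies the irreducible `A`-subspace `L` of `K` with `U`. Its inverse
  -- embeds `U` in `K`, necessarily as `x ↦ x ⊗ y`.
  obtain ⟨L, hL, hLK⟩ := exists_minimal_submodule (resLeft (extTensor σ τ)) K
    (fun a z hz => hK (a, 1) z hz) hK0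
  obtain ⟨w, hw⟩ := @exists_ne _ (IsIrreducible.nontrivial hL) 0
  obtain ⟨l, hl⟩ : ∃ l : T →ₗ[ℂ] ℂ, contractRight U l (w : U ⊗[ℂ] T) ≠ 0 := by
    by_contra! h
    exact hw (Subtype.ext (eq_zero_of_contractRight h))
  let c : L.toRepresentation.IntertwiningMap σ :=
    ⟨contractRight U l ∘ₗ L.toSubmodule.subtype, fun a => LinearMap.ext fun z =>
      contractRight_extTensor σ τ l a (z : U ⊗[ℂ] T)⟩
  have hc : Function.Bijective c := by
    refine (IsIrreducible.bijective_or_eq_zero c).resolve_right ?_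
    exact intertwiningMap_ne_zero.2 ⟨w, hl⟩
  let e := IntertwiningMap.ofBijective c hc
  obtain ⟨y, hy⟩ := IsIrreducible.exists_eq_tmul hσ
    (L.toSubmodule.subtype ∘ₗ e.symm.toLinearMap) (fun a x => by
      have : e.symm (σ a x) = L.toRepresentation a (e.symm x) :=
        e.symm.toIntertwiningMap.isIntertwining _ _ a x
      refine (congrArg Subtype.val this).trans ?_
      change extTensor σ τ (a, 1) (e.symm x : U ⊗[ℂ] T) = _
      exact extTensor_inl_apply σ τ a _)
  have hyK : ∀ x, x ⊗ₜ[ℂ] y ∈ K := fun x => by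
    rw [← hy]
    exact hLK (e.symm x).2
  -- The vectors `y` with `U ⊗ y ⊆ K` form a `B`-invariant subspace, nonzero by the previous step,
  -- so irreducibility of `τ` applies.
  let Q : Submodule ℂ T :=
    { carrier := {y | ∀ x : U, x ⊗ₜ[ℂ] y ∈ K}
      add_mem' := fun h h' x => by rw [TensorProduct.tmul_add]; exact K.add_mem (h x) (h' x)
      zero_mem' := fun x => by simp
      smul_mem' := fun r y h x => by rw [TensorProduct.tmul_smul]; exact K.smul_mem r (h x) }
  have hQ : Q = ⊤ := by
    refine (IsIrreducible.eq_bot_or_eq_top_of_submodule hτ Q ?_).resolve_left ?_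
    · intro b y hy x
      have := hK (1, b) _ (hy x)
      simpa using this
    · intro h0
      have hy0 : y = 0 := by
        rw [← Submodule.mem_bot ℂ, ← h0]
        exact hyK
      have h1 : ((e.symm (e w) : L.toSubmodule) : U ⊗[ℂ] T) = 0 := by
        refine (hy (e w)).trans ?_
        rw [hy0, TensorProduct.tmul_zero]
      rw [e.symm_apply_apply] at h1
      exact hw (Subtype.ext h1)
  rw [eq_top_iff]
  rintro z -
  induction z with
  | zero => exact K.zero_mem
  | add x y hx hy => exact K.add_mem hx hy
  | tmul x y =>
    have : y ∈ Q := hQ ▸ Submodule.mem_top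
    exact this x

/-- An invariant `K ⊆ T` gives the invariant subspace `U ⊗ K`, from which `K` is recovered by
contraction. -/
lemma IsIrreducible.of_extTensor_right {σ : Representation ℂ A U} {τ : Representation ℂ B T}
    (h : (extTensor σ τ).IsIrreducible) : τ.IsIrreducible := by
  rw [isIrreducible_iff_submodule] at h
  obtain ⟨hn, h⟩ := h
  have hU : Nontrivial U := by
    by_contra hU
    rw [not_nontrivial_iff_subsingleton] at hU
    exact not_subsingleton (U ⊗[ℂ] T) inferInstance
  have hT : Nontrivial T := by
    by_contra hT
    rw [not_nontrivial_iff_subsingleton] at hT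
    exact not_subsingleton (U ⊗[ℂ] T) inferInstance
  obtain ⟨x₀, hx₀⟩ := exists_ne (0 : U)
  obtain ⟨l, hl⟩ := exists_dual_eq_one hx₀
  rw [isIrreducible_iff_submodule]
  refine ⟨hT, fun K hK => ?_⟩
  rcases h (LinearMap.range (K.subtype.lTensor U)) (by
    rintro ⟨a, b⟩ _ ⟨z, rfl⟩
    refine ⟨TensorProduct.map (σ a) ((τ b).restrict (hK b)) z, ?_⟩
    induction z with
    | zero => simp
    | add x y hx hy => simp only [map_add, hx, hy]
    | tmul x y => simp) with h | h
  · left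
    rw [eq_bot_iff]
    intro y hy
    have : x₀ ⊗ₜ[ℂ] y ∈ LinearMap.range (K.subtype.lTensor U) := ⟨x₀ ⊗ₜ ⟨y, hy⟩, by simp⟩
    rw [h, Submodule.mem_bot] at this
    exact tmul_right_injective hx₀ (by simpa using this)
  · right
    rw [eq_top_iff]
    rintro y -
    have : x₀ ⊗ₜ[ℂ] y ∈ LinearMap.range (K.subtype.lTensor U) := by rw [h]; trivial
    obtain ⟨z, hz⟩ := this
    have := congrArg (contractLeft T l) hz
    rw [contractLeft_lTensor, contractLeft_tmul, hl, one_smul] at this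
    exact this ▸ Submodule.coe_mem _

end Tensor
end ThetaMonoid
namespace ThetaMonoid

/-! ### Isotypic representations and big theta lifts -/

section BigTheta

variable {A B U T T' V X : Type*} [Monoid A] [Monoid B] [AddCommGroup U] [Module ℂ U]
  [AddCommGroup T] [Module ℂ T] [AddCommGroup T'] [Module ℂ T'] [AddCommGroup V] [Module ℂ V]
  [AddCommGroup X] [Module ℂ X]

open Representation

/-- If no surjection onto a power of `σ` were injective, each could be enlarged by one more copy of
`σ`, against the finite dimension of `V`. -/
lemma exists_equiv_pi [FiniteDimensional ℂ V] [FiniteDimensional ℂ U]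
    (α : Representation ℂ A V) {σ : Representation ℂ A U} (hσ : σ.IsIrreducible)
    (h : ∀ v, (∀ f : α.IntertwiningMap σ, f v = 0) → v = 0) :
    ∃ (n : ℕ) (e : V ≃ₗ[ℂ] (Fin n → U)), ∀ a v i, e (α a v) i = σ a (e v i) := by
  have hU := IsIrreducible.nontrivial hσ
  by_contra! hcon
  have key : ∀ n : ℕ, ∃ F : V →ₗ[ℂ] (Fin n → U), Function.Surjective F ∧
      ∀ a v i, F (α a v) i = σ a (F v i) := by
    intro n
    induction n with
    | zero => exact ⟨0, fun x => ⟨0, Subsingleton.elim _ _⟩, fun a v i => i.elim0⟩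
    | succ n ih =>
      obtain ⟨F, hF, hFe⟩ := ih
      obtain ⟨v, hv, hv0⟩ : ∃ v, F v = 0 ∧ v ≠ 0 := by
        by_contra! hinj
        obtain ⟨a, v, i, hne⟩ := hcon n (LinearEquiv.ofBijective F
          ⟨(injective_iff_map_eq_zero F).2 hinj, hF⟩)
        exact hne (hFe a v i)
      obtain ⟨f, hf⟩ : ∃ f : α.IntertwiningMap σ, f v ≠ 0 := by
        by_contra! hf
        exact hv0 (h v hf)
      -- Since `f` is nonzero on the invariant subspace `ker F`, it maps it onto `σ`; this is what
      -- makes the pair `(f, F)` surjective.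
      have hker : (LinearMap.ker F).map f.toLinearMap = ⊤ := by
        refine (IsIrreducible.eq_bot_or_eq_top_of_submodule hσ _ ?_).resolve_left ?_
        · rintro a _ ⟨w, hw, rfl⟩
          refine ⟨α a w, ?_, f.isIntertwining _ _ a w⟩
          change F w = 0 at hw
          change F (α a w) = 0
          ext i
          rw [hFe, hw]
          simp
        · intro h0
          have : f v ∈ (LinearMap.ker F).map f.toLinearMap := ⟨v, hv, rfl⟩
          rw [h0, Submodule.mem_bot] at this
          exact hf this
      refine ⟨LinearMap.pi (Fin.cons f.toLinearMap fun i => LinearMap.proj i ∘ₗ F), ?_, ?_⟩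
      · intro x
        obtain ⟨w, hw⟩ := hF (fun i => x i.succ)
        have hk : x 0 - f w ∈ (LinearMap.ker F).map f.toLinearMap := by rw [hker]; trivial
        obtain ⟨k, hk, hkx⟩ := hk
        change F k = 0 at hk
        change f k = _ at hkx
        refine ⟨w + k, ?_⟩
        ext i
        refine Fin.cases ?_ (fun i => ?_) i
        · simp [hkx]
        · simp [hk, hw]
      · intro a v i
        refine Fin.cases ?_ (fun i => ?_) i
        · exact f.isIntertwining _ _ a v
        · exact hFe a v i
  obtain ⟨F, hF, -⟩ := key (Module.finrank ℂ V + 1)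
  have h1 := LinearMap.finrank_le_finrank_of_surjective hF
  rw [Module.finrank_pi_fintype] at h1
  have h2 : 0 < Module.finrank ℂ U := Module.finrank_pos
  simp only [Finset.sum_const, Finset.card_univ, Fintype.card_fin, smul_eq_mul] at h1
  nlinarith

/-- A representation of `A × B` which is isotypic as a representation of `A` is an external
tensor product. -/
lemma exists_equiv_extTensor [FiniteDimensional ℂ V] [FiniteDimensional ℂ U]
    (Ω : Representation ℂ (A × B) V) {σ : Representation ℂ A U} (hσ : σ.IsIrreducible)
    (h : ∀ v, (∀ f : (resLeft Ω).IntertwiningMap σ, f v = 0) → v = 0) :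
    ∃ (n : ℕ) (Θ : Representation ℂ B (Fin n → ℂ)), Nonempty (Ω.Equiv (extTensor σ Θ)) := by
  have hU := IsIrreducible.nontrivial hσ
  obtain ⟨x₀, hx₀⟩ := exists_ne (0 : U)
  obtain ⟨n, e₀, he₀⟩ := exists_equiv_pi (resLeft Ω) hσ h
  let e : V ≃ₗ[ℂ] U ⊗[ℂ] (Fin n → ℂ) := e₀.trans (TensorProduct.piScalarRight ℂ ℂ U (Fin n)).symm
  have hpi : ∀ a (z : U ⊗[ℂ] (Fin n → ℂ)) i,
      TensorProduct.piScalarRight ℂ ℂ U (Fin n) ((σ a).rTensor _ z) i =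
        σ a (TensorProduct.piScalarRight ℂ ℂ U (Fin n) z i) := by
    intro a z i
    induction z with
    | zero => simp
    | tmul x y => simp
    | add x y hx hy => simp only [map_add, Pi.add_apply, hx, hy]
  have he : ∀ a v, e (Ω (a, 1) v) = (σ a).rTensor _ (e v) := by
    intro a v
    apply (TensorProduct.piScalarRight ℂ ℂ U (Fin n)).injective
    ext i
    rw [hpi]
    simp only [e, LinearEquiv.trans_apply, LinearEquiv.apply_symm_apply]
    exact he₀ a v i
  -- The action of `b` commutes with that of `A`, so it has the form `1 ⊗ t`.
  have hθ : ∀ b : B, ∃ t : (Fin n → ℂ) →ₗ[ℂ] (Fin n → ℂ), ∀ v,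
      e (Ω (1, b) v) = t.lTensor U (e v) := by
    intro b
    obtain ⟨t, ht⟩ := IsIrreducible.exists_eq_lTensor hσ
      (e.toLinearMap ∘ₗ Ω (1, b) ∘ₗ e.symm.toLinearMap) (fun a z => by
        obtain ⟨v, rfl⟩ := e.surjective z
        simp only [LinearMap.comp_apply, LinearEquiv.coe_coe, e.symm_apply_apply]
        rw [← he, ← he, e.symm_apply_apply, ← Module.End.mul_apply, ← Module.End.mul_apply,
          ← map_mul, ← map_mul]
        simp)
    exact ⟨t, fun v => by simpa using ht (e v)⟩
  choose θ hθ using hθ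
  -- The operator `1 ⊗ t` determines `t`, so multiplicativity of `b ↦ t` is inherited from `Ω`.
  have huniq : ∀ t t' : (Fin n → ℂ) →ₗ[ℂ] (Fin n → ℂ),
      (∀ v, t.lTensor U (e v) = t'.lTensor U (e v)) → t = t' := by
    intro t t' htt
    refine LinearMap.ext fun y => ?_
    have := htt (e.symm (x₀ ⊗ₜ y))
    rw [e.apply_symm_apply, LinearMap.lTensor_tmul, LinearMap.lTensor_tmul] at this
    exact tmul_right_injective hx₀ this
  let Θ : Representation ℂ B (Fin n → ℂ) :=
    { toFun := θ
      map_one' := huniq _ _ fun v => by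
        rw [← hθ]
        change e (Ω 1 v) = _
        simp [Module.End.one_eq_id]
      map_mul' := fun b b' => huniq _ _ fun v => by
        rw [← hθ, Module.End.mul_eq_comp, LinearMap.lTensor_comp, LinearMap.comp_apply, ← hθ,
          ← hθ, ← Module.End.mul_apply, ← map_mul]
        simp }
  refine ⟨n, Θ, ⟨Representation.Equiv.mk e fun g => LinearMap.ext fun v => ?_⟩⟩
  obtain ⟨a, b⟩ := g
  have h1 : Ω (a, b) v = Ω (a, 1) (Ω (1, b) v) := by
    rw [← Module.End.mul_apply, ← map_mul]; simp
  have h2 : extTensor σ Θ (a, b) (e v) = extTensor σ Θ (a, 1) (extTensor σ Θ (1, b) (e v)) := by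
    rw [← Module.End.mul_apply, ← map_mul]; simp
  change e (Ω (a, b) v) = extTensor σ Θ (a, b) (e v)
  rw [h1, h2, he, hθ, extTensor_inl_apply, extTensor_inr_apply]
  rfl

lemma mem_isotypicKer {Ω : Representation ℂ (A × B) V} {σ : Representation ℂ A U} {v : V} :
    v ∈ isotypicKer Ω σ ↔ ∀ f : (resLeft Ω).IntertwiningMap σ, f v = 0 := by
  rw [isotypicKer, Submodule.mem_iInf]
  rfl

lemma exists_isBigTheta [FiniteDimensional ℂ V] [FiniteDimensional ℂ U]
    (Ω : Representation ℂ (A × B) V) {σ : Representation ℂ A U} (hσ : σ.IsIrreducible) :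
    ∃ (n : ℕ) (Θ : Representation ℂ B (Fin n → ℂ)), IsBigTheta Ω σ Θ := by
  refine exists_equiv_extTensor (isotypicQuotient Ω σ) hσ fun v hv => ?_
  obtain ⟨v, rfl⟩ := (isotypicKer Ω σ).mkQ_surjective v
  refine (Submodule.Quotient.mk_eq_zero _).2 (mem_isotypicKer.2 fun f => ?_)
  exact hv ⟨(isotypicKer Ω σ).liftQ f.toLinearMap fun w hw => mem_isotypicKer.1 hw f,
    fun a => by
      ext w
      exact f.isIntertwining _ _ a w⟩

lemma IsBigTheta.finiteDimensional [FiniteDimensional ℂ V] [Nontrivial U]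
    {Ω : Representation ℂ (A × B) V} {σ : Representation ℂ A U} {Θ : Representation ℂ B T}
    (h : IsBigTheta Ω σ Θ) : FiniteDimensional ℂ T := by
  obtain ⟨e⟩ := h
  obtain ⟨x₀, hx₀⟩ := exists_ne (0 : U)
  exact FiniteDimensional.of_injective
    (e.toLinearEquiv.symm.toLinearMap ∘ₗ TensorProduct.mk ℂ U T x₀)
    (fun y y' hy => tmul_right_injective hx₀ (e.toLinearEquiv.symm.injective hy))

/-- Maps from `Ω` to `σ ⊗ τ` factor through the `σ`-isotypic quotient `σ ⊗ Θ`, and maps `σ ⊗ Θ → σ ⊗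
τ` are of the form `1 ⊗ t` by Schur. So the irreducible quotients of `Θ` can be read off from `Ω`.
-/
lemma IsBigTheta.exists_intertwiningMap_ne_zero_iff [FiniteDimensional ℂ V]
    [FiniteDimensional ℂ U] [FiniteDimensional ℂ X] {Ω : Representation ℂ (A × B) V}
    {σ : Representation ℂ A U} {Θ : Representation ℂ B T} (h : IsBigTheta Ω σ Θ)
    (hσ : σ.IsIrreducible) (τ : Representation ℂ B X) :
    (∃ f : Θ.IntertwiningMap τ, f ≠ 0) ↔ ∃ f : Ω.IntertwiningMap (extTensor σ τ), f ≠ 0 := by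
  have hU := IsIrreducible.nontrivial hσ
  obtain ⟨x₀, hx₀⟩ := exists_ne (0 : U)
  obtain ⟨e⟩ := h
  constructor
  · rintro ⟨f, hf⟩
    obtain ⟨y, hy⟩ := intertwiningMap_ne_zero.1 hf
    refine ⟨⟨f.toLinearMap.lTensor U ∘ₗ e.toLinearMap ∘ₗ (isotypicKer Ω σ).mkQ, fun g => ?_⟩, ?_⟩
    · ext v
      have h1 : e ((isotypicKer Ω σ).mkQ (Ω g v)) =
          extTensor σ Θ g (e ((isotypicKer Ω σ).mkQ v)) :=
        e.toIntertwiningMap.isIntertwining _ _ g ((isotypicKer Ω σ).mkQ v)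
      have h2 : ∀ z, f.toLinearMap.lTensor U (extTensor σ Θ g z) =
          extTensor σ τ g (f.toLinearMap.lTensor U z) := by
        intro z
        induction z with
        | zero => simp
        | tmul x y => simp [f.isIntertwining]
        | add x y hx hy => simp only [map_add, hx, hy]
      change f.toLinearMap.lTensor U (e ((isotypicKer Ω σ).mkQ (Ω g v))) = _
      rw [h1, h2]
      rfl
    · obtain ⟨v, hv⟩ := (isotypicKer Ω σ).mkQ_surjective (e.symm (x₀ ⊗ₜ y))
      refine intertwiningMap_ne_zero.2 ⟨v, fun h0 => hy ?_⟩
      change f.toLinearMap.lTensor U (e ((isotypicKer Ω σ).mkQ v)) = 0 at h0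
      rw [hv, e.apply_symm_apply, LinearMap.lTensor_tmul] at h0
      exact tmul_right_injective hx₀ (by simpa using h0)
  · rintro ⟨f, hf⟩
    obtain ⟨v, hv⟩ := intertwiningMap_ne_zero.1 hf
    -- Every contraction of `f` in the factor `τ` is an `A`-map to `σ`, and together the
    -- contractions detect zero.
    have hker : isotypicKer Ω σ ≤ LinearMap.ker f.toLinearMap := by
      intro w hw
      refine eq_zero_of_contractRight fun l => ?_
      exact mem_isotypicKer.1 hw ⟨contractRight U l ∘ₗ f.toLinearMap, fun a =>
        LinearMap.ext fun w => by
          have : f (Ω (a, 1) w) = extTensor σ τ (a, 1) (f w) := f.isIntertwining _ _ _ w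
          change contractRight U l (f (Ω (a, 1) w)) = σ a (contractRight U l (f w))
          rw [this, contractRight_extTensor]⟩
    let F : U ⊗[ℂ] T →ₗ[ℂ] U ⊗[ℂ] X :=
      (isotypicKer Ω σ).liftQ f.toLinearMap hker ∘ₗ e.symm.toLinearMap
    have hFe : ∀ w, F (e ((isotypicKer Ω σ).mkQ w)) = f w := by
      intro w
      change (isotypicKer Ω σ).liftQ f.toLinearMap hker (e.symm (e ((isotypicKer Ω σ).mkQ w))) = _
      rw [e.symm_apply_apply]
      rfl
    have hF : ∀ g z, F (extTensor σ Θ g z) = extTensor σ τ g (F z) := by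
      intro g z
      obtain ⟨w, hw⟩ := (isotypicKer Ω σ).mkQ_surjective (e.symm z)
      have hz : z = e ((isotypicKer Ω σ).mkQ w) := by rw [hw, e.apply_symm_apply]
      have h1 : e ((isotypicKer Ω σ).mkQ (Ω g w)) =
          extTensor σ Θ g (e ((isotypicKer Ω σ).mkQ w)) :=
        e.toIntertwiningMap.isIntertwining _ _ g ((isotypicKer Ω σ).mkQ w)
      rw [hz, ← h1, hFe, hFe]
      exact f.isIntertwining _ _ g w
    obtain ⟨t, ht⟩ := IsIrreducible.exists_eq_lTensor hσ F (fun a z => by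
      rw [← extTensor_inl_apply σ Θ, ← extTensor_inl_apply σ τ, hF])
    refine ⟨⟨t, fun b => LinearMap.ext fun y => ?_⟩, ?_⟩
    · have := hF (1, b) (x₀ ⊗ₜ y)
      rw [ht, ht] at this
      simp only [extTensor_tmul, map_one, Module.End.one_apply, LinearMap.lTensor_tmul] at this
      exact tmul_right_injective hx₀ this
    · intro h0
      have ht0 : t = 0 := congrArg IntertwiningMap.toLinearMap h0
      apply hv
      rw [← hFe, ht, ht0]
      simp

lemma isIrreducibleQuotient_iff {Θ : Representation ℂ B T} {τ : Representation ℂ B X} :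
    IsIrreducibleQuotient Θ τ ↔ τ.IsIrreducible ∧ ∃ f : Θ.IntertwiningMap τ, f ≠ 0 := by
  refine and_congr_right fun hτ => exists_congr fun f => ⟨fun hf h0 => ?_, fun hf =>
    (IsIrreducible.surjective_or_eq_zero f).resolve_right hf⟩
  have := IsIrreducible.nontrivial hτ
  obtain ⟨x, hx⟩ := exists_ne (0 : X)
  obtain ⟨y, hy⟩ := hf x
  rw [h0] at hy
  exact hx hy.symm

/-- Every finite-dimensional irreducible representation of `A × B` is an external tensor
product. -/
lemma IsIrreducible.exists_extTensor [Finite A] [FiniteDimensional ℂ X]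
    {π : Representation ℂ (A × B) X}
    (h : π.IsIrreducible) :
    ∃ (n m : ℕ) (σ : Representation ℂ A (Fin n → ℂ)) (τ : Representation ℂ B (Fin m → ℂ)),
      σ.IsIrreducible ∧ τ.IsIrreducible ∧ Nonempty (π.Equiv (extTensor σ τ)) := by
  have := IsIrreducible.nontrivial h
  obtain ⟨K, hK, hirr⟩ := exists_irreducible_quotient (resLeft π)
  let e : (X ⧸ K) ≃ₗ[ℂ] (Fin (Module.finrank ℂ (X ⧸ K)) → ℂ) :=
    (Module.finBasis ℂ (X ⧸ K)).equivFun
  let E := transportEquiv ((resLeft π).quotient K hK) e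
  have hσ := isIrreducible_of_equiv E hirr
  -- The isotypic kernel is invariant under all of `A × B`, and it is not everything because `σ` is
  -- an `A`-quotient. Hence it vanishes, and `π` is `σ`-isotypic.
  have hker : isotypicKer π (transport ((resLeft π).quotient K hK) e) = ⊥ := by
    refine (IsIrreducible.eq_bot_or_eq_top_of_submodule h _
      (isotypicKer_le_comap π _)).resolve_right fun htop => ?_
    obtain ⟨y, hy⟩ := @exists_ne _ (IsIrreducible.nontrivial hirr) 0
    obtain ⟨x, rfl⟩ := K.mkQ_surjective y
    have hx : x ∈ isotypicKer π (transport ((resLeft π).quotient K hK) e) := by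
      rw [htop]; trivial
    let q : (resLeft π).IntertwiningMap ((resLeft π).quotient K hK) := ⟨K.mkQ, fun a => rfl⟩
    have h1 := mem_isotypicKer.1 hx (E.toIntertwiningMap.comp q)
    exact hy ((LinearEquiv.map_eq_zero_iff e).1 h1)
  obtain ⟨m, τ, ⟨F⟩⟩ := exists_equiv_extTensor π hσ fun v hv => by
    rw [← Submodule.mem_bot ℂ, ← hker]
    exact mem_isotypicKer.2 hv
  exact ⟨_, m, _, τ, hσ, IsIrreducible.of_extTensor_right (isIrreducible_of_equiv F h), ⟨F⟩⟩

end BigTheta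
end ThetaMonoid
namespace ThetaMonoid

/-! ### Theta representations through multiplicities -/

section Multiplicity

variable {A B U T V X : Type*} [Monoid A] [Monoid B] [AddCommGroup U] [Module ℂ U]
  [AddCommGroup T] [Module ℂ T] [AddCommGroup V] [Module ℂ V]
  [AddCommGroup X] [Module ℂ X]

open Representation

/-- For pairs in the relation `R`, the multiplicities of `σ ⊗ τ` in the cosocle of `Ω` are at most
one, and `σ` determines `τ` when it is not zero. -/
structure LeftMultiplicityFree (Ω : Representation ℂ (A × B) V)
    (R : ∀ {X Y : Type} [AddCommGroup X] [Module ℂ X] [AddCommGroup Y] [Module ℂ Y],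
      Representation ℂ A X → Representation ℂ B Y → Prop) : Prop where
  rank_le_one : ∀ (X Y : Type) [AddCommGroup X] [Module ℂ X] [AddCommGroup Y] [Module ℂ Y]
    (σ : Representation ℂ A X) (τ : Representation ℂ B Y),
    σ.IsIrreducible → τ.IsIrreducible → R σ τ →
      Module.rank ℂ (Ω.IntertwiningMap (extTensor σ τ)) ≤ 1
  unique : ∀ (X Y Y' : Type) [AddCommGroup X] [Module ℂ X] [AddCommGroup Y] [Module ℂ Y]
    [AddCommGroup Y'] [Module ℂ Y'] (σ : Representation ℂ A X) (τ : Representation ℂ B Y)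
    (τ' : Representation ℂ B Y'), σ.IsIrreducible → τ.IsIrreducible → τ'.IsIrreducible →
      R σ τ → R σ τ' → (∃ f : Ω.IntertwiningMap (extTensor σ τ), f ≠ 0) →
      (∃ f : Ω.IntertwiningMap (extTensor σ τ'), f ≠ 0) → Nonempty (τ'.Equiv τ)

/-- Exchange of the two factors in homomorphisms to an external tensor product. -/
def swapHom (Ω : Representation ℂ (A × B) V) (σ : Representation ℂ A U)
    (τ : Representation ℂ B T) :
    Ω.IntertwiningMap (extTensor σ τ) ≃ₗ[ℂ] (swapRep Ω).IntertwiningMap (extTensor τ σ) where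
  toFun f := ⟨(TensorProduct.comm ℂ U T).toLinearMap ∘ₗ f.toLinearMap, fun g => by
    ext v
    have h1 : f (Ω g.swap v) = extTensor σ τ g.swap (f v) := f.isIntertwining _ _ _ v
    have h2 : ∀ z, TensorProduct.comm ℂ U T (extTensor σ τ g.swap z) =
        extTensor τ σ g (TensorProduct.comm ℂ U T z) := by
      intro z
      induction z with
      | zero => simp
      | tmul x y => simp
      | add x y hx hy => simp only [map_add, hx, hy]
    exact (congrArg (TensorProduct.comm ℂ U T) h1).trans (h2 _)⟩
  invFun f := ⟨(TensorProduct.comm ℂ T U).toLinearMap ∘ₗ f.toLinearMap, fun g => by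
    ext v
    have h1 : f (Ω g v) = extTensor τ σ g.swap (f v) := f.isIntertwining _ _ g.swap v
    have h2 : ∀ z, TensorProduct.comm ℂ T U (extTensor τ σ g.swap z) =
        extTensor σ τ g (TensorProduct.comm ℂ T U z) := by
      intro z
      induction z with
      | zero => simp
      | tmul x y => simp
      | add x y hx hy => simp only [map_add, hx, hy]
    exact (congrArg (TensorProduct.comm ℂ T U) h1).trans (h2 _)⟩
  map_add' f g := by ext v; exact map_add (TensorProduct.comm ℂ U T) _ _
  map_smul' c f := by ext v; exact map_smul (TensorProduct.comm ℂ U T) _ _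
  left_inv f := by
    ext v
    exact (TensorProduct.comm ℂ U T).symm_apply_apply (f v)
  right_inv f := by
    ext v
    exact (TensorProduct.comm ℂ U T).apply_symm_apply (f v)

/-- Removes big theta lifts from the condition: the irreducible quotients of any model of `Θ` are
the `τ` for which `Ω` has a nonzero map to `σ ⊗ τ`. -/
lemma exists_isBigTheta_unique_iff [FiniteDimensional ℂ V] [Finite A] [Finite B]
    (Ω : Representation ℂ (A × B) V) {σ : Representation ℂ A X} (hσ : σ.IsIrreducible)
    (P : ∀ {X : Type} [AddCommGroup X] [Module ℂ X], Representation ℂ B X → Prop) :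
    (∃ (T : Type) (_ : AddCommGroup T) (_ : Module ℂ T) (Θ : Representation ℂ B T),
        IsBigTheta Ω σ Θ ∧ (HasNoIrreducibleQuotient Θ P ∨ HasUniqueIrreducibleQuotient Θ P)) ↔
    ∀ (Y Y' : Type) [AddCommGroup Y] [Module ℂ Y] [AddCommGroup Y'] [Module ℂ Y']
      (τ : Representation ℂ B Y) (τ' : Representation ℂ B Y'), τ.IsIrreducible →
      τ'.IsIrreducible → P τ → P τ' → (∃ f : Ω.IntertwiningMap (extTensor σ τ), f ≠ 0) →
      (∃ f : Ω.IntertwiningMap (extTensor σ τ'), f ≠ 0) → Nonempty (τ'.Equiv τ) := by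
  have := IsIrreducible.finiteDimensional hσ
  constructor
  · rintro ⟨T, _, _, Θ, hΘ, h⟩ Y Y' _ _ _ _ τ τ' hτ hτ' hP hP' hf hf'
    have := IsIrreducible.finiteDimensional hτ
    have := IsIrreducible.finiteDimensional hτ'
    have hq := isIrreducibleQuotient_iff.2
      ⟨hτ, (hΘ.exists_intertwiningMap_ne_zero_iff hσ τ).2 hf⟩
    have hq' := isIrreducibleQuotient_iff.2
      ⟨hτ', (hΘ.exists_intertwiningMap_ne_zero_iff hσ τ').2 hf'⟩
    rcases h with h | ⟨Z, _, _, τ₀, -, h⟩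
    · exact absurd hP (h Y τ hq)
    · obtain ⟨e⟩ := h Y τ hq hP
      obtain ⟨e'⟩ := h Y' τ' hq' hP'
      exact ⟨e'.trans e.symm⟩
  · intro h
    obtain ⟨n, Θ, hΘ⟩ := exists_isBigTheta Ω hσ
    refine ⟨_, _, _, Θ, hΘ, ?_⟩
    rw [or_iff_not_imp_left]
    intro hno
    simp only [HasNoIrreducibleQuotient, not_forall, not_not] at hno
    obtain ⟨Y, _, _, τ, hq, hP⟩ := hno
    refine ⟨Y, _, _, τ, ⟨hq, hP⟩, fun Y' _ _ τ' hq' hP' => ?_⟩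
    rw [isIrreducibleQuotient_iff] at hq hq'
    have := IsIrreducible.finiteDimensional hq.1
    have := IsIrreducible.finiteDimensional hq'.1
    exact h Y Y' τ τ' hq.1 hq'.1 hP hP'
      ((hΘ.exists_intertwiningMap_ne_zero_iff hσ τ).1 hq.2)
      ((hΘ.exists_intertwiningMap_ne_zero_iff hσ τ').1 hq'.2)

lemma isThetaWithRespectTo_iff [FiniteDimensional ℂ V] [Finite A] [Finite B]
    (Ω : Representation ℂ (A × B) V)
    (S : ∀ {X : Type} [AddCommGroup X] [Module ℂ X], Representation ℂ (A × B) X → Prop) :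
    IsThetaWithRespectTo Ω S ↔
      LeftMultiplicityFree Ω (fun σ τ => S (extTensor σ τ)) ∧
      LeftMultiplicityFree (swapRep Ω) (fun τ σ => S (extTensor σ τ)) := by
  constructor
  · intro h
    refine ⟨⟨h.multiplicity, ?_⟩, ⟨?_, ?_⟩⟩
    · intro X Y Y' _ _ _ _ _ _ σ τ τ' hσ hτ hτ' hS hS'
      exact (exists_isBigTheta_unique_iff Ω hσ (fun τ => S (extTensor σ τ))).1
        (h.theta_left X σ hσ) Y Y' τ τ' hτ hτ' hS hS'
    · intro Y X _ _ _ _ τ σ hτ hσ hS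
      rw [← (swapHom Ω σ τ).rank_eq]
      exact h.multiplicity X Y σ τ hσ hτ hS
    · intro Y X X' _ _ _ _ _ _ τ σ σ' hτ hσ hσ' hS hS'
      exact (exists_isBigTheta_unique_iff (swapRep Ω) hτ (fun σ => S (extTensor σ τ))).1
        (h.theta_right Y τ hτ) X X' σ σ' hσ hσ' hS hS'
  · rintro ⟨h, h'⟩
    refine ⟨h.rank_le_one, fun X _ _ σ hσ => ?_, fun Y _ _ τ hτ => ?_⟩
    · exact (exists_isBigTheta_unique_iff Ω hσ (fun τ => S (extTensor σ τ))).2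
        fun Y Y' _ _ _ _ τ τ' hτ hτ' => h.unique X Y Y' σ τ τ' hσ hτ hτ'
    · exact (exists_isBigTheta_unique_iff (swapRep Ω) hτ (fun σ => S (extTensor σ τ))).2
        fun X X' _ _ _ _ σ σ' hσ hσ' => h'.unique Y X X' τ σ σ' hτ hσ hσ'

lemma hasNoIrreducibleQuotient_true_iff {T : Type} [AddCommGroup T]
    [Module ℂ T] [FiniteDimensional ℂ T] (Θ : Representation ℂ B T) :
    HasNoIrreducibleQuotient Θ (fun _ => True) ↔ Subsingleton T := by
  constructor
  · intro h
    rw [← not_nontrivial_iff_subsingleton]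
    intro hT
    obtain ⟨K, hK, hirr⟩ := exists_irreducible_quotient Θ
    exact h _ (Θ.quotient K hK) ⟨hirr, ⟨K.mkQ, fun a => rfl⟩, K.mkQ_surjective⟩ trivial
  · rintro hT X _ _ τ ⟨hτ, q, hq⟩ -
    have := IsIrreducible.nontrivial hτ
    exact not_subsingleton X hq.subsingleton

/-- A finite-dimensional space is zero exactly when it has no irreducible quotient, so the two forms
of the degenerate case agree. -/
lemma isTheta_iff_isThetaWithRespectTo [FiniteDimensional ℂ V] [Finite A] [Finite B]
    (Ω : Representation ℂ (A × B) V) :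
    IsTheta Ω ↔ IsThetaWithRespectTo Ω (fun _ => True) := by
  constructor
  · intro h
    refine ⟨fun X Y _ _ _ _ σ τ hσ hτ _ => h.multiplicity X Y σ τ hσ hτ,
      fun X _ _ σ hσ => ?_, fun Y _ _ τ hτ => ?_⟩
    · have := IsIrreducible.nontrivial hσ
      obtain ⟨T, _, _, Θ, hΘ, h⟩ := h.theta_left X σ hσ
      have := hΘ.finiteDimensional
      exact ⟨T, _, _, Θ, hΘ, h.imp_left (hasNoIrreducibleQuotient_true_iff Θ).2⟩
    · have := IsIrreducible.nontrivial hτ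
      obtain ⟨T, _, _, Θ, hΘ, h⟩ := h.theta_right Y τ hτ
      have := hΘ.finiteDimensional
      exact ⟨T, _, _, Θ, hΘ, h.imp_left (hasNoIrreducibleQuotient_true_iff Θ).2⟩
  · intro h
    refine ⟨fun X Y _ _ _ _ σ τ hσ hτ => h.multiplicity X Y σ τ hσ hτ trivial,
      fun X _ _ σ hσ => ?_, fun Y _ _ τ hτ => ?_⟩
    · have := IsIrreducible.nontrivial hσ
      obtain ⟨T, _, _, Θ, hΘ, h⟩ := h.theta_left X σ hσ
      have := hΘ.finiteDimensional
      exact ⟨T, _, _, Θ, hΘ, h.imp_left (hasNoIrreducibleQuotient_true_iff Θ).1⟩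
    · have := IsIrreducible.nontrivial hτ
      obtain ⟨T, _, _, Θ, hΘ, h⟩ := h.theta_right Y τ hτ
      have := hΘ.finiteDimensional
      exact ⟨T, _, _, Θ, hΘ, h.imp_left (hasNoIrreducibleQuotient_true_iff Θ).1⟩

end Multiplicity
end ThetaMonoid
namespace ThetaMonoid

/-! ### Theta representations through commutants -/

section Rigid

variable {A B U U' T T' V X X' : Type*} [Monoid A] [Monoid B] [AddCommGroup U] [Module ℂ U]
  [AddCommGroup U'] [Module ℂ U']
  [AddCommGroup T] [Module ℂ T] [AddCommGroup T'] [Module ℂ T'] [AddCommGroup V] [Module ℂ V]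
  [AddCommGroup X] [Module ℂ X] [AddCommGroup X'] [Module ℂ X']

open Representation

/-- Irreducible quotients of `Ω` which are related by a nonzero `A`-homomorphism are quotients by
the same kernel. -/
def KernelRigid (Ω : Representation ℂ (A × B) V) : Prop :=
  ∀ (X X' : Type) [AddCommGroup X] [Module ℂ X] [AddCommGroup X'] [Module ℂ X']
    (π : Representation ℂ (A × B) X) (π' : Representation ℂ (A × B) X'),
    π.IsIrreducible → π'.IsIrreducible → ∀ (p : Ω.IntertwiningMap π) (p' : Ω.IntertwiningMap π'),
      p ≠ 0 → p' ≠ 0 → ∀ t : X →ₗ[ℂ] X', (∀ a x, t (π (a, 1) x) = π' (a, 1) (t x)) → t ≠ 0 →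
        ∀ v, p v = 0 ↔ p' v = 0

/-- The commutant of `A` commutes with the commutant of `B`. -/
def CommutantsCommute (Ω : Representation ℂ (A × B) V) : Prop :=
  ∀ T S : V →ₗ[ℂ] V, (∀ a v, T (Ω (a, 1) v) = Ω (a, 1) (T v)) →
    (∀ b v, S (Ω (1, b) v) = Ω (1, b) (S v)) → ∀ v, T (S v) = S (T v)

lemma CommutantsCommute.swapRep {Ω : Representation ℂ (A × B) V} (h : CommutantsCommute Ω) :
    CommutantsCommute (swapRep Ω) :=
  fun T S hT hS v => (h S T hS hT v).symm

lemma exists_intertwiningMap_of_ker_le {M : Type*} [Monoid M] {Ω : Representation ℂ M V}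
    {π : Representation ℂ M X}
    {π' : Representation ℂ M X'} (p : Ω.IntertwiningMap π) (hp : Function.Surjective p)
    (p' : Ω.IntertwiningMap π') (h : ∀ v, p v = 0 → p' v = 0) :
    ∃ f : π.IntertwiningMap π', ∀ v, p' v = f (p v) := by
  have hker : LinearMap.ker p.toLinearMap ≤ LinearMap.ker p'.toLinearMap := h
  let F : X →ₗ[ℂ] X' := (LinearMap.ker p.toLinearMap).liftQ p'.toLinearMap hker ∘ₗ
    (p.toLinearMap.quotKerEquivOfSurjective hp).symm.toLinearMap
  have hF : ∀ v, F (p v) = p' v := by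
    intro v
    have : (p.toLinearMap.quotKerEquivOfSurjective hp).symm (p v) =
        (LinearMap.ker p.toLinearMap).mkQ v := by
      rw [LinearEquiv.symm_apply_eq]
      rfl
    change (LinearMap.ker p.toLinearMap).liftQ p'.toLinearMap hker
      ((p.toLinearMap.quotKerEquivOfSurjective hp).symm (p v)) = _
    rw [this]
    rfl
  refine ⟨⟨F, fun g => LinearMap.ext fun x => ?_⟩, fun v => (hF v).symm⟩
  obtain ⟨v, rfl⟩ := hp x
  change F (π g (p v)) = π' g (F (p v))
  rw [← p.isIntertwining, hF, hF, p'.isIntertwining]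

/-- External tensor products of equivalent representations are equivalent. -/
def extTensorCongr {σ : Representation ℂ A U} {σ' : Representation ℂ A U'}
    {τ : Representation ℂ B T} {τ' : Representation ℂ B T'} (e : σ.Equiv σ') (e' : τ.Equiv τ') :
    (extTensor σ τ).Equiv (extTensor σ' τ') :=
  Representation.Equiv.mk (TensorProduct.congr e.toLinearEquiv e'.toLinearEquiv) fun g => by
    ext x y
    have h1 : e.toLinearEquiv (σ g.1 x) = σ' g.1 (e.toLinearEquiv x) :=
      e.toIntertwiningMap.isIntertwining _ _ g.1 x
    have h2 : e'.toLinearEquiv (τ g.2 y) = τ' g.2 (e'.toLinearEquiv y) :=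
      e'.toIntertwiningMap.isIntertwining _ _ g.2 y
    exact congrArg₂ (fun a b => a ⊗ₜ[ℂ] b) h1 h2

lemma exists_equiv_of_extTensor {σ : Representation ℂ A U} {τ : Representation ℂ B T}
    {τ' : Representation ℂ B T'} (hσ : σ.IsIrreducible) (hτ : τ.IsIrreducible)
    (hτ' : τ'.IsIrreducible) [FiniteDimensional ℂ U] [FiniteDimensional ℂ T']
    (f : (extTensor σ τ).IntertwiningMap (extTensor σ τ')) (hf : f ≠ 0) :
    Nonempty (τ.Equiv τ') := by
  have := IsIrreducible.nontrivial hσ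
  obtain ⟨x₀, hx₀⟩ := exists_ne (0 : U)
  obtain ⟨t, ht⟩ := IsIrreducible.exists_eq_lTensor hσ f.toLinearMap (fun a z => by
    have := f.isIntertwining _ _ (a, 1) z
    rwa [extTensor_inl_apply, extTensor_inl_apply] at this)
  let s : τ.IntertwiningMap τ' := ⟨t, fun b => LinearMap.ext fun y => by
    have : f.toLinearMap (extTensor σ τ (1, b) (x₀ ⊗ₜ y)) =
      extTensor σ τ' (1, b) (f.toLinearMap (x₀ ⊗ₜ y)) := f.isIntertwining _ _ (1, b) (x₀ ⊗ₜ y)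
    rw [ht, ht] at this
    simp only [extTensor_tmul, map_one, Module.End.one_apply, LinearMap.lTensor_tmul] at this
    exact tmul_right_injective hx₀ this⟩
  have hs : Function.Bijective s := by
    refine (IsIrreducible.bijective_or_eq_zero s).resolve_right fun h0 => hf ?_
    have ht0 : t = 0 := congrArg IntertwiningMap.toLinearMap h0
    ext z
    change f.toLinearMap _ = _
    rw [ht, ht0]
    simp
  exact ⟨IntertwiningMap.ofBijective s hs⟩

/-- Surjections with equal kernels differ by an isomorphism of the targets. For a single target this
is a scalar by Schur; for `σ ⊗ τ` and `σ ⊗ τ'` it yields `τ ≃ τ'`. -/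
lemma KernelRigid.leftMultiplicityFree [Finite A] [Finite B] {Ω : Representation ℂ (A × B) V}
    (h : KernelRigid Ω) : LeftMultiplicityFree Ω (fun _ _ => True) := by
  constructor
  · intro X Y _ _ _ _ σ τ hσ hτ _
    have := IsIrreducible.finiteDimensional hσ
    have := IsIrreducible.finiteDimensional hτ
    have hστ := isIrreducible_extTensor hσ hτ
    have := IsIrreducible.nontrivial hστ
    rw [rank_le_one_iff]
    by_cases h0 : ∀ p : Ω.IntertwiningMap (extTensor σ τ), p = 0
    · exact ⟨0, fun p => ⟨0, by rw [h0 p, smul_zero]⟩⟩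
    push Not at h0
    obtain ⟨p, hp⟩ := h0
    refine ⟨p, fun p' => ?_⟩
    by_cases hp' : p' = 0
    · exact ⟨0, by rw [hp', zero_smul]⟩
    have hker := h _ _ _ _ hστ hστ p p' hp hp' LinearMap.id (fun _ _ => rfl)
      (by
        intro hid
        obtain ⟨z, hz⟩ := exists_ne (0 : X ⊗[ℂ] Y)
        exact hz (LinearMap.congr_fun hid z))
    obtain ⟨f, hf⟩ := exists_intertwiningMap_of_ker_le p
      ((IsIrreducible.surjective_or_eq_zero p).resolve_right hp) p' (fun v => (hker v).1)
    obtain ⟨c, hc⟩ := IsIrreducible.exists_eq_smul hστ f.toLinearMap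
      (fun g x => f.isIntertwining _ _ g x)
    refine ⟨c, ?_⟩
    ext v
    exact (hc (p v)).symm.trans (hf v).symm
  · rintro X Y Y' _ _ _ _ _ _ σ τ τ' hσ hτ hτ' - - ⟨p, hp⟩ ⟨p', hp'⟩
    have := IsIrreducible.finiteDimensional hσ
    have := IsIrreducible.finiteDimensional hτ
    have := IsIrreducible.finiteDimensional hτ'
    have hστ := isIrreducible_extTensor hσ hτ
    have hστ' := isIrreducible_extTensor hσ hτ'
    have := IsIrreducible.nontrivial hσ
    have := IsIrreducible.nontrivial hτ
    have := IsIrreducible.nontrivial hτ'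
    obtain ⟨x, hx⟩ := exists_ne (0 : X)
    obtain ⟨y, hy⟩ := exists_ne (0 : Y)
    obtain ⟨y', hy'⟩ := exists_ne (0 : Y')
    obtain ⟨l, hl⟩ := exists_dual_eq_one hy
    -- The linking `A`-map is the identity of `σ` tensored with the rank-one map sending `y` to
    -- `y'`; no `B`-equivariance is needed.
    have hker := h _ _ _ _ hστ hστ' p p' hp hp' ((l.smulRight y').lTensor X)
      (fun a z => by
        rw [extTensor_inl_apply, extTensor_inl_apply]
        exact lTensor_rTensor_comm _ _ z)
      (fun h0 => by
        have := LinearMap.congr_fun h0 (x ⊗ₜ y)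
        simp only [LinearMap.lTensor_tmul, LinearMap.smulRight_apply, hl, one_smul,
          LinearMap.zero_apply] at this
        exact hy' (tmul_right_injective hx (by simpa using this)))
    obtain ⟨f, hf⟩ := exists_intertwiningMap_of_ker_le p'
      ((IsIrreducible.surjective_or_eq_zero p').resolve_right hp') p (fun v => (hker v).2)
    refine exists_equiv_of_extTensor hσ hτ' hτ f fun h0 => hp ?_
    ext v
    change p v = 0
    rw [hf, h0]
    rfl

lemma LeftMultiplicityFree.exists_forall_eq_smul {Ω : Representation ℂ (A × B) V}
    {R : ∀ {X Y : Type} [AddCommGroup X] [Module ℂ X] [AddCommGroup Y] [Module ℂ Y],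
      Representation ℂ A X → Representation ℂ B Y → Prop} (h : LeftMultiplicityFree Ω R)
    {X Y : Type} [AddCommGroup X] [Module ℂ X] [AddCommGroup Y] [Module ℂ Y]
    {σ : Representation ℂ A X} {τ : Representation ℂ B Y} (hσ : σ.IsIrreducible)
    (hτ : τ.IsIrreducible) (hR : R σ τ) :
    ∃ f₀ : Ω.IntertwiningMap (extTensor σ τ), ∀ f : Ω.IntertwiningMap (extTensor σ τ),
      ∃ c : ℂ, c • f₀ = f :=
  rank_le_one_iff.1 (h.rank_le_one X Y σ τ hσ hτ hR)

/-- A nonzero `A`-map between the quotients identifies their `A`-factors, then uniqueness identifies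
the `B`-factors. Both projections now lie in one Hom space of dimension at most one, so they are
proportional. -/
lemma LeftMultiplicityFree.kernelRigid [Finite A] [Finite B] {Ω : Representation ℂ (A × B) V}
    (h : LeftMultiplicityFree Ω (fun _ _ => True)) : KernelRigid Ω := by
  intro X X' _ _ _ _ π π' hπ hπ' p p' hp hp' t ht ht0 v
  have := IsIrreducible.finiteDimensional hπ
  have := IsIrreducible.finiteDimensional hπ'
  obtain ⟨n, m, σ, τ, hσ, hτ, ⟨e⟩⟩ := IsIrreducible.exists_extTensor hπ
  obtain ⟨n', m', σ', τ', hσ', hτ', ⟨e'⟩⟩ := IsIrreducible.exists_extTensor hπ'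
  obtain ⟨ε⟩ : Nonempty (σ'.Equiv σ) := by
    -- Evaluating `t` at a pure tensor and contracting in the other factor gives a nonzero map `σ →
    -- σ'`, hence an isomorphism.
    let F : (Fin n → ℂ) ⊗[ℂ] (Fin m → ℂ) →ₗ[ℂ] (Fin n' → ℂ) ⊗[ℂ] (Fin m' → ℂ) :=
      e'.toLinearMap ∘ₗ t ∘ₗ e.symm.toLinearMap
    have hF : ∀ a z, F (extTensor σ τ (a, 1) z) = extTensor σ' τ' (a, 1) (F z) := by
      intro a z
      have h1 : e.symm (extTensor σ τ (a, 1) z) = π (a, 1) (e.symm z) :=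
        e.symm.toIntertwiningMap.isIntertwining _ _ _ z
      have h2 : ∀ z, e' (π' (a, 1) z) = extTensor σ' τ' (a, 1) (e' z) := fun z =>
        e'.toIntertwiningMap.isIntertwining _ _ _ z
      change e' (t (e.symm _)) = _
      rw [h1, ht, h2]
      rfl
    have hF0 : F ≠ 0 := by
      intro h0
      apply ht0
      ext x
      have := LinearMap.congr_fun h0 (e x)
      change e' (t (e.symm (e x))) = 0 at this
      rw [e.symm_apply_apply] at this
      exact (LinearEquiv.map_eq_zero_iff e'.toLinearEquiv).1 this
    obtain ⟨x, y, hxy⟩ : ∃ x y, F (x ⊗ₜ y) ≠ 0 := by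
      by_contra! h0
      exact hF0 (TensorProduct.ext' h0)
    obtain ⟨l, hl⟩ : ∃ l : (Fin m' → ℂ) →ₗ[ℂ] ℂ, contractRight _ l (F (x ⊗ₜ y)) ≠ 0 := by
      by_contra! h0
      exact hxy (eq_zero_of_contractRight h0)
    let f : σ.IntertwiningMap σ' :=
      ⟨contractRight _ l ∘ₗ F ∘ₗ (TensorProduct.mk ℂ _ _).flip y, fun a => by
        refine LinearMap.ext fun x => ?_
        change contractRight _ l (F (σ a x ⊗ₜ y)) = σ' a (contractRight _ l (F (x ⊗ₜ y)))
        rw [← contractRight_extTensor σ' τ', ← hF]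
        simp⟩
    have hf : Function.Bijective f :=
      (IsIrreducible.bijective_or_eq_zero f).resolve_right (intertwiningMap_ne_zero.2 ⟨x, hl⟩)
    exact ⟨(IntertwiningMap.ofBijective f hf).symm⟩
  let q := e.toIntertwiningMap.comp p
  let q' := (extTensorCongr ε (Representation.Equiv.refl τ')).toIntertwiningMap.comp
    (e'.toIntertwiningMap.comp p')
  have hq : ∀ v, q v = 0 ↔ p v = 0 := fun _ => LinearEquiv.map_eq_zero_iff e.toLinearEquiv
  have hq' : ∀ v, q' v = 0 ↔ p' v = 0 := fun _ =>
    (LinearEquiv.map_eq_zero_iff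
      (extTensorCongr ε (Representation.Equiv.refl τ')).toLinearEquiv).trans
      (LinearEquiv.map_eq_zero_iff e'.toLinearEquiv)
  obtain ⟨w, hw⟩ := intertwiningMap_ne_zero.1 hp
  obtain ⟨w', hw'⟩ := intertwiningMap_ne_zero.1 hp'
  obtain ⟨δ⟩ := h.unique _ _ _ σ τ τ' hσ hτ hτ' trivial trivial
    ⟨q, intertwiningMap_ne_zero.2 ⟨w, fun h0 => hw ((hq w).1 h0)⟩⟩
    ⟨q', intertwiningMap_ne_zero.2 ⟨w', fun h0 => hw' ((hq' w').1 h0)⟩⟩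
  let q'' := (extTensorCongr (Representation.Equiv.refl σ) δ).toIntertwiningMap.comp q'
  have hq'' : ∀ v, q'' v = 0 ↔ p' v = 0 := fun v =>
    (LinearEquiv.map_eq_zero_iff
      (extTensorCongr (Representation.Equiv.refl σ) δ).toLinearEquiv).trans (hq' v)
  obtain ⟨v₀, hv₀⟩ := h.exists_forall_eq_smul hσ hτ trivial
  obtain ⟨r, hr⟩ := hv₀ q
  obtain ⟨s, hs⟩ := hv₀ q''
  have hr0 : r ≠ 0 := by
    rintro rfl
    apply hw
    rw [← hq, ← hr, zero_smul]
    rfl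
  have hs0 : s ≠ 0 := by
    rintro rfl
    apply hw'
    rw [← hq'', ← hs, zero_smul]
    rfl
  rw [← hq, ← hq'', ← hr, ← hs]
  change r • v₀ v = 0 ↔ s • v₀ v = 0
  rw [smul_eq_zero_iff_right hr0, smul_eq_zero_iff_right hs0]

/-- Two representations on the same space with the same invariant subspaces have isomorphic
lattices of subrepresentations. -/
def subrepresentationOrderIso {M N : Type*} [Monoid M] [Monoid N] (Ω : Representation ℂ M V)
    (Ω' : Representation ℂ N V)
    (h : ∀ K : Submodule ℂ V, (∀ m, ∀ v ∈ K, Ω m v ∈ K) ↔ ∀ n, ∀ v ∈ K, Ω' n v ∈ K) :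
    Subrepresentation Ω ≃o Subrepresentation Ω' where
  toFun K := ⟨K.toSubmodule, fun m v hv => (h K.toSubmodule).1
    (fun m _ hv => K.apply_mem_toSubmodule m hv) m v hv⟩
  invFun K := ⟨K.toSubmodule, fun m v hv => (h K.toSubmodule).2
    (fun m _ hv => K.apply_mem_toSubmodule m hv) m v hv⟩
  left_inv _ := rfl
  right_inv _ := rfl
  map_rel_iff' := Iff.rfl

/-- `swapRep` does not change subrepresentations. -/
def swapRepOrderIso (Ω : Representation ℂ (A × B) V) :
    Subrepresentation Ω ≃o Subrepresentation (swapRep Ω) :=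
  subrepresentationOrderIso _ _ fun _ => ⟨fun h m => h m.swap, fun h m => h m.swap⟩

lemma isIrreducible_swapRep {Ω : Representation ℂ (A × B) V} (h : Ω.IsIrreducible) :
    (swapRep Ω).IsIrreducible :=
  (OrderIso.isSimpleOrder_iff (swapRepOrderIso Ω)).1 h

lemma isSemisimple_swapRep {Ω : Representation ℂ (A × B) V} (h : Ω.IsSemisimpleRepresentation) :
    (swapRep Ω).IsSemisimpleRepresentation :=
  (OrderIso.complementedLattice_iff (swapRepOrderIso Ω)).1 h

/-- `swapRep` does not change intertwining maps. -/
def swapRepHom {Ω : Representation ℂ (A × B) V} {π : Representation ℂ (A × B) X}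
    (f : Ω.IntertwiningMap π) : (swapRep Ω).IntertwiningMap (swapRep π) :=
  ⟨f.toLinearMap, fun g => f.isIntertwining' g.swap⟩

/-- Two quotients with different kernels would split off together as a direct sum. The projection to
the second summand commutes with `A × B`, but not with an `A`-map from the first summand to the
second. -/
lemma CommutantsCommute.kernelRigid {Ω : Representation ℂ (A × B) V}
    (hΩ : Ω.IsSemisimpleRepresentation) (h : CommutantsCommute Ω) : KernelRigid Ω := by
  intro X X' _ _ _ _ π π' hπ hπ' p p' hp hp' t ht ht0 v
  have hps := (IsIrreducible.surjective_or_eq_zero p).resolve_right hp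
  have hps' := (IsIrreducible.surjective_or_eq_zero p').resolve_right hp'
  have hmap : p'.ker.toSubmodule.map p.toLinearMap = ⊥ := by
    refine (IsIrreducible.eq_bot_or_eq_top_of_submodule hπ _ ?_).resolve_right fun htop => ht0 ?_
    · rintro m _ ⟨w, hw, rfl⟩
      exact ⟨Ω m w, p'.ker.apply_mem_toSubmodule m hw, p.isIntertwining _ _ m w⟩
    have hprod : Function.Surjective (p.prod p') := by
      rintro ⟨x, x'⟩
      obtain ⟨w, rfl⟩ := hps' x'
      have : x - p w ∈ p'.ker.toSubmodule.map p.toLinearMap := by rw [htop]; trivial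
      obtain ⟨k, hk, hkx⟩ := this
      change p' k = 0 at hk
      change p k = x - p w at hkx
      refine ⟨w + k, Prod.ext ?_ ?_⟩
      · change p (w + k) = x
        rw [map_add, hkx]
        abel
      · change p' (w + k) = p' w
        rw [map_add, hk, add_zero]
    obtain ⟨s, hs⟩ := IsSemisimple.exists_rightInverse hΩ (p.prod p') hprod
    have hs1 : ∀ z, p (s z) = z.1 := fun z => congrArg Prod.fst (hs z)
    have hs2 : ∀ z, p' (s z) = z.2 := fun z => congrArg Prod.snd (hs z)
    -- The first operator is `t` from one summand to the other, the second is the projection to the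
    -- target. One composite is `0`, the other is `t`, so commutation kills `t`.
    have key := h (s.toLinearMap ∘ₗ LinearMap.inr ℂ X X' ∘ₗ t ∘ₗ p.toLinearMap)
      (s.toLinearMap ∘ₗ LinearMap.inr ℂ X X' ∘ₗ p'.toLinearMap)
      (fun a w => by
        change s (0, t (p (Ω (a, 1) w))) = Ω (a, 1) (s (0, t (p w)))
        rw [p.isIntertwining, ht, ← s.isIntertwining]
        simp)
      (fun b w => by
        change s (0, p' (Ω (1, b) w)) = Ω (1, b) (s (0, p' w))
        rw [p'.isIntertwining, ← s.isIntertwining]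
        simp)
    ext x
    obtain ⟨v, rfl⟩ := hps x
    have h1 : s (0, t (p (s (0, p' v)))) = s (0, p' (s (0, t (p v)))) := key v
    rw [hs1, hs2] at h1
    have h2 := congrArg p' h1
    rw [hs2, hs2] at h2
    simpa using h2.symm
  have hle : ∀ v, p' v = 0 → p v = 0 := by
    intro v hv
    have : p v ∈ p'.ker.toSubmodule.map p.toLinearMap := ⟨v, hv, rfl⟩
    rwa [hmap, Submodule.mem_bot] at this
  refine ⟨fun hv => ?_, hle v⟩
  obtain ⟨f, hf⟩ := exists_intertwiningMap_of_ker_le p' hps' p hle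
  have hfi := (IsIrreducible.injective_or_eq_zero f).resolve_right fun h0 => hp (by
    ext w
    change p w = 0
    rw [hf, h0]
    rfl)
  apply hfi
  rw [← hf, hv, map_zero]

/-- `T` preserves the kernel of `p`: otherwise it would carry some other irreducible constituent
nontrivially into `π` by an `A`-map, which rigidity excludes. So `T` descends to the quotient. -/
lemma KernelRigid.exists_lift [FiniteDimensional ℂ V] {Ω : Representation ℂ (A × B) V}
    (hΩ : Ω.IsSemisimpleRepresentation) (h : KernelRigid Ω) {T : V →ₗ[ℂ] V}
    (hT : ∀ a v, T (Ω (a, 1) v) = Ω (a, 1) (T v)) {X : Type} [AddCommGroup X] [Module ℂ X]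
    {π : Representation ℂ (A × B) X} (hπ : π.IsIrreducible) (p : Ω.IntertwiningMap π)
    (hp : p ≠ 0) :
    ∃ t : X →ₗ[ℂ] X, (∀ a x, t (π (a, 1) x) = π (a, 1) (t x)) ∧ ∀ v, p (T v) = t (p v) := by
  have hps := (IsIrreducible.surjective_or_eq_zero p).resolve_right hp
  have hle : ∀ v, p v = 0 → p (T v) = 0 := by
    by_contra! hcon
    obtain ⟨v, hv, hv'⟩ := hcon
    -- The largest subrepresentation killed by `p ∘ T`; `T` is not `B`-linear, so `ker (p ∘ T)` need
    -- not be invariant.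
    let Z : Subrepresentation Ω :=
      { toSubmodule := ⨅ g, LinearMap.ker (p.toLinearMap ∘ₗ T ∘ₗ Ω g)
        apply_mem_toSubmodule := fun g w hw => by
          rw [Submodule.mem_iInf] at hw ⊢
          intro g'
          have := hw (g' * g)
          simpa using this }
    have hZ : ∀ w, w ∈ Z.toSubmodule ↔ ∀ g, p (T (Ω g w)) = 0 := fun w => by
      simp only [Z, Submodule.mem_iInf]
      rfl
    obtain ⟨C, hC⟩ := hΩ.exists_isCompl (p.ker ⊓ Z)
    have hsup : (p.ker ⊓ Z).toSubmodule ⊔ C.toSubmodule = ⊤ :=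
      congrArg Subrepresentation.toSubmodule hC.sup_eq_top
    have hinf : (p.ker ⊓ Z).toSubmodule ⊓ C.toSubmodule = ⊥ :=
      congrArg Subrepresentation.toSubmodule hC.inf_eq_bot
    obtain ⟨z, hz, c, hc, hzc⟩ := Submodule.mem_sup.1
      (show v ∈ (p.ker ⊓ Z).toSubmodule ⊔ C.toSubmodule by rw [hsup]; trivial)
    have hz1 : p z = 0 := hz.1
    have hz2 : p (T z) = 0 := by
      have := (hZ z).1 hz.2 1
      simpa using this
    -- The component `c` of the bad vector lies in `ker p ∩ C` and is nonzero. An irreducible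
    -- summand there meets `Z` trivially, so `p ∘ T` is nonzero on it and links `π'` to `π`.
    obtain ⟨n, π', i, p', hπ', hi, hp'⟩ := IsSemisimple.exists_summand hΩ
      (p.ker ⊓ C).toSubmodule (fun m v hv => (p.ker ⊓ C).apply_mem_toSubmodule m hv) (by
        intro h0
        have hcJ : c ∈ (p.ker ⊓ C).toSubmodule := by
          refine ⟨?_, hc⟩
          change p c = 0
          rw [← hzc, map_add, hz1, zero_add] at hv
          exact hv
        rw [h0, Submodule.mem_bot] at hcJ
        apply hv'
        rw [← hzc, hcJ, add_zero, hz2])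
    have := IsIrreducible.nontrivial hπ'
    obtain ⟨x, hx⟩ := exists_ne (0 : Fin n → ℂ)
    have hker := h _ _ π' π hπ' hπ p' p
      (intertwiningMap_ne_zero.2 ⟨i x, by rwa [hp']⟩) hp
      (p.toLinearMap ∘ₗ T ∘ₗ i.toLinearMap)
      (fun a x => by
        change p (T (i (π' (a, 1) x))) = π (a, 1) (p (T (i x)))
        rw [i.isIntertwining, hT, p.isIntertwining])
      (fun h0 => by
        have hmem : i x ∈ (p.ker ⊓ Z).toSubmodule ⊓ C.toSubmodule := by
          refine ⟨⟨(hi x).1, (hZ _).2 fun g => ?_⟩, (hi x).2⟩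
          rw [← i.isIntertwining]
          exact LinearMap.congr_fun h0 (π' g x)
        rw [hinf, Submodule.mem_bot] at hmem
        apply hx
        rw [← hp' x, hmem, map_zero])
    apply hx
    rw [← hp' x, hker]
    exact (hi x).1
  let αT : (resLeft Ω).IntertwiningMap (resLeft π) :=
    ⟨p.toLinearMap ∘ₗ T, fun a => LinearMap.ext fun v => by
      change p (T (Ω (a, 1) v)) = π (a, 1) (p (T v))
      rw [hT, p.isIntertwining]⟩
  let p₀ : (resLeft Ω).IntertwiningMap (resLeft π) :=
    ⟨p.toLinearMap, fun a => p.isIntertwining' (a, 1)⟩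
  obtain ⟨f, hf⟩ := exists_intertwiningMap_of_ker_le p₀ hps αT hle
  exact ⟨f.toLinearMap, fun a x => f.isIntertwining _ _ a x, hf⟩

/-- On `σ ⊗ τ` the commutant of `A` consists of operators `1 ⊗ t'` and that of `B` of operators `s'
⊗ 1`. -/
lemma IsIrreducible.commute_of_commutants [Finite A] [FiniteDimensional ℂ X]
    {π : Representation ℂ (A × B) X} (hπ : π.IsIrreducible) {t s : X →ₗ[ℂ] X}
    (ht : ∀ a x, t (π (a, 1) x) = π (a, 1) (t x))
    (hs : ∀ b x, s (π (1, b) x) = π (1, b) (s x)) (x : X) : t (s x) = s (t x) := by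
  obtain ⟨n, m, σ, τ, hσ, hτ, ⟨e⟩⟩ := IsIrreducible.exists_extTensor hπ
  have he : ∀ g x, e (π g x) = extTensor σ τ g (e x) := fun g x =>
    e.toIntertwiningMap.isIntertwining _ _ g x
  obtain ⟨t', ht'⟩ := IsIrreducible.exists_eq_lTensor hσ
    (e.toLinearMap ∘ₗ t ∘ₗ e.symm.toLinearMap) (fun a z => by
      obtain ⟨x, rfl⟩ := e.toLinearEquiv.surjective z
      change e (t (e.symm _)) = LinearMap.rTensor _ (σ a) (e (t (e.symm (e x))))
      rw [e.symm_apply_apply, ← extTensor_inl_apply σ τ, ← extTensor_inl_apply σ τ, ← he, ← ht]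
      change e (t (e.symm (extTensor σ τ (a, 1) (e x)))) = _
      rw [← he, e.symm_apply_apply])
  obtain ⟨s', hs'⟩ := IsIrreducible.exists_eq_rTensor hτ
    (e.toLinearMap ∘ₗ s ∘ₗ e.symm.toLinearMap) (fun b z => by
      obtain ⟨x, rfl⟩ := e.toLinearEquiv.surjective z
      change e (s (e.symm _)) = LinearMap.lTensor _ (τ b) (e (s (e.symm (e x))))
      rw [e.symm_apply_apply, ← extTensor_inr_apply σ τ, ← extTensor_inr_apply σ τ, ← he, ← hs]
      change e (s (e.symm (extTensor σ τ (1, b) (e x)))) = _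
      rw [← he, e.symm_apply_apply])
  have h1 : ∀ x, e (t x) = t'.lTensor _ (e x) := fun x => by
    rw [← ht']
    change _ = e (t (e.symm (e x)))
    rw [e.symm_apply_apply]
  have h2 : ∀ x, e (s x) = s'.rTensor _ (e x) := fun x => by
    rw [← hs']
    change _ = e (s (e.symm (e x)))
    rw [e.symm_apply_apply]
  apply e.toLinearEquiv.injective
  change e _ = e _
  rw [h1, h2, h2, h1, lTensor_rTensor_comm]

lemma commutantsCommute_of_kernelRigid [FiniteDimensional ℂ V] [Finite A] [Finite B]
    {Ω : Representation ℂ (A × B) V} (hΩ : Ω.IsSemisimpleRepresentation) (h : KernelRigid Ω)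
    (h' : KernelRigid (swapRep Ω)) : CommutantsCommute Ω := by
  intro T S hT hS v
  have key : ∀ (X : Type) [AddCommGroup X] [Module ℂ X] (π : Representation ℂ (A × B) X),
      π.IsIrreducible → ∀ p : Ω.IntertwiningMap π, p ≠ 0 → ∀ v, p (T (S v)) = p (S (T v)) := by
    intro X _ _ π hπ p hp v
    have := IsIrreducible.finiteDimensional hπ
    obtain ⟨t, ht, htp⟩ := h.exists_lift hΩ hT hπ p hp
    obtain ⟨s, hs, hsp⟩ := h'.exists_lift (isSemisimple_swapRep hΩ) (T := S) hS
      (isIrreducible_swapRep hπ) (swapRepHom p) (fun h0 => hp (by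
        ext v
        exact congrArg (fun f : (swapRep Ω).IntertwiningMap (swapRep π) => f v) h0))
    have hsp' : ∀ v, p (S v) = s (p v) := hsp
    rw [htp, hsp', hsp', htp]
    exact IsIrreducible.commute_of_commutants hπ ht hs (p v)
  -- The common kernel of all irreducible quotients. It vanishes by semisimplicity, so it suffices
  -- that `T` and `S` commute after each projection.
  let J : Submodule ℂ V :=
    { carrier := {v | ∀ (X : Type) [AddCommGroup X] [Module ℂ X] (π : Representation ℂ (A × B) X),
        π.IsIrreducible → ∀ p : Ω.IntertwiningMap π, p ≠ 0 → p v = 0}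
      add_mem' := fun hv hw X _ _ π hπ p hp => by rw [map_add, hv X π hπ p hp, hw X π hπ p hp,
        add_zero]
      zero_mem' := fun X _ _ π hπ p hp => map_zero p
      smul_mem' := fun c v hv X _ _ π hπ p hp => by rw [map_smul, hv X π hπ p hp, smul_zero] }
  have hJ : J = ⊥ := by
    by_contra hJ0
    obtain ⟨n, π, i, p, hπ, hi, hp⟩ := IsSemisimple.exists_summand hΩ J
      (fun m v hv X _ _ π hπ p hp => by
        rw [p.isIntertwining, hv X π hπ p hp, map_zero]) hJ0
    have := IsIrreducible.nontrivial hπ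
    obtain ⟨x, hx⟩ := exists_ne (0 : Fin n → ℂ)
    apply hx
    rw [← hp x]
    exact hi x _ π hπ p (intertwiningMap_ne_zero.2 ⟨i x, by rwa [hp]⟩)
  rw [← sub_eq_zero, ← Submodule.mem_bot ℂ, ← hJ]
  intro X _ _ π hπ p hp
  rw [map_sub, sub_eq_zero]
  exact key X π hπ p hp v

/-- A finite-dimensional semisimple representation of `A × B` is multiplicity free on both sides if
and only if the commutants of `A` and `B` commute. -/
lemma leftMultiplicityFree_and_swap_iff [FiniteDimensional ℂ V] [Finite A] [Finite B]
    {Ω : Representation ℂ (A × B) V} (hΩ : Ω.IsSemisimpleRepresentation) :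
    (LeftMultiplicityFree Ω (fun _ _ => True) ∧
      LeftMultiplicityFree (swapRep Ω) (fun _ _ => True)) ↔ CommutantsCommute Ω :=
  ⟨fun h => commutantsCommute_of_kernelRigid hΩ h.1.kernelRigid h.2.kernelRigid, fun h =>
    ⟨(h.kernelRigid hΩ).leftMultiplicityFree,
      (h.swapRep.kernelRigid (isSemisimple_swapRep hΩ)).leftMultiplicityFree⟩⟩

end Rigid
end ThetaMonoid
namespace ThetaMonoid

/-! ### Commutants in coinduced representations of groups -/

section Coinduced

variable {G W : Type*} [Group G] [AddCommGroup W] [Module ℂ W] {H : Subgroup G}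

open Representation Classical

/-- The function supported on the coset `H x` with value `w` at `x`. -/
def cosetDelta (ρ : Representation ℂ H W) (x : G) : W →ₗ[ℂ] coindV H.subtype ρ where
  toFun w := ⟨fun g => if h : g * x⁻¹ ∈ H then ρ ⟨g * x⁻¹, h⟩ w else 0, fun γ g => by
    have : (H.subtype γ * g) * x⁻¹ = γ * (g * x⁻¹) := mul_assoc _ _ _
    by_cases h : g * x⁻¹ ∈ H
    · have h' : (H.subtype γ * g) * x⁻¹ ∈ H := this ▸ H.mul_mem γ.2 h
      refine (dif_pos h').trans (Eq.trans ?_ (congrArg (ρ γ) (dif_pos h).symm))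
      rw [← Module.End.mul_apply, ← map_mul]
      congr 2
      exact Subtype.ext this
    · have h' : (H.subtype γ * g) * x⁻¹ ∉ H := fun h' => h ((H.mul_mem_cancel_left γ.2).1 (this ▸ h'))
      refine (dif_neg h').trans (Eq.trans ?_ (congrArg (ρ γ) (dif_neg h).symm))
      rw [map_zero]⟩
  map_add' w w' := by
    ext g
    by_cases h : g * x⁻¹ ∈ H <;> simp [h]
  map_smul' c w := by
    ext g
    by_cases h : g * x⁻¹ ∈ H <;> simp [h]

lemma cosetDelta_apply_of_mem (ρ : Representation ℂ H W) {x g : G} (h : g * x⁻¹ ∈ H) (w : W) :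
    (cosetDelta ρ x w).1 g = ρ ⟨g * x⁻¹, h⟩ w := dif_pos h

lemma cosetDelta_apply_of_notMem (ρ : Representation ℂ H W) {x g : G} (h : g * x⁻¹ ∉ H) (w : W) :
    (cosetDelta ρ x w).1 g = 0 := dif_neg h

lemma cosetDelta_one_apply_one (ρ : Representation ℂ H W) (w : W) :
    (cosetDelta ρ 1 w).1 1 = w := by
  have h : (1 : G) * 1⁻¹ ∈ H := by simp
  rw [cosetDelta_apply_of_mem ρ h]
  have : (⟨1 * 1⁻¹, h⟩ : H) = 1 := Subtype.ext (by simp)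
  rw [this, map_one]
  rfl

lemma coind_apply_cosetDelta (ρ : Representation ℂ H W) {x n : G} (h : x * n * x⁻¹ ∈ H) (w : W) :
    coind H.subtype ρ n (cosetDelta ρ x w) = cosetDelta ρ x (ρ ⟨x * n * x⁻¹, h⟩ w) := by
  ext g
  change (cosetDelta ρ x w).1 (g * n) = _
  have heq : g * n * x⁻¹ = g * x⁻¹ * (x * n * x⁻¹) := by group
  by_cases hg : g * x⁻¹ ∈ H
  · have hg' : g * n * x⁻¹ ∈ H := heq ▸ H.mul_mem hg h
    rw [cosetDelta_apply_of_mem ρ hg, cosetDelta_apply_of_mem ρ hg', ← Module.End.mul_apply,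
      ← map_mul]
    congr 2
    exact Subtype.ext heq
  · have hg' : g * n * x⁻¹ ∉ H := fun h' => hg ((H.mul_mem_cancel_right h).1 (heq ▸ h'))
    rw [cosetDelta_apply_of_notMem ρ hg, cosetDelta_apply_of_notMem ρ hg']

/-- The part of `φ` on a coset of `H` is produced once for each of its points, hence `|H|` times. -/
lemma sum_cosetDelta [Fintype G] (ρ : Representation ℂ H W) (φ : coindV H.subtype ρ) :
    ∑ x, cosetDelta ρ x (φ.1 x) = (Nat.card H : ℂ) • φ := by
  ext g
  have h1 : ∀ x, (cosetDelta ρ x (φ.1 x)).1 g = if g * x⁻¹ ∈ H then φ.1 g else 0 := by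
    intro x
    by_cases h : g * x⁻¹ ∈ H
    · rw [cosetDelta_apply_of_mem ρ h, if_pos h, ← φ.2 ⟨_, h⟩ x]
      simp
    · rw [cosetDelta_apply_of_notMem ρ h, if_neg h]
  have h2 : (∑ x, cosetDelta ρ x (φ.1 x)).1 g = ∑ x, (cosetDelta ρ x (φ.1 x)).1 g := by
    rw [Submodule.coe_sum, Finset.sum_apply]
  rw [h2]
  simp only [h1]
  rw [Finset.sum_ite, Finset.sum_const_zero, add_zero, Finset.sum_const]
  have hcard : (Finset.univ.filter fun x => g * x⁻¹ ∈ H).card = Nat.card H := by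
    rw [Nat.card_eq_fintype_card, ← Fintype.card_coe]
    refine Fintype.card_congr ⟨fun x => ⟨g * (x.1)⁻¹, (Finset.mem_filter.1 x.2).2⟩,
      fun h => ⟨h.1⁻¹ * g, by simp⟩, fun x => ?_, fun h => ?_⟩
    · ext; simp
    · ext; simp
  rw [hcard, ← Nat.cast_smul_eq_nsmul ℂ]
  rfl

/-- The kernel of an operator on a coinduced representation, at `(1, x)`. -/
def coindKernel {ρ : Representation ℂ H W} (T : coindV H.subtype ρ →ₗ[ℂ] coindV H.subtype ρ)
    (x : G) : W →ₗ[ℂ] W :=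
  LinearMap.proj 1 ∘ₗ (coindV H.subtype ρ).subtype ∘ₗ T ∘ₗ cosetDelta ρ x

lemma apply_one_eq_sum_coindKernel [Fintype G] {ρ : Representation ℂ H W}
    (T : coindV H.subtype ρ →ₗ[ℂ] coindV H.subtype ρ) (φ : coindV H.subtype ρ) :
    (T φ).1 1 = (Nat.card H : ℂ)⁻¹ • ∑ x, coindKernel T x (φ.1 x) := by
  have h1 : ∑ x, coindKernel T x (φ.1 x) = (T (∑ x, cosetDelta ρ x (φ.1 x))).1 1 := by
    rw [map_sum, Submodule.coe_sum, Finset.sum_apply]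
    rfl
  rw [h1, sum_cosetDelta, map_smul]
  have h0 : (Nat.card H : ℂ) ≠ 0 := Nat.cast_ne_zero.2 Nat.card_pos.ne'
  change _ = (Nat.card H : ℂ)⁻¹ • ((Nat.card H : ℂ) • (T φ).1 1)
  rw [inv_smul_smul₀ h0]

/-- Translation by `n` sends the delta at `x` with value `w` to the delta at `x` with value moved by
`x n x⁻¹`; the result is then evaluated at `1`. -/
lemma coindKernel_comm {ρ : Representation ℂ H W}
    {T : coindV H.subtype ρ →ₗ[ℂ] coindV H.subtype ρ} {n : G} (hn : n ∈ H)
    (hT : ∀ φ, T (coind H.subtype ρ n φ) = coind H.subtype ρ n (T φ)) {x : G}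
    (hx : x * n * x⁻¹ ∈ H) (w : W) :
    ρ ⟨n, hn⟩ (coindKernel T x w) = coindKernel T x (ρ ⟨x * n * x⁻¹, hx⟩ w) := by
  change ρ ⟨n, hn⟩ ((T (cosetDelta ρ x w)).1 1) =
    (T (cosetDelta ρ x (ρ ⟨x * n * x⁻¹, hx⟩ w))).1 1
  rw [← coind_apply_cosetDelta ρ hx, hT, ← (T (cosetDelta ρ x w)).2 ⟨n, hn⟩ 1]
  change _ = (T (cosetDelta ρ x w)).1 (1 * n)
  rw [one_mul]
  exact congrArg (T (cosetDelta ρ x w)).1 (mul_one n)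

/-- The operator on a coinduced representation which acts on the value at `g` through the conjugate
of `a` by `c g`. -/
def coindConj (ρ : Representation ℂ H W) (N : Subgroup H) (c : G → H)
    (hc : ∀ (γ : H) (g : G), (γ * c g)⁻¹ * c (γ * g) ∈ N) (a : W →ₗ[ℂ] W)
    (ha : ∀ n ∈ N, ∀ w, a (ρ n w) = ρ n (a w)) : coindV H.subtype ρ →ₗ[ℂ] coindV H.subtype ρ where
  toFun φ := ⟨fun g => ρ (c g) (a (ρ (c g)⁻¹ (φ.1 g))), fun γ g => by
    have h1 : c (γ * g) * ((γ * c g)⁻¹ * c (γ * g))⁻¹ = γ * c g := by group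
    -- `c (γ * g)` and `γ * c g` differ by an element of `N`, which `a` commutes with, so both give
    -- the same conjugate of `a`.
    have h2 : (c (γ * g))⁻¹ * γ = ((γ * c g)⁻¹ * c (γ * g))⁻¹ * (c g)⁻¹ := by group
    change ρ (c (γ * g)) (a (ρ (c (γ * g))⁻¹ (φ.1 (γ * g)))) = _
    rw [show φ.1 (γ * g) = ρ γ (φ.1 g) from φ.2 γ g, ← Module.End.mul_apply (ρ _⁻¹), ← map_mul, h2,
      map_mul, Module.End.mul_apply, ha _ (N.inv_mem (hc γ g)), ← Module.End.mul_apply (ρ (c _)), ← map_mul, h1, map_mul]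
    rfl⟩
  map_add' φ ψ := by
    ext g
    simp
  map_smul' r φ := by
    ext g
    simp

lemma coindConj_apply_one {ρ : Representation ℂ H W} {N : Subgroup H} {c : G → H}
    (hc : ∀ (γ : H) (g : G), (γ * c g)⁻¹ * c (γ * g) ∈ N) (h1 : c 1 ∈ N) {a : W →ₗ[ℂ] W}
    (ha : ∀ n ∈ N, ∀ w, a (ρ n w) = ρ n (a w)) (φ : coindV H.subtype ρ) :
    (coindConj ρ N c hc a ha φ).1 1 = a (φ.1 1) := by
  change ρ (c 1) (a (ρ (c 1)⁻¹ (φ.1 1))) = _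
  rw [← ha _ h1, ← Module.End.mul_apply (ρ (c 1)), ← map_mul]
  simp

lemma coindConj_comm {ρ : Representation ℂ H W} {N : Subgroup H} {c : G → H}
    (hc : ∀ (γ : H) (g : G), (γ * c g)⁻¹ * c (γ * g) ∈ N) {a : W →ₗ[ℂ] W}
    (ha : ∀ n ∈ N, ∀ w, a (ρ n w) = ρ n (a w)) {x : G} (hx : ∀ g, c (g * x) = c g)
    (φ : coindV H.subtype ρ) :
    coindConj ρ N c hc a ha (coind H.subtype ρ x φ) =
      coind H.subtype ρ x (coindConj ρ N c hc a ha φ) := by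
  ext g
  change ρ (c g) (a (ρ (c g)⁻¹ (φ.1 (g * x)))) = ρ (c (g * x)) (a (ρ (c (g * x))⁻¹ (φ.1 (g * x))))
  rw [hx]

end Coinduced

/-! ### Coinduction from a subgroup of a product that projects onto both factors -/

section CoinducedProduct

variable {G₁ G₂ W : Type*} [Group G₁] [Group G₂] [AddCommGroup W] [Module ℂ W]
  {H : Subgroup (G₁ × G₂)}

open Representation

/-- For a subgroup `H` of `G₁ × G₂`, the operators commuting with `H ∩ G₁` commute with the
operators commuting with `H ∩ G₂`. -/
def KernelCommutantsCommute (ρ : Representation ℂ H W) : Prop :=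
  ∀ a b : W →ₗ[ℂ] W, (∀ n : H, n.1.2 = 1 → ∀ w, a (ρ n w) = ρ n (a w)) →
    (∀ n : H, n.1.1 = 1 → ∀ w, b (ρ n w) = ρ n (b w)) → ∀ w, a (b w) = b (a w)

lemma KernelCommutantsCommute.of_coind (hs₁ : ∀ g₁, ∃ g₂, (g₁, g₂) ∈ H)
    (hs₂ : ∀ g₂, ∃ g₁, (g₁, g₂) ∈ H) {ρ : Representation ℂ H W}
    (h : CommutantsCommute (coind H.subtype ρ)) : KernelCommutantsCommute ρ := by
  intro a b ha hb w
  choose d₁ hd₁ using hs₁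
  choose d₂ hd₂ using hs₂
  -- `c₁` lifts the second coordinate only: it is unchanged by right translation by `G₁`, and it is
  -- left `H`-equivariant up to `H ∩ G₁`, with which `a` commutes. The roles are exchanged for `c₂`
  -- and `b`.
  let c₁ : G₁ × G₂ → H := fun g => ⟨(d₂ g.2, g.2), hd₂ _⟩
  let c₂ : G₁ × G₂ → H := fun g => ⟨(g.1, d₁ g.1), hd₁ _⟩
  let N₁ : Subgroup H := ((MonoidHom.snd G₁ G₂).comp H.subtype).ker
  let N₂ : Subgroup H := ((MonoidHom.fst G₁ G₂).comp H.subtype).ker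
  have hc₁ : ∀ (γ : H) g, (γ * c₁ g)⁻¹ * c₁ (γ * g) ∈ N₁ := fun γ g => by
    simp [N₁, c₁, MonoidHom.mem_ker]
  have hc₂ : ∀ (γ : H) g, (γ * c₂ g)⁻¹ * c₂ (γ * g) ∈ N₂ := fun γ g => by
    simp [N₂, c₂, MonoidHom.mem_ker]
  have h1₁ : c₁ 1 ∈ N₁ := by simp [N₁, c₁, MonoidHom.mem_ker]
  have h1₂ : c₂ 1 ∈ N₂ := by simp [N₂, c₂, MonoidHom.mem_ker]
  have key := h (coindConj ρ N₁ c₁ hc₁ a ha) (coindConj ρ N₂ c₂ hc₂ b hb)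
    (fun x φ => coindConj_comm hc₁ ha (x := (x, 1)) (fun g => by simp [c₁]) φ)
    (fun x φ => coindConj_comm hc₂ hb (x := (1, x)) (fun g => by simp [c₂]) φ)
    (cosetDelta ρ 1 w)
  have key' := congrArg (fun φ => φ.1 1) key
  simp only [coindConj_apply_one hc₁ h1₁ ha, coindConj_apply_one hc₂ h1₂ hb,
    cosetDelta_one_apply_one] at key'
  exact key'

/-- Each point `x` is moved by an element of `H` with the same first coordinate to a point `(1, y
x)`. So the kernel of `T` can be rewritten to involve only values of `φ` on `1 × G₂`. -/
lemma exists_kernel_of_comm_left [Finite G₁] [Finite G₂] (hs₁ : ∀ g₁, ∃ g₂, (g₁, g₂) ∈ H)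
    {ρ : Representation ℂ H W} {T : coindV H.subtype ρ →ₗ[ℂ] coindV H.subtype ρ}
    (hT : ∀ g φ, T (coind H.subtype ρ (g, 1) φ) = coind H.subtype ρ (g, 1) (T φ)) :
    ∃ (a : G₁ × G₂ → W →ₗ[ℂ] W) (y : G₁ × G₂ → G₂) (s : Finset (G₁ × G₂)),
      (∀ x, ∀ n : H, n.1.2 = 1 → ∀ w, a x (ρ n w) = ρ n (a x w)) ∧
      ∀ φ, (T φ).1 1 = ∑ x ∈ s, a x (φ.1 (1, y x)) := by
  have := Fintype.ofFinite (G₁ × G₂)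
  choose d₁ hd₁ using hs₁
  let c : G₁ × G₂ → H := fun x => ⟨(x.1, d₁ x.1), hd₁ _⟩
  refine ⟨fun x => (Nat.card H : ℂ)⁻¹ • (coindKernel T x ∘ₗ ρ (c x)), fun x => (d₁ x.1)⁻¹ * x.2,
    Finset.univ, fun x n hn w => ?_, fun φ => ?_⟩
  · have heq : x * n.1 * x⁻¹ = c x * n.1 * (c x)⁻¹ := by
      ext <;> simp [c, hn]
    have hx : x * n.1 * x⁻¹ ∈ H := heq ▸ H.mul_mem (H.mul_mem (c x).2 n.2) (H.inv_mem (c x).2)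
    have hn' : n.1 = (n.1.1, 1) := Prod.ext rfl hn
    have hk := coindKernel_comm (T := T) (n := n.1) n.2 (fun φ => by rw [hn']; exact hT _ φ) hx
      (ρ (c x) w)
    have hcn : (⟨x * n.1 * x⁻¹, hx⟩ : H) = c x * n * (c x)⁻¹ := Subtype.ext heq
    simp only [LinearMap.smul_apply, LinearMap.comp_apply, map_smul]
    rw [show ρ n = ρ ⟨n.1, n.2⟩ from rfl, hk, hcn, ← Module.End.mul_apply (ρ (c x * n * _)),
      ← map_mul, ← Module.End.mul_apply (ρ (c x)), ← map_mul]
    simp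
  · rw [apply_one_eq_sum_coindKernel, Finset.smul_sum]
    refine Finset.sum_congr rfl fun x _ => ?_
    have hx : x = (c x : G₁ × G₂) * (1, (d₁ x.1)⁻¹ * x.2) := by ext <;> simp [c]
    have hφ : φ.1 x = ρ (c x) (φ.1 (1, (d₁ x.1)⁻¹ * x.2)) := by
      rw [← φ.2 (c x)]
      exact congrArg φ.1 hx
    simp only [LinearMap.smul_apply, LinearMap.comp_apply]
    rw [← hφ]

lemma exists_kernel_of_comm_right [Finite G₁] [Finite G₂] (hs₂ : ∀ g₂, ∃ g₁, (g₁, g₂) ∈ H)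
    {ρ : Representation ℂ H W} {T : coindV H.subtype ρ →ₗ[ℂ] coindV H.subtype ρ}
    (hT : ∀ g φ, T (coind H.subtype ρ (1, g) φ) = coind H.subtype ρ (1, g) (T φ)) :
    ∃ (b : G₁ × G₂ → W →ₗ[ℂ] W) (y : G₁ × G₂ → G₁) (s : Finset (G₁ × G₂)),
      (∀ x, ∀ n : H, n.1.1 = 1 → ∀ w, b x (ρ n w) = ρ n (b x w)) ∧
      ∀ φ, (T φ).1 1 = ∑ x ∈ s, b x (φ.1 (y x, 1)) := by
  have := Fintype.ofFinite (G₁ × G₂)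
  choose d₂ hd₂ using hs₂
  let c : G₁ × G₂ → H := fun x => ⟨(d₂ x.2, x.2), hd₂ _⟩
  refine ⟨fun x => (Nat.card H : ℂ)⁻¹ • (coindKernel T x ∘ₗ ρ (c x)), fun x => (d₂ x.2)⁻¹ * x.1,
    Finset.univ, fun x n hn w => ?_, fun φ => ?_⟩
  · have heq : x * n.1 * x⁻¹ = c x * n.1 * (c x)⁻¹ := by
      ext <;> simp [c, hn]
    have hx : x * n.1 * x⁻¹ ∈ H := heq ▸ H.mul_mem (H.mul_mem (c x).2 n.2) (H.inv_mem (c x).2)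
    have hn' : n.1 = (1, n.1.2) := Prod.ext hn rfl
    have hk := coindKernel_comm (T := T) (n := n.1) n.2 (fun φ => by rw [hn']; exact hT _ φ) hx
      (ρ (c x) w)
    have hcn : (⟨x * n.1 * x⁻¹, hx⟩ : H) = c x * n * (c x)⁻¹ := Subtype.ext heq
    simp only [LinearMap.smul_apply, LinearMap.comp_apply, map_smul]
    rw [show ρ n = ρ ⟨n.1, n.2⟩ from rfl, hk, hcn, ← Module.End.mul_apply (ρ (c x * n * _)),
      ← map_mul, ← Module.End.mul_apply (ρ (c x)), ← map_mul]
    simp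
  · rw [apply_one_eq_sum_coindKernel, Finset.smul_sum]
    refine Finset.sum_congr rfl fun x _ => ?_
    have hx : x = (c x : G₁ × G₂) * ((d₂ x.2)⁻¹ * x.1, 1) := by ext <;> simp [c]
    have hφ : φ.1 x = ρ (c x) (φ.1 ((d₂ x.2)⁻¹ * x.1, 1)) := by
      rw [← φ.2 (c x)]
      exact congrArg φ.1 hx
    simp only [LinearMap.smul_apply, LinearMap.comp_apply]
    rw [← hφ]

/-- `T` acts through the second variable and `S` through the first. Both composites are double sums
over the same values of `φ`, with coefficients `a b` and `b a`. -/
lemma KernelCommutantsCommute.apply_one_comm [Finite G₁] [Finite G₂]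
    (hs₁ : ∀ g₁, ∃ g₂, (g₁, g₂) ∈ H) (hs₂ : ∀ g₂, ∃ g₁, (g₁, g₂) ∈ H)
    {ρ : Representation ℂ H W} (h : KernelCommutantsCommute ρ)
    {T S : coindV H.subtype ρ →ₗ[ℂ] coindV H.subtype ρ}
    (hT : ∀ g φ, T (coind H.subtype ρ (g, 1) φ) = coind H.subtype ρ (g, 1) (T φ))
    (hS : ∀ g φ, S (coind H.subtype ρ (1, g) φ) = coind H.subtype ρ (1, g) (S φ))
    (φ : coindV H.subtype ρ) : (T (S φ)).1 1 = (S (T φ)).1 1 := by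
  obtain ⟨a, y, s, ha, hTa⟩ := exists_kernel_of_comm_left hs₁ hT
  obtain ⟨b, z, s', hb, hSb⟩ := exists_kernel_of_comm_right hs₂ hS
  have h1 : ∀ g, (S φ).1 (1, g) = ∑ x ∈ s', b x (φ.1 (z x, g)) := by
    intro g
    have : (S φ).1 (1, g) = (coind H.subtype ρ (1, g) (S φ)).1 1 :=
      congrArg (S φ).1 (one_mul _).symm
    rw [this, ← hS, hSb]
    refine Finset.sum_congr rfl fun x _ => ?_
    change b x (φ.1 ((z x, 1) * (1, g))) = _
    simp
  have h2 : ∀ g, (T φ).1 (g, 1) = ∑ x ∈ s, a x (φ.1 (g, y x)) := by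
    intro g
    have : (T φ).1 (g, 1) = (coind H.subtype ρ (g, 1) (T φ)).1 1 :=
      congrArg (T φ).1 (one_mul _).symm
    rw [this, ← hT, hTa]
    refine Finset.sum_congr rfl fun x _ => ?_
    change a x (φ.1 ((1, y x) * (g, 1))) = _
    simp
  rw [hTa, hSb]
  simp only [h1, h2, map_sum]
  rw [Finset.sum_comm]
  exact Finset.sum_congr rfl fun x _ => Finset.sum_congr rfl fun x' _ => h _ _ (ha _) (hb _) _

/-- If `H ≤ G₁ × G₂` projects onto both factors, the commutants of `G₁` and `G₂` in the
representation coinduced from `H` commute if and only if those of `H ∩ G₁` and `H ∩ G₂` do. -/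
lemma kernelCommutantsCommute_iff_coind [Finite G₁] [Finite G₂]
    (hs₁ : ∀ g₁, ∃ g₂, (g₁, g₂) ∈ H) (hs₂ : ∀ g₂, ∃ g₁, (g₁, g₂) ∈ H)
    (ρ : Representation ℂ H W) :
    KernelCommutantsCommute ρ ↔ CommutantsCommute (coind H.subtype ρ) := by
  refine ⟨fun h T S hT hS φ => ?_, KernelCommutantsCommute.of_coind hs₁ hs₂⟩
  let π := coind H.subtype ρ
  have hinv : ∀ g ψ, π g⁻¹ (π g ψ) = ψ := fun g ψ => by
    rw [← Module.End.mul_apply, ← map_mul]; simp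
  have hcomm : ∀ (g₁ : G₁) (g₂ : G₂) ψ, π (g₁, 1) (π (1, g₂) ψ) = π (1, g₂) (π (g₁, 1) ψ) :=
    fun g₁ g₂ ψ => by
      rw [← Module.End.mul_apply, ← map_mul, ← Module.End.mul_apply, ← map_mul]; simp
  ext1
  funext g
  obtain ⟨g₁, g₂⟩ := g
  have hg : ∀ ψ, π (g₁, g₂) ψ = π (1, g₂) (π (g₁, 1) ψ) := fun ψ => by
    rw [← Module.End.mul_apply, ← map_mul]; simp
  have hval : ∀ ψ : coindV H.subtype ρ, ψ.1 (g₁, g₂) = (π (g₁, g₂) ψ).1 1 := fun ψ =>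
    congrArg ψ.1 (one_mul _).symm
  have hi₁ : ∀ ψ, π (g₁⁻¹, 1) (π (g₁, 1) ψ) = ψ := fun ψ => by
    have := hinv (g₁, 1) ψ
    simpa using this
  have hi₂ : ∀ ψ, π (1, g₂⁻¹) (π (1, g₂) ψ) = ψ := fun ψ => by
    have := hinv (1, g₂) ψ
    simpa using this
  -- The value at `(g₁, g₂)` is a value at `1` after translation. Conjugating `T` by `G₂` and `S` by
  -- `G₁` preserves their commutation properties.
  have key := h.apply_one_comm hs₁ hs₂ (T := π (1, g₂) ∘ₗ T ∘ₗ π (1, g₂⁻¹))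
    (S := π (g₁, 1) ∘ₗ S ∘ₗ π (g₁⁻¹, 1))
    (fun g ψ => by
      change π (1, g₂) (T (π (1, g₂⁻¹) (π (g, 1) ψ))) = π (g, 1) (π (1, g₂) (T (π (1, g₂⁻¹) ψ)))
      rw [← hcomm, hT, hcomm])
    (fun g ψ => by
      change π (g₁, 1) (S (π (g₁⁻¹, 1) (π (1, g) ψ))) = π (1, g) (π (g₁, 1) (S (π (g₁⁻¹, 1) ψ)))
      rw [hcomm, hS, hcomm]) (π (g₁, g₂) φ)
  have hSg : ∀ ψ, π (g₁, 1) (S (π (g₁⁻¹, 1) (π (g₁, g₂) ψ))) = π (g₁, g₂) (S ψ) := fun ψ => by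
    rw [hg, hg, ← hcomm, hi₁, hS, hcomm]
  have hTg : ∀ ψ, π (1, g₂) (T (π (1, g₂⁻¹) (π (g₁, g₂) ψ))) = π (g₁, g₂) (T ψ) := fun ψ => by
    rw [hg, hg, hi₂, hT]
  simp only [LinearMap.comp_apply, hSg, hTg] at key
  rw [hval, hval]
  exact key

end CoinducedProduct
end ThetaMonoid
namespace ThetaMonoid

/-! ### Finite semisimple monoids which are centric in themselves -/

section Clifford

variable {M : Type*} [Monoid M]

/-- Every element satisfies `m ^ (k + 1) = m`, and the idempotents are central. -/
structure IsCliffordWithExponent (M : Type*) [Monoid M] (k : ℕ) : Prop where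
  pos : 0 < k
  pow_succ_eq : ∀ m : M, m ^ (k + 1) = m
  central : ∀ e : M, e * e = e → ∀ m, e * m = m * e

/-- In a semisimple ring the left ideal of `m` is generated by an idempotent, so `m = m s m` in the
algebra. Comparing coefficients at `m` gives a solution in the monoid. -/
lemma IsSemisimpleMonoid.exists_eq_mul_mul (h : IsSemisimpleMonoid M) (m : M) :
    ∃ n, m = m * n * m := by
  have := h
  unfold IsSemisimpleMonoid at this
  obtain ⟨e, he, hI⟩ := IsSemisimpleRing.ideal_eq_span_idempotent
    (Ideal.span {MonoidAlgebra.single m (1 : ℂ)})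
  obtain ⟨r, hr⟩ := Ideal.mem_span_singleton'.1
    (show MonoidAlgebra.single m (1 : ℂ) ∈ Ideal.span {e} from
      hI ▸ Ideal.mem_span_singleton_self _)
  obtain ⟨s, hs⟩ := Ideal.mem_span_singleton'.1
    (show e ∈ Ideal.span {MonoidAlgebra.single m (1 : ℂ)} from
      hI ▸ Ideal.mem_span_singleton_self _)
  have h1 : MonoidAlgebra.single m (1 : ℂ) * s * MonoidAlgebra.single m (1 : ℂ) =
      MonoidAlgebra.single m (1 : ℂ) := by
    rw [mul_assoc, hs, ← hr, mul_assoc, he.eq]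
  by_contra! hcon
  have h2 : ∀ s : MonoidAlgebra ℂ M,
      (MonoidAlgebra.single m (1 : ℂ) * s * MonoidAlgebra.single m (1 : ℂ)).coeff m = 0 := by
    intro s
    induction s using MonoidAlgebra.induction_linear with
    | zero => simp
    | add x y hx hy => simp [mul_add, add_mul, hx, hy]
    | single n c =>
      rw [MonoidAlgebra.single_mul_single, MonoidAlgebra.single_mul_single]
      simp [(hcon n).symm]
  have h3 := h2 s
  rw [h1] at h3
  simp at h3

lemma IsCentric.exists_mul_left (h : IsCentric (⊤ : Submonoid M)) (m n : M) :
    ∃ n', n * m = m * n' := by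
  have : n * m ∈ (fun n => n * m) '' ((⊤ : Submonoid M) : Set M) := ⟨n, trivial, rfl⟩
  rw [← h m] at this
  obtain ⟨n', -, hn'⟩ := this
  exact ⟨n', hn'.symm⟩

lemma IsCentric.exists_mul_right (h : IsCentric (⊤ : Submonoid M)) (m n : M) :
    ∃ n', m * n = n' * m := by
  have : m * n ∈ (fun n => m * n) '' ((⊤ : Submonoid M) : Set M) := ⟨n, trivial, rfl⟩
  rw [h m] at this
  obtain ⟨n', -, hn'⟩ := this
  exact ⟨n', hn'.symm⟩

lemma pow_mul_succ_eq {k : ℕ} {m : M} (h : m ^ (k + 1) = m) (j : ℕ) : m ^ (k * j + 1) = m := by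
  induction j with
  | zero => simp
  | succ j ih =>
    rw [show k * (j + 1) + 1 = k + (k * j + 1) by ring, pow_add, ih, ← pow_succ, h]

/-- Regularity and `mM = Mm` give `m = m² x`, so `m` can be recovered from its higher powers.
Finiteness makes the powers periodic, and the period starts at `m` itself. -/
lemma exists_isCliffordWithExponent [Finite M] (hs : IsSemisimpleMonoid M)
    (hc : IsCentric (⊤ : Submonoid M)) : ∃ k, IsCliffordWithExponent M k := by
  have key : ∀ m : M, ∃ p, 0 < p ∧ m ^ (p + 1) = m := by
    intro m
    obtain ⟨n, hn⟩ := hs.exists_eq_mul_mul m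
    obtain ⟨x, hx⟩ := hc.exists_mul_left m n
    have hmx : m * m * x = m := by
      rw [mul_assoc, ← hx, ← mul_assoc]
      exact hn.symm
    have hpow : ∀ j, m ^ (j + 1) * x ^ j = m := by
      intro j
      induction j with
      | zero => simp
      | succ j ih =>
        calc m ^ (j + 1 + 1) * x ^ (j + 1) = m ^ j * (m * m * x) * x ^ j := by
              rw [pow_succ m (j + 1), pow_succ m j, pow_succ' x j]
              simp only [mul_assoc]
          _ = m := by rw [hmx, ← pow_succ, ih]
    -- From `m ^ a = m ^ b`, right multiplication by `m * x ^ a` cancels the preperiod, leaving the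
    -- exponent `b - a`.
    obtain ⟨a, b, hab, heq⟩ := Finite.exists_ne_map_eq_of_infinite fun i : ℕ => m ^ i
    wlog hlt : a < b generalizing a b
    · exact this b a hab.symm heq.symm (lt_of_le_of_ne (not_lt.1 hlt) hab.symm)
    refine ⟨b - a, Nat.sub_pos_of_lt hlt, ?_⟩
    have h1 : m ^ (b - a) * m ^ a = m ^ a := by
      rw [← pow_add, Nat.sub_add_cancel hlt.le]
      exact heq.symm
    calc m ^ (b - a + 1) = m ^ (b - a) * (m ^ (a + 1) * x ^ a) := by rw [pow_succ, hpow]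
      _ = m ^ (b - a) * m ^ a * (m * x ^ a) := by rw [pow_succ]; simp only [mul_assoc]
      _ = m := by rw [h1, ← mul_assoc, ← pow_succ, hpow]
  choose p hp hpm using key
  have := Fintype.ofFinite M
  -- The product is a common multiple of the individual periods.
  refine ⟨∏ m, p m, Finset.prod_pos fun m _ => hp m, fun m => ?_, fun e he m => ?_⟩
  · obtain ⟨j, hj⟩ := Finset.dvd_prod_of_mem p (Finset.mem_univ m)
    rw [hj]
    exact pow_mul_succ_eq (hpm m) j
  -- `e * m` lies in `Me` and `m * e` in `eM`, so both equal `e * m * e`.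
  · obtain ⟨n, hn⟩ := hc.exists_mul_left e m
    obtain ⟨n', hn'⟩ := hc.exists_mul_right e m
    calc e * m = e * m * e := by rw [hn', mul_assoc, he]
      _ = m * e := by rw [mul_assoc, hn, ← mul_assoc, he]

lemma idem_pow {e : M} (he : e * e = e) {j : ℕ} (hj : j ≠ 0) : e ^ j = e :=
  IsIdempotentElem.pow_eq he hj

namespace IsCliffordWithExponent

variable {k : ℕ} (h : IsCliffordWithExponent M k)

include h

lemma pow_mul_self (m : M) : m ^ k * m = m := by rw [← pow_succ, h.pow_succ_eq]

lemma self_mul_pow (m : M) : m * m ^ k = m := by rw [← pow_succ', h.pow_succ_eq]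

lemma mul_left_of_pow (m : M) {j : ℕ} (hj : 0 < j) : m ^ k * m ^ j = m ^ j := by
  obtain ⟨i, rfl⟩ := Nat.exists_eq_add_of_lt hj
  rw [zero_add, pow_succ', ← mul_assoc, h.pow_mul_self]

lemma pow_idem (m : M) : m ^ k * m ^ k = m ^ k := h.mul_left_of_pow m h.pos

lemma mul_pow_mul_pow (m n : M) : (m * n) ^ k * n ^ k = (m * n) ^ k := by
  obtain ⟨i, hi⟩ := Nat.exists_eq_add_of_lt h.pos
  have : (m * n) ^ k = (m * n) ^ i * (m * n) := by rw [← pow_succ, hi, zero_add]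
  rw [this, mul_assoc, mul_assoc m, h.self_mul_pow]

/-- `e` is a right multiple of `m * n`, hence absorbs `(m * n) ^ k` on the left, while `n * e = n`
makes `(m * n) ^ k` absorb `e`. -/
lemma mul_pow_eq {e m n : M} (hm : m ^ k = e) (hn : n ^ k = e) :
    (m * n) ^ k = e := by
  obtain ⟨i, hi⟩ := Nat.exists_eq_add_of_lt h.pos
  have hme : m * e = m := hm ▸ h.self_mul_pow m
  have hne : n * e = n := hn ▸ h.self_mul_pow n
  have h1 : m * n * (n ^ i * m ^ i) = e := by
    rw [zero_add] at hi
    calc m * n * (n ^ i * m ^ i) = m * (n * n ^ i) * m ^ i := by simp only [mul_assoc]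
      _ = m * m ^ i := by rw [← pow_succ', ← hi, hn, hme]
      _ = e := by rw [← pow_succ', ← hi, hm]
  have h2 : (m * n) ^ k * e = e := by
    rw [← h1, ← mul_assoc, h.pow_mul_self]
  have h3 : (m * n) ^ k * e = (m * n) ^ k := by
    have : (m * n) ^ k = (m * n) ^ i * (m * n) := by rw [← pow_succ, hi, zero_add]
    rw [this, mul_assoc, mul_assoc m n e, hne]
  rw [← h3, h2]

lemma pow_eq_of_mul_pow_eq {e m n : M} (hm : m * e = m)
    (hmn : (m * n) ^ k = e) : m ^ k = e := by
  obtain ⟨i, hi⟩ := Nat.exists_eq_add_of_lt h.pos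
  rw [zero_add] at hi
  have h1 : m ^ k * e = e := by
    rw [← hmn, hi, pow_succ' (m * n), ← hi, ← mul_assoc, ← mul_assoc, h.pow_mul_self]
  have h2 : m ^ k * e = m ^ k := by
    rw [hi, pow_succ, mul_assoc, hm]
  rw [← h2, h1]

end IsCliffordWithExponent

/-- The maximal subgroup `G` of a monoid `M` at an idempotent `e`, with the retraction of `M` onto
`G` with a zero adjoined which sends `m` to `m * e` if this is in the subgroup. -/
structure MaximalSubgroup (e : M) (G : Type*) [Group G] where
  /-- The inclusion. -/
  incl : G → M
  /-- The retraction. -/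
  ret : M →* WithZero G
  incl_mul : ∀ g h, incl (g * h) = incl g * incl h
  incl_one : incl 1 = e
  ret_incl : ∀ g : G, ret (incl g) = g
  incl_of_ret : ∀ (m : M) (g : G), ret m = g → incl g = m * e

/-- The group is the set of `m` with `m ^ k = e`. Multiplicativity of the retraction is the fact
that a product times `e` lies in the group exactly when each factor times `e` does. -/
lemma IsCliffordWithExponent.exists_maximalSubgroup.{u} {M : Type u} [Monoid M] [Finite M] {k : ℕ}
    (h : IsCliffordWithExponent M k) {e : M} (he : e * e = e) :
    ∃ (G : Type u) (_ : Group G) (_ : Finite G), Nonempty (MaximalSubgroup e G) := by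
  classical
  let G : Type u := {m : M // m ^ k = e}
  let _ : Mul G := ⟨fun a b => ⟨a.1 * b.1, h.mul_pow_eq a.2 b.2⟩⟩
  let _ : One G := ⟨⟨e, idem_pow he h.pos.ne'⟩⟩
  have hpos : 0 < 2 * k - 1 := by have := h.pos; omega
  -- The exponent `k - 1` would fail for `k = 1`, since `a ^ 0 = 1` need not lie in the group; `2 *
  -- k - 1` is always positive.
  let _ : Inv G := ⟨fun a => ⟨a.1 ^ (2 * k - 1), by
    rw [← pow_mul, mul_comm, pow_mul, a.2, idem_pow he hpos.ne']⟩⟩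
  have hright : ∀ a : G, a.1 * e = a.1 := fun a => by
    have := h.self_mul_pow a.1
    rwa [a.2] at this
  let _ : Group G := Group.ofLeftAxioms (fun a b c => Subtype.ext (mul_assoc _ _ _))
    (fun a => Subtype.ext (by
      change e * a.1 = a.1
      rw [h.central e he, hright]))
    (fun a => Subtype.ext (by
      change a.1 ^ (2 * k - 1) * a.1 = e
      rw [← pow_succ, show 2 * k - 1 + 1 = k + k by omega, pow_add, a.2, he]))
  have hmul : ∀ m n : M, m * n * e = m * e * (n * e) := fun m n => by
    rw [mul_assoc m e, ← mul_assoc e n e, h.central e he n, mul_assoc n e e, he, mul_assoc]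
  have hiff : ∀ m n : M, (m * n * e) ^ k = e ↔ (m * e) ^ k = e ∧ (n * e) ^ k = e := fun m n => by
    constructor
    · intro hmn
      have h1 : (m * e * (n * e)) ^ k = e := by rw [← hmul, hmn]
      have h2 := h.pow_eq_of_mul_pow_eq (by rw [mul_assoc, he]) h1
      refine ⟨h2, ?_⟩
      have h3 : (n * e) ^ k * e = e := by
        have := h.mul_pow_mul_pow (m * e) (n * e)
        rwa [h1, ← h.central _ (h.pow_idem _)] at this
      obtain ⟨i, hi⟩ := Nat.exists_eq_add_of_lt h.pos
      rw [zero_add] at hi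
      have h4 : (n * e) ^ k * e = (n * e) ^ k := by
        rw [hi, pow_succ, mul_assoc, mul_assoc n, he]
      rw [← h4, h3]
    · rintro ⟨hm, hn⟩
      rw [hmul]
      exact h.mul_pow_eq hm hn
  let r : M → WithZero G := fun m => if hm : (m * e) ^ k = e then ((⟨m * e, hm⟩ : G) : WithZero G)
    else 0
  have hr : ∀ m (hm : (m * e) ^ k = e), r m = ((⟨m * e, hm⟩ : G) : WithZero G) := fun m hm =>
    dif_pos hm
  have hr0 : ∀ m, ¬ (m * e) ^ k = e → r m = 0 := fun m hm => dif_neg hm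
  refine ⟨G, inferInstance, inferInstanceAs (Finite {m : M // m ^ k = e}), ⟨
    { incl := Subtype.val
      ret := ⟨⟨r, ?_⟩, ?_⟩
      incl_mul := fun _ _ => rfl
      incl_one := rfl
      ret_incl := fun g => ?_
      incl_of_ret := fun m g hm => ?_ }⟩⟩
  · have h1 : ((1 : M) * e) ^ k = e := by rw [one_mul, idem_pow he h.pos.ne']
    rw [hr 1 h1]
    exact congrArg _ (Subtype.ext (one_mul e))
  · intro m n
    change r (m * n) = r m * r n
    by_cases hm : (m * e) ^ k = e
    · by_cases hn : (n * e) ^ k = e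
      · rw [hr m hm, hr n hn, hr _ ((hiff m n).2 ⟨hm, hn⟩), ← WithZero.coe_mul]
        exact congrArg _ (Subtype.ext (hmul m n))
      · rw [hr0 n hn, hr0 _ (fun h' => hn ((hiff m n).1 h').2), mul_zero]
    · rw [hr0 m hm, hr0 _ (fun h' => hm ((hiff m n).1 h').1), zero_mul]
  · have h1 : (g.1 * e) ^ k = e := by rw [hright, g.2]
    change r g.1 = g
    rw [hr _ h1]
    exact congrArg _ (Subtype.ext (hright g))
  · change r m = g at hm
    by_cases h1 : (m * e) ^ k = e
    · rw [hr m h1, WithZero.coe_inj] at hm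
      rw [← hm]
    · rw [hr0 m h1] at hm
      exact absurd hm.symm WithZero.coe_ne_zero

namespace MaximalSubgroup

variable {e : M} {G : Type*} [Group G] (μ : MaximalSubgroup e G)

lemma ret_idem : μ.ret e = 1 := by
  have := μ.ret_incl 1
  rwa [μ.incl_one, WithZero.coe_one] at this

lemma exists_ret_eq {m : M} (h : μ.ret m ≠ 0) : ∃ g : G, μ.ret m = g :=
  ⟨_, (WithZero.coe_unzero h).symm⟩

lemma idem_mul_idem {e : M} {G : Type*} [Group G] (μ : MaximalSubgroup e G) : e * e = e := by
  have := μ.incl_mul 1 1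
  rw [mul_one, μ.incl_one] at this
  exact this.symm

lemma incl_mul_idem (g : G) : μ.incl g * e = μ.incl g := by
  have := μ.incl_mul g 1
  rw [mul_one, μ.incl_one] at this
  exact this.symm

lemma ret_ne_zero_of_eq {m a b : M} (h : e = a * m * b) : μ.ret m ≠ 0 := by
  intro h0
  have : μ.ret (a * m * b) = 1 := by rw [← h, μ.ret_idem]
  rw [map_mul, map_mul, h0, mul_zero, zero_mul] at this
  exact zero_ne_one this

/-- A group has only one idempotent, so `d` retracts to `1`. -/
lemma eq_idem_of_ret_ne_zero {d : M} (hd : d * d = d) (hde : d * e = d) (h : μ.ret d ≠ 0) :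
    d = e := by
  obtain ⟨g, hg⟩ := μ.exists_ret_eq h
  have h1 : g = 1 := by
    have := congrArg μ.ret hd
    rw [map_mul, hg, ← WithZero.coe_mul, WithZero.coe_inj] at this
    simpa using this
  rw [← hde, ← μ.incl_of_ret d g hg, h1, μ.incl_one]

end MaximalSubgroup

end Clifford
end ThetaMonoid
namespace ThetaMonoid

/-! ### Inflation from the maximal subgroup at an idempotent -/

section Inflate

variable {M₁ M₂ G₁ G₂ V : Type*} [Monoid M₁] [Monoid M₂] [Group G₁] [Group G₂]
  [AddCommGroup V] [Module ℂ V] {f₁ : M₁} {f₂ : M₂}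

open Representation

lemma IsCliffordWithExponent.prod {k₁ k₂ : ℕ} (h₁ : IsCliffordWithExponent M₁ k₁)
    (h₂ : IsCliffordWithExponent M₂ k₂) : IsCliffordWithExponent (M₁ × M₂) (k₁ * k₂) where
  pos := Nat.mul_pos h₁.pos h₂.pos
  pow_succ_eq m := Prod.ext (pow_mul_succ_eq (h₁.pow_succ_eq m.1) k₂) (by
    rw [mul_comm]
    exact pow_mul_succ_eq (h₂.pow_succ_eq m.2) k₁)
  central e he m := Prod.ext (h₁.central e.1 (congrArg Prod.fst he) m.1)
    (h₂.central e.2 (congrArg Prod.snd he) m.2)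

/-- The representation of `M₁ × M₂` on a representation of a maximal subgroup `G₁ × G₂`. -/
def inflate (μ₁ : MaximalSubgroup f₁ G₁) (μ₂ : MaximalSubgroup f₂ G₂)
    (π : Representation ℂ (G₁ × G₂) V) : Representation ℂ (M₁ × M₂) V :=
  MonoidHom.noncommCoprod
    ((WithZero.lift' (π.comp (MonoidHom.inl G₁ G₂)) : WithZero G₁ →* Module.End ℂ V).comp μ₁.ret)
    ((WithZero.lift' (π.comp (MonoidHom.inr G₁ G₂)) : WithZero G₂ →* Module.End ℂ V).comp μ₂.ret)
    (fun m n => by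
      change WithZero.lift' _ (μ₁.ret m) * WithZero.lift' _ (μ₂.ret n) =
        WithZero.lift' _ (μ₂.ret n) * WithZero.lift' _ (μ₁.ret m)
      induction μ₁.ret m using WithZero.recZeroCoe with
      | zero => simp
      | coe a =>
        induction μ₂.ret n using WithZero.recZeroCoe with
        | zero => simp
        | coe b =>
          rw [WithZero.lift'_coe, WithZero.lift'_coe]
          change π (a, 1) * π (1, b) = π (1, b) * π (a, 1)
          rw [← map_mul, ← map_mul]
          simp)

variable (μ₁ : MaximalSubgroup f₁ G₁) (μ₂ : MaximalSubgroup f₂ G₂)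
  (π : Representation ℂ (G₁ × G₂) V)

lemma inflate_apply (m : M₁ × M₂) : inflate μ₁ μ₂ π m =
    WithZero.lift' (π.comp (MonoidHom.inl G₁ G₂)) (μ₁.ret m.1) *
      WithZero.lift' (π.comp (MonoidHom.inr G₁ G₂)) (μ₂.ret m.2) := rfl

lemma inflate_apply_of_coe {m : M₁ × M₂} {g : G₁ × G₂} (h₁ : μ₁.ret m.1 = g.1)
    (h₂ : μ₂.ret m.2 = g.2) : inflate μ₁ μ₂ π m = π g := by
  rw [inflate_apply, h₁, h₂, WithZero.lift'_coe, WithZero.lift'_coe]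
  change π (g.1, 1) * π (1, g.2) = π g
  rw [← map_mul]
  simp

lemma inflate_apply_of_zero {m : M₁ × M₂} (h : μ₁.ret m.1 = 0 ∨ μ₂.ret m.2 = 0) :
    inflate μ₁ μ₂ π m = 0 := by
  rw [inflate_apply]
  rcases h with h | h <;> simp [h]

lemma exists_coe_or_zero (m : M₁ × M₂) :
    (∃ g : G₁ × G₂, μ₁.ret m.1 = g.1 ∧ μ₂.ret m.2 = g.2) ∨ (μ₁.ret m.1 = 0 ∨ μ₂.ret m.2 = 0) := by
  by_cases h₁ : μ₁.ret m.1 = 0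
  · exact Or.inr (Or.inl h₁)
  by_cases h₂ : μ₂.ret m.2 = 0
  · exact Or.inr (Or.inr h₂)
  obtain ⟨g₁, hg₁⟩ := μ₁.exists_ret_eq h₁
  obtain ⟨g₂, hg₂⟩ := μ₂.exists_ret_eq h₂
  exact Or.inl ⟨(g₁, g₂), hg₁, hg₂⟩

/-- The inclusion of the maximal subgroup. -/
def inclProd (g : G₁ × G₂) : M₁ × M₂ := (μ₁.incl g.1, μ₂.incl g.2)

lemma inflate_inclProd (g : G₁ × G₂) : inflate μ₁ μ₂ π (inclProd μ₁ μ₂ g) = π g :=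
  inflate_apply_of_coe μ₁ μ₂ π (μ₁.ret_incl g.1) (μ₂.ret_incl g.2)

lemma inclProd_mul (g g' : G₁ × G₂) :
    inclProd μ₁ μ₂ (g * g') = inclProd μ₁ μ₂ g * inclProd μ₁ μ₂ g' :=
  Prod.ext (μ₁.incl_mul _ _) (μ₂.incl_mul _ _)

lemma inclProd_one : inclProd μ₁ μ₂ 1 = (f₁, f₂) := Prod.ext μ₁.incl_one μ₂.incl_one

lemma inclProd_mul_idem (g : G₁ × G₂) : inclProd μ₁ μ₂ g * (f₁, f₂) = inclProd μ₁ μ₂ g := by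
  rw [← inclProd_one μ₁ μ₂, ← inclProd_mul, mul_one]

lemma inclProd_eq {m : M₁ × M₂} {g : G₁ × G₂} (h₁ : μ₁.ret m.1 = g.1) (h₂ : μ₂.ret m.2 = g.2) :
    inclProd μ₁ μ₂ g = m * (f₁, f₂) :=
  Prod.ext (μ₁.incl_of_ret _ _ h₁) (μ₂.incl_of_ret _ _ h₂)

lemma idem_mul_idem_prod (μ₁ : MaximalSubgroup f₁ G₁) (μ₂ : MaximalSubgroup f₂ G₂) :
    (f₁, f₂) * (f₁, f₂) = (f₁, f₂) :=
  Prod.ext μ₁.idem_mul_idem μ₂.idem_mul_idem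

/-- Translates nonvanishing of the retraction into the ideal condition that defines an apex. -/
lemma exists_coe_iff (m : M₁ × M₂) :
    (∃ g : G₁ × G₂, μ₁.ret m.1 = g.1 ∧ μ₂.ret m.2 = g.2) ↔ ∃ a b, (f₁, f₂) = a * m * b := by
  constructor
  · rintro ⟨g, h₁, h₂⟩
    refine ⟨1, (f₁, f₂) * inclProd μ₁ μ₂ g⁻¹, ?_⟩
    rw [one_mul, ← mul_assoc, ← inclProd_eq μ₁ μ₂ h₁ h₂, ← inclProd_mul, mul_inv_cancel,
      inclProd_one]
  · rintro ⟨a, b, h⟩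
    refine (exists_coe_or_zero μ₁ μ₂ m).resolve_right ?_
    rintro (h' | h')
    · exact μ₁.ret_ne_zero_of_eq (congrArg Prod.fst h) h'
    · exact μ₂.ret_ne_zero_of_eq (congrArg Prod.snd h) h'

lemma eq_idem_of_coe {d : M₁ × M₂} {g : G₁ × G₂} (hd : d * d = d) (hdf : d * (f₁, f₂) = d)
    (h₁ : μ₁.ret d.1 = g.1) (h₂ : μ₂.ret d.2 = g.2) : d = (f₁, f₂) :=
  Prod.ext
    (μ₁.eq_idem_of_ret_ne_zero (congrArg Prod.fst hd) (congrArg Prod.fst hdf)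
      (h₁ ▸ WithZero.coe_ne_zero))
    (μ₂.eq_idem_of_ret_ne_zero (congrArg Prod.snd hd) (congrArg Prod.snd hdf)
      (h₂ ▸ WithZero.coe_ne_zero))

/-- Maschke's theorem: every element acts as a group element or as zero, so the invariant subspaces
are those of the group. -/
lemma isSemisimple_inflate [Finite G₁] [Finite G₂] :
    (inflate μ₁ μ₂ π).IsSemisimpleRepresentation := by
  have : NeZero (Nat.card (G₁ × G₂) : ℂ) := ⟨Nat.cast_ne_zero.2 Nat.card_pos.ne'⟩
  have h : π.IsSemisimpleRepresentation := inferInstance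
  refine (OrderIso.complementedLattice_iff (subrepresentationOrderIso _ π fun K => ?_)).2 h
  constructor
  · intro hK g v hv
    rw [← inflate_inclProd μ₁ μ₂]
    exact hK _ v hv
  · intro hK m v hv
    rcases exists_coe_or_zero μ₁ μ₂ m with ⟨g, h₁, h₂⟩ | h
    · rw [inflate_apply_of_coe μ₁ μ₂ π h₁ h₂]
      exact hK g v hv
    · rw [inflate_apply_of_zero μ₁ μ₂ π h]
      exact K.zero_mem

lemma commutantsCommute_inflate_iff :
    CommutantsCommute (inflate μ₁ μ₂ π) ↔ CommutantsCommute π := by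
  have h₁ : ∀ T : V →ₗ[ℂ] V, (∀ m v, T (inflate μ₁ μ₂ π (m, 1) v) = inflate μ₁ μ₂ π (m, 1) (T v)) ↔
      ∀ g v, T (π (g, 1) v) = π (g, 1) (T v) := by
    intro T
    constructor
    · intro h g v
      have := h (μ₁.incl g) v
      rwa [inflate_apply_of_coe μ₁ μ₂ π (g := (g, 1)) (μ₁.ret_incl g) (map_one μ₂.ret)] at this
    · intro h m v
      rcases exists_coe_or_zero μ₁ μ₂ (m, 1) with ⟨g, h₁, h₂⟩ | h0
      · rw [inflate_apply_of_coe μ₁ μ₂ π h₁ h₂]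
        have hg : g = (g.1, 1) := Prod.ext rfl (by
          have h₂ : μ₂.ret 1 = g.2 := h₂
          rw [map_one, ← WithZero.coe_one, WithZero.coe_inj] at h₂
          exact h₂.symm)
        rw [hg]
        exact h _ _
      · rw [inflate_apply_of_zero μ₁ μ₂ π h0]
        simp
  have h₂ : ∀ T : V →ₗ[ℂ] V, (∀ m v, T (inflate μ₁ μ₂ π (1, m) v) = inflate μ₁ μ₂ π (1, m) (T v)) ↔
      ∀ g v, T (π (1, g) v) = π (1, g) (T v) := by
    intro T
    constructor
    · intro h g v
      have := h (μ₂.incl g) v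
      rwa [inflate_apply_of_coe μ₁ μ₂ π (g := (1, g)) (map_one μ₁.ret) (μ₂.ret_incl g)] at this
    · intro h m v
      rcases exists_coe_or_zero μ₁ μ₂ (1, m) with ⟨g, h₁, h₂⟩ | h0
      · rw [inflate_apply_of_coe μ₁ μ₂ π h₁ h₂]
        have hg : g = (1, g.2) := Prod.ext (by
          have h₁ : μ₁.ret 1 = g.1 := h₁
          rw [map_one, ← WithZero.coe_one, WithZero.coe_inj] at h₁
          exact h₁.symm) rfl
        rw [hg]
        exact h _ _
      · rw [inflate_apply_of_zero μ₁ μ₂ π h0]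
        simp
  simp only [CommutantsCommute, h₁, h₂]

/-- An irreducible quotient of an inflated representation has apex `(f₁, f₂)`. -/
lemma isApex_of_inflate {X : Type*} [AddCommGroup X] [Module ℂ X]
    {ξ : Representation ℂ (M₁ × M₂) X}
    (hξ : ξ.IsIrreducible) (p : (inflate μ₁ μ₂ π).IntertwiningMap ξ) (hp : p ≠ 0) :
    IsApex ξ (f₁, f₂) := by
  have hps := (IsIrreducible.surjective_or_eq_zero p).resolve_right hp
  refine ⟨idem_mul_idem_prod μ₁ μ₂, fun m => ?_⟩
  rw [← exists_coe_iff μ₁ μ₂]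
  constructor
  · rintro h0 ⟨g, h₁, h₂⟩
    apply hp
    ext v
    -- An element with nonzero retraction acts invertibly, so it cannot act by zero on a nonzero
    -- quotient.
    have : v = inflate μ₁ μ₂ π m (π g⁻¹ v) := by
      rw [inflate_apply_of_coe μ₁ μ₂ π h₁ h₂, ← Module.End.mul_apply, ← map_mul]
      simp
    change p v = 0
    rw [this, p.isIntertwining, h0]
    rfl
  · intro h
    have h0 := (exists_coe_or_zero μ₁ μ₂ m).resolve_left h
    ext x
    obtain ⟨v, rfl⟩ := hps x
    rw [← p.isIntertwining, inflate_apply_of_zero μ₁ μ₂ π h0]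
    exact map_zero p

end Inflate

section ExtendZero

variable {G₁ G₂ W : Type*} [AddCommGroup W]

/-- Extension of a function on a group by zero, evaluated on the group with zero. -/
def extendZero (ψ : G₁ × G₂ → W) (a : WithZero G₁) (b : WithZero G₂) : W :=
  WithZero.recZeroCoe 0 (fun g₁ => WithZero.recZeroCoe 0 (fun g₂ => ψ (g₁, g₂)) b) a

lemma extendZero_coe (ψ : G₁ × G₂ → W) (g : G₁ × G₂) : extendZero ψ g.1 g.2 = ψ g := rfl

lemma extendZero_of_zero (ψ : G₁ × G₂ → W) {a : WithZero G₁} {b : WithZero G₂}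
    (h : a = 0 ∨ b = 0) : extendZero ψ a b = 0 := by
  rcases h with rfl | rfl
  · rfl
  · induction a using WithZero.recZeroCoe <;> rfl

end ExtendZero

/-! ### The part of an induced representation at an idempotent -/

section Induced

variable {M₁ M₂ G₁ G₂ W : Type*} [Monoid M₁] [Monoid M₂] [Group G₁] [Group G₂]
  [AddCommGroup W] [Module ℂ W] {f₁ : M₁} {f₂ : M₂} [Finite G₁] [Finite G₂]
  (μ₁ : MaximalSubgroup f₁ G₁) (μ₂ : MaximalSubgroup f₂ G₂) {Γ : Submonoid (M₁ × M₂)}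

open Representation

/-- The intersection of `Γ` with the maximal subgroup at `(f₁, f₂)`. -/
def unitSubgroup (hf : (f₁, f₂) ∈ Γ) : Subgroup (G₁ × G₂) where
  carrier := {g | inclProd μ₁ μ₂ g ∈ Γ}
  one_mem' := by
    change inclProd μ₁ μ₂ 1 ∈ Γ
    rwa [inclProd_one]
  mul_mem' {g g'} hg hg' := by
    change inclProd μ₁ μ₂ (g * g') ∈ Γ
    rw [inclProd_mul]
    exact Γ.mul_mem hg hg'
  inv_mem' {g} hg := by
    change inclProd μ₁ μ₂ g⁻¹ ∈ Γ
    -- `Γ` is only a submonoid; finiteness of the group turns inverses into powers.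
    have h1 : g⁻¹ = g ^ (Nat.card (G₁ × G₂) - 1) := by
      rw [inv_eq_iff_mul_eq_one, ← pow_succ', Nat.sub_add_cancel Nat.card_pos, pow_card_eq_one']
    rw [h1]
    induction Nat.card (G₁ × G₂) - 1 with
    | zero =>
      rw [pow_zero, inclProd_one]
      exact hf
    | succ n ih =>
      rw [pow_succ, inclProd_mul]
      exact Γ.mul_mem ih hg

/-- The restriction of a representation of `Γ` on which `(f₁, f₂)` acts by the identity to the
intersection of `Γ` with the maximal subgroup at `(f₁, f₂)`. -/
def unitRep (hf : (f₁, f₂) ∈ Γ) {ρ : Representation ℂ Γ W} (hρ : ρ ⟨(f₁, f₂), hf⟩ = 1) :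
    Representation ℂ (unitSubgroup μ₁ μ₂ hf) W where
  toFun g := ρ ⟨inclProd μ₁ μ₂ g.1, g.2⟩
  map_one' := by
    rw [← hρ]
    congr 1
    exact Subtype.ext (inclProd_one μ₁ μ₂)
  map_mul' g g' := by
    rw [← map_mul]
    congr 1
    exact Subtype.ext (inclProd_mul μ₁ μ₂ g.1 g'.1)

variable {hf : (f₁, f₂) ∈ Γ} {ρ : Representation ℂ Γ W} (hρ : ρ ⟨(f₁, f₂), hf⟩ = 1)

lemma mem_unitSubgroup_of_coe {γ : M₁ × M₂} (hγ : γ ∈ Γ) {g : G₁ × G₂} (h₁ : μ₁.ret γ.1 = g.1)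
    (h₂ : μ₂.ret γ.2 = g.2) : g ∈ unitSubgroup μ₁ μ₂ hf := by
  change inclProd μ₁ μ₂ g ∈ Γ
  rw [inclProd_eq μ₁ μ₂ h₁ h₂]
  exact Γ.mul_mem hγ hf

/-- Since `ρ (f₁, f₂) = 1`, an element `γ` acts as `γ * (f₁, f₂)`, which lies in the maximal
subgroup. -/
lemma apply_eq_unitRep (γ : Γ) (g : unitSubgroup μ₁ μ₂ hf) (h₁ : μ₁.ret γ.1.1 = g.1.1)
    (h₂ : μ₂.ret γ.1.2 = g.1.2) : ρ γ = unitRep μ₁ μ₂ hf hρ g := by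
  have h : (⟨inclProd μ₁ μ₂ g.1, g.2⟩ : Γ) = γ * ⟨(f₁, f₂), hf⟩ :=
    Subtype.ext (inclProd_eq μ₁ μ₂ h₁ h₂)
  change ρ γ = ρ ⟨inclProd μ₁ μ₂ g.1, g.2⟩
  rw [h, map_mul, hρ, mul_one]

/-- Extension by zero of functions from the maximal subgroup to the monoid. -/
def extendUnits (hρ0 : ∀ γ : Γ, ρ γ ≠ 0 → ∃ a b : M₁ × M₂, (f₁, f₂) = a * γ * b) :
    (inflate μ₁ μ₂ (coind (unitSubgroup μ₁ μ₂ hf).subtype (unitRep μ₁ μ₂ hf hρ))).IntertwiningMap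
      (Ind Γ ρ) where
  toFun ψ := ⟨fun m => extendZero ψ.1 (μ₁.ret m.1) (μ₂.ret m.2), fun γ m => by
    change extendZero ψ.1 (μ₁.ret (γ.1.1 * m.1)) (μ₂.ret (γ.1.2 * m.2)) =
      ρ γ (extendZero ψ.1 (μ₁.ret m.1) (μ₂.ret m.2))
    rw [map_mul, map_mul]
    rcases exists_coe_or_zero μ₁ μ₂ γ.1 with ⟨g, h₁, h₂⟩ | h0
    · have hg := mem_unitSubgroup_of_coe μ₁ μ₂ (hf := hf) γ.2 h₁ h₂
      rw [apply_eq_unitRep μ₁ μ₂ hρ γ ⟨g, hg⟩ h₁ h₂, h₁, h₂]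
      rcases exists_coe_or_zero μ₁ μ₂ m with ⟨g', h₁', h₂'⟩ | h0'
      · rw [h₁', h₂']
        exact ψ.2 ⟨g, hg⟩ g'
      · rw [extendZero_of_zero _ h0', map_zero]
        exact extendZero_of_zero _ (h0'.imp (fun h => by rw [h, mul_zero])
          (fun h => by rw [h, mul_zero]))
    · have hγ : ρ γ = 0 := by
        by_contra h
        obtain ⟨g, h₁, h₂⟩ := (exists_coe_iff μ₁ μ₂ γ.1).2 (hρ0 γ h)
        rcases h0 with h0 | h0
        · exact WithZero.coe_ne_zero (h₁.symm.trans h0)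
        · exact WithZero.coe_ne_zero (h₂.symm.trans h0)
      rw [hγ, LinearMap.zero_apply]
      exact extendZero_of_zero _ (h0.imp (fun h => by rw [h, zero_mul])
          (fun h => by rw [h, zero_mul]))⟩
  map_add' ψ ψ' := by
    ext m
    change extendZero (ψ.1 + ψ'.1) (μ₁.ret m.1) (μ₂.ret m.2) =
      extendZero ψ.1 (μ₁.ret m.1) (μ₂.ret m.2) + extendZero ψ'.1 (μ₁.ret m.1) (μ₂.ret m.2)
    rcases exists_coe_or_zero μ₁ μ₂ m with ⟨g, h₁, h₂⟩ | h0
    · rw [h₁, h₂]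
      rfl
    · simp only [extendZero_of_zero _ h0, add_zero]
  map_smul' c ψ := by
    ext m
    change extendZero (c • ψ.1) (μ₁.ret m.1) (μ₂.ret m.2) =
      c • extendZero ψ.1 (μ₁.ret m.1) (μ₂.ret m.2)
    rcases exists_coe_or_zero μ₁ μ₂ m with ⟨g, h₁, h₂⟩ | h0
    · rw [h₁, h₂]
      rfl
    · simp only [extendZero_of_zero _ h0, smul_zero]
  isIntertwining' m := by
    refine LinearMap.ext fun ψ => Subtype.ext (funext fun x => ?_)
    change extendZero (inflate μ₁ μ₂ _ m ψ).1 (μ₁.ret x.1) (μ₂.ret x.2) =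
      extendZero ψ.1 (μ₁.ret (x.1 * m.1)) (μ₂.ret (x.2 * m.2))
    rw [map_mul, map_mul]
    rcases exists_coe_or_zero μ₁ μ₂ x with ⟨g, h₁, h₂⟩ | h0
    · rw [h₁, h₂]
      rcases exists_coe_or_zero μ₁ μ₂ m with ⟨g', h₁', h₂'⟩ | h0'
      · rw [h₁', h₂', inflate_apply_of_coe μ₁ μ₂ _ h₁' h₂']
        rfl
      · rw [inflate_apply_of_zero μ₁ μ₂ _ h0']
        refine (extendZero_coe _ g).trans (extendZero_of_zero _ ?_).symm
        exact h0'.imp (fun h => by rw [h, mul_zero]) (fun h => by rw [h, mul_zero])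
    · rw [extendZero_of_zero _ h0, extendZero_of_zero]
      exact h0.imp (fun h => by rw [h, zero_mul]) (fun h => by rw [h, zero_mul])

/-- Restriction of functions from the monoid to the maximal subgroup. -/
def restrictUnits : coindV Γ.subtype ρ →ₗ[ℂ]
    coindV (unitSubgroup μ₁ μ₂ hf).subtype (unitRep μ₁ μ₂ hf hρ) where
  toFun φ := ⟨fun g => φ.1 (inclProd μ₁ μ₂ g), fun h g => by
    change φ.1 (inclProd μ₁ μ₂ (h.1 * g)) = ρ ⟨inclProd μ₁ μ₂ h.1, h.2⟩ (φ.1 (inclProd μ₁ μ₂ g))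
    rw [inclProd_mul]
    exact φ.2 ⟨inclProd μ₁ μ₂ h.1, h.2⟩ _⟩
  map_add' _ _ := rfl
  map_smul' _ _ := rfl

/-- Centrality turns right translation by `d` into left multiplication, where equivariance applies.
-/
lemma ind_apply_idem {k : ℕ} (hk : IsCliffordWithExponent (M₁ × M₂) k) {d : M₁ × M₂}
    (hd : d * d = d) (hdΓ : d ∈ Γ) (φ : coindV Γ.subtype ρ) (m : M₁ × M₂) :
    (Ind Γ ρ d φ).1 m = ρ ⟨d, hdΓ⟩ (φ.1 m) := by
  rw [← φ.2 ⟨d, hdΓ⟩ m]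
  exact congrArg φ.1 (hk.central d hd m).symm

/-- `P` is the product of the operators `1 - R e` for `e` in `s`. It intertwines because each `e` is
central, and it is invisible to quotients on which all these `e` vanish. -/
lemma exists_truncation {M V : Type*} [Monoid M] [AddCommGroup V] [Module ℂ V]
    (R : Representation ℂ M V) (s : Finset M) (hs : ∀ e ∈ s, e * e = e)
    (hc : ∀ e ∈ s, ∀ m, e * m = m * e) :
    ∃ P : R.IntertwiningMap R, (∀ e ∈ s, ∀ v, R e (P v) = 0) ∧
      (∀ v, (∀ e ∈ s, R e v = 0) → P v = v) ∧
      ∀ (X : Type) [AddCommGroup X] [Module ℂ X] (ξ : Representation ℂ M X)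
        (q : R.IntertwiningMap ξ), (∀ e ∈ s, ξ e = 0) → ∀ v, q (P v) = q v := by
  classical
  induction s using Finset.induction_on with
  | empty => exact ⟨IntertwiningMap.id R, by simp, by simp, by simp⟩
  | insert e s _ ih =>
    obtain ⟨P, h1, h2, h3⟩ := ih (fun d hd => hs d (Finset.mem_insert_of_mem hd))
      (fun d hd => hc d (Finset.mem_insert_of_mem hd))
    have hes := hs e (Finset.mem_insert_self e s)
    have hec := hc e (Finset.mem_insert_self e s)
    let P' : R.IntertwiningMap R := ⟨P.toLinearMap - R e ∘ₗ P.toLinearMap, fun m => by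
      ext v
      change P (R m v) - R e (P (R m v)) = R m (P v - R e (P v))
      rw [P.isIntertwining, map_sub, ← Module.End.mul_apply, ← map_mul, hec, map_mul]
      rfl⟩
    have hP' : ∀ v, P' v = P v - R e (P v) := fun v => rfl
    refine ⟨P', fun d hd v => ?_, fun v hv => ?_, fun X _ _ ξ q hq v => ?_⟩
    · rw [hP', map_sub]
      rcases Finset.mem_insert.1 hd with rfl | hd
      · rw [← Module.End.mul_apply, ← map_mul, hes, sub_self]
      · rw [h1 d hd, ← Module.End.mul_apply, ← map_mul, ← hec, map_mul, Module.End.mul_apply,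
          h1 d hd, map_zero, sub_zero]
    · rw [hP', h2 v fun d hd => hv d (Finset.mem_insert_of_mem hd),
        hv e (Finset.mem_insert_self e s), sub_zero]
    · rw [hP', map_sub, q.isIntertwining, hq e (Finset.mem_insert_self e s),
        h3 X ξ q fun d hd => hq d (Finset.mem_insert_of_mem hd)]
      simp

/-- Homomorphisms from an induced representation to a representation on which the idempotents below
`(f₁, f₂)` vanish factor through the functions on the maximal subgroup. -/
lemma nonempty_linearEquiv_of_vanish [Finite M₁] [Finite M₂] {k : ℕ}
    (hk : IsCliffordWithExponent (M₁ × M₂) k)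
    (hρ0 : ∀ γ : Γ, ρ γ ≠ 0 → ∃ a b : M₁ × M₂, (f₁, f₂) = a * γ * b)
    {X : Type} [AddCommGroup X] [Module ℂ X] (ξ : Representation ℂ (M₁ × M₂) X)
    (hξ : ∀ d : M₁ × M₂, d * d = d → d * (f₁, f₂) = d → d ≠ (f₁, f₂) → ξ d = 0) :
    Nonempty ((Ind Γ ρ).IntertwiningMap ξ ≃ₗ[ℂ] (inflate μ₁ μ₂
      (coind (unitSubgroup μ₁ μ₂ hf).subtype (unitRep μ₁ μ₂ hf hρ))).IntertwiningMap ξ) := by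
  classical
  have := Fintype.ofFinite (M₁ × M₂)
  have hff := idem_mul_idem_prod μ₁ μ₂
  -- The idempotents strictly below `(f₁, f₂)`; `P` removes their contribution.
  let s : Finset (M₁ × M₂) := Finset.univ.filter fun d =>
    d * d = d ∧ d * (f₁, f₂) = d ∧ d ≠ (f₁, f₂)
  have hs : ∀ d, d ∈ s ↔ d * d = d ∧ d * (f₁, f₂) = d ∧ d ≠ (f₁, f₂) := fun d => by simp [s]
  obtain ⟨P, hP1, hP2, hP3⟩ := exists_truncation (Ind Γ ρ) s (fun d hd => ((hs d).1 hd).1)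
    (fun d hd => hk.central d ((hs d).1 hd).1)
  let E := extendUnits μ₁ μ₂ hρ hρ0
  have hRf : ∀ φ, Ind Γ ρ (f₁, f₂) φ = φ := fun φ => by
    ext m
    rw [ind_apply_idem hk hff hf, hρ]
    rfl
  -- `m` acts as `m * (f₁, f₂)`, which factors through the idempotent `(m * (f₁, f₂)) ^ k`. When `m`
  -- retracts to zero this idempotent is strictly below `(f₁, f₂)`, hence kills the image of `P`.
  have hRz : ∀ m : M₁ × M₂, (μ₁.ret m.1 = 0 ∨ μ₂.ret m.2 = 0) → ∀ φ, Ind Γ ρ m (P φ) = 0 := by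
    intro m hm φ
    have hd : (m * (f₁, f₂)) ^ k ∈ s := by
      refine (hs _).2 ⟨hk.pow_idem _, ?_, fun h => ?_⟩
      · obtain ⟨i, hi⟩ := Nat.exists_eq_add_of_lt hk.pos
        rw [zero_add] at hi
        rw [hi, pow_succ, mul_assoc, mul_assoc m, hff]
      · have h1 : (f₁, f₂) = 1 * m * ((f₁, f₂) * (m * (f₁, f₂)) ^ (k - 1)) := by
          rw [one_mul, ← mul_assoc, ← pow_succ', Nat.sub_add_cancel hk.pos, h]
        obtain ⟨g, h₁, h₂⟩ := (exists_coe_iff μ₁ μ₂ m).2 ⟨_, _, h1⟩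
        rcases hm with hm | hm
        · exact WithZero.coe_ne_zero (h₁.symm.trans hm)
        · exact WithZero.coe_ne_zero (h₂.symm.trans hm)
    have h1 : Ind Γ ρ m (P φ) = Ind Γ ρ (m * (f₁, f₂) * (m * (f₁, f₂)) ^ k) (P φ) := by
      rw [hk.self_mul_pow, map_mul, Module.End.mul_apply, hRf]
    rw [h1, map_mul, Module.End.mul_apply, hP1 _ hd, map_zero]
  -- Restriction alone does not intertwine with the inflated action, but it does after truncation.
  -- Then `E ∘ Q = P` and `Q ∘ E = 1`, and maps to `ξ` do not see `P`.
  let Q : (Ind Γ ρ).IntertwiningMap (inflate μ₁ μ₂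
      (coind (unitSubgroup μ₁ μ₂ hf).subtype (unitRep μ₁ μ₂ hf hρ))) :=
    ⟨restrictUnits μ₁ μ₂ hρ ∘ₗ P.toLinearMap, fun m => LinearMap.ext fun φ => by
      change restrictUnits μ₁ μ₂ hρ (P (Ind Γ ρ m φ)) =
        inflate μ₁ μ₂ _ m (restrictUnits μ₁ μ₂ hρ (P φ))
      rw [P.isIntertwining]
      rcases exists_coe_or_zero μ₁ μ₂ m with ⟨g, h₁, h₂⟩ | h0
      · rw [inflate_apply_of_coe μ₁ μ₂ _ h₁ h₂]
        ext x
        change (P φ).1 (inclProd μ₁ μ₂ x * m) = (P φ).1 (inclProd μ₁ μ₂ (x * g))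
        rw [inclProd_mul, inclProd_eq μ₁ μ₂ h₁ h₂, ← hk.central _ hff m, ← mul_assoc,
          inclProd_mul_idem]
      · rw [inflate_apply_of_zero μ₁ μ₂ _ h0, hRz m h0, map_zero]
        rfl⟩
  have hEQ : ∀ φ, E (Q φ) = P φ := by
    intro φ
    ext m
    change extendZero (fun g => (P φ).1 (inclProd μ₁ μ₂ g)) (μ₁.ret m.1) (μ₂.ret m.2) = (P φ).1 m
    rcases exists_coe_or_zero μ₁ μ₂ m with ⟨g, h₁, h₂⟩ | h0
    · rw [h₁, h₂, extendZero_coe, inclProd_eq μ₁ μ₂ h₁ h₂]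
      conv_rhs => rw [← hRf (P φ)]
      rfl
    · rw [extendZero_of_zero _ h0]
      have := congrArg (fun φ => φ.1 1) (hRz m h0 φ)
      change (P φ).1 (1 * m) = 0 at this
      rw [one_mul] at this
      exact this.symm
  have hQE : ∀ ψ, Q (E ψ) = ψ := by
    intro ψ
    have h1 : P (E ψ) = E ψ := by
      refine hP2 _ fun d hd => ?_
      rw [← E.isIntertwining, inflate_apply_of_zero]
      · exact map_zero E
      · obtain ⟨h1, h2, h3⟩ := (hs d).1 hd
        refine (exists_coe_or_zero μ₁ μ₂ d).resolve_left ?_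
        rintro ⟨g, h₁, h₂⟩
        exact h3 (eq_idem_of_coe μ₁ μ₂ h1 h2 h₁ h₂)
    change restrictUnits μ₁ μ₂ hρ (P (E ψ)) = ψ
    rw [h1]
    ext g
    change extendZero ψ.1 (μ₁.ret (μ₁.incl g.1)) (μ₂.ret (μ₂.incl g.2)) = _
    rw [μ₁.ret_incl, μ₂.ret_incl, extendZero_coe]
  exact ⟨{
    toFun := fun q => q.comp E
    invFun := fun q => q.comp Q
    map_add' := fun _ _ => rfl
    map_smul' := fun _ _ => rfl
    left_inv := fun q => by
      ext φ
      change q (E (Q φ)) = q φ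
      rw [hEQ]
      exact hP3 X ξ q (fun d hd => hξ d ((hs d).1 hd).1 ((hs d).1 hd).2.1 ((hs d).1 hd).2.2) φ
    right_inv := fun q => by
      ext ψ
      exact congrArg q (hQE ψ) }⟩

end Induced
end ThetaMonoid
namespace ThetaMonoid

/-! ### Comparison of multiplicities -/

section Comparison

variable {A B V V' : Type*} [Monoid A] [Monoid B] [AddCommGroup V] [Module ℂ V] [AddCommGroup V']
  [Module ℂ V'] {Ω : Representation ℂ (A × B) V} {Ω' : Representation ℂ (A × B) V'}
  {R R' : ∀ {X Y : Type} [AddCommGroup X] [Module ℂ X] [AddCommGroup Y] [Module ℂ Y],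
    Representation ℂ A X → Representation ℂ B Y → Prop}

open Representation

/-- Only pairs with a nonzero homomorphism need comparison. This matters because that homomorphism
is what determines the apex of `σ ⊗ τ`. -/
lemma LeftMultiplicityFree.of_nonempty_linearEquiv (h : LeftMultiplicityFree Ω' R')
    (hR : ∀ (X Y : Type) [AddCommGroup X] [Module ℂ X] [AddCommGroup Y] [Module ℂ Y]
      (σ : Representation ℂ A X) (τ : Representation ℂ B Y), σ.IsIrreducible → τ.IsIrreducible →
      R σ τ → (∃ f : Ω.IntertwiningMap (extTensor σ τ), f ≠ 0) → R' σ τ ∧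
        Nonempty (Ω.IntertwiningMap (extTensor σ τ) ≃ₗ[ℂ] Ω'.IntertwiningMap (extTensor σ τ))) :
    LeftMultiplicityFree Ω R := by
  constructor
  · intro X Y _ _ _ _ σ τ hσ hτ hr
    rw [rank_le_one_iff]
    by_cases h0 : ∃ f : Ω.IntertwiningMap (extTensor σ τ), f ≠ 0
    · obtain ⟨hr', ⟨e⟩⟩ := hR X Y σ τ hσ hτ hr h0
      obtain ⟨f₀, hf₀⟩ := h.exists_forall_eq_smul hσ hτ hr'
      refine ⟨e.symm f₀, fun f => ?_⟩
      obtain ⟨c, hc⟩ := hf₀ (e f)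
      exact ⟨c, by rw [← map_smul, hc, e.symm_apply_apply]⟩
    · push Not at h0
      exact ⟨0, fun f => ⟨0, by rw [h0 f, smul_zero]⟩⟩
  · intro X Y Y' _ _ _ _ _ _ σ τ τ' hσ hτ hτ' hr hr' h0 h0'
    obtain ⟨hs, ⟨e⟩⟩ := hR X Y σ τ hσ hτ hr h0
    obtain ⟨hs', ⟨e'⟩⟩ := hR X Y' σ τ' hσ hτ' hr' h0'
    obtain ⟨f, hf⟩ := h0
    obtain ⟨f', hf'⟩ := h0'
    exact h.unique X Y Y' σ τ τ' hσ hτ hτ' hs hs' ⟨e f, e.map_ne_zero_iff.2 hf⟩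
      ⟨e' f', e'.map_ne_zero_iff.2 hf'⟩

lemma LeftMultiplicityFree.and_swap_of_nonempty_linearEquiv
    (h : LeftMultiplicityFree Ω' R' ∧ LeftMultiplicityFree (swapRep Ω') (fun τ σ => R' σ τ))
    (hR : ∀ (X Y : Type) [AddCommGroup X] [Module ℂ X] [AddCommGroup Y] [Module ℂ Y]
      (σ : Representation ℂ A X) (τ : Representation ℂ B Y), σ.IsIrreducible → τ.IsIrreducible →
      R σ τ → (∃ f : Ω.IntertwiningMap (extTensor σ τ), f ≠ 0) → R' σ τ ∧
        Nonempty (Ω.IntertwiningMap (extTensor σ τ) ≃ₗ[ℂ] Ω'.IntertwiningMap (extTensor σ τ))) :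
    LeftMultiplicityFree Ω R ∧ LeftMultiplicityFree (swapRep Ω) (fun τ σ => R σ τ) := by
  refine ⟨h.1.of_nonempty_linearEquiv hR, h.2.of_nonempty_linearEquiv ?_⟩
  rintro Y X _ _ _ _ τ σ hτ hσ hr ⟨f, hf⟩
  obtain ⟨hr', ⟨e⟩⟩ := hR X Y σ τ hσ hτ hr
    ⟨(swapHom Ω σ τ).symm f, (swapHom Ω σ τ).symm.map_ne_zero_iff.2 hf⟩
  exact ⟨hr', ⟨((swapHom Ω σ τ).symm.trans e).trans (swapHom Ω' σ τ)⟩⟩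

end Comparison

/-! ### Representations with a single apex -/

section Apex

variable {M V : Type*} [Monoid M] [AddCommGroup V] [Module ℂ V]

open Representation

lemma isSemisimple_of_forall_isUnit [Finite M] (hM : ∀ m : M, IsUnit m)
    (π : Representation ℂ M V) : π.IsSemisimpleRepresentation := by
  have : NeZero (Nat.card Mˣ : ℂ) := ⟨Nat.cast_ne_zero.2 Nat.card_pos.ne'⟩
  have h : (show Representation ℂ Mˣ V from π.comp (Units.coeHom M)).IsSemisimpleRepresentation :=
    inferInstance
  refine (OrderIso.complementedLattice_iff (subrepresentationOrderIso π _ fun K => ?_)).2 h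
  constructor
  · intro hK u
    exact hK u
  · intro hK m
    obtain ⟨u, rfl⟩ := hM m
    exact hK u

lemma IsApex.apply_ne_zero {π : Representation ℂ M V} {e : M} (h : IsApex π e) : π e ≠ 0 :=
  fun h0 => (h.2 e).1 h0 ⟨1, 1, by simp⟩

lemma IsCliffordWithExponent.submonoid {k : ℕ} (h : IsCliffordWithExponent M k)
    (Γ : Submonoid M) : IsCliffordWithExponent Γ k where
  pos := h.pos
  pow_succ_eq m := Subtype.ext (h.pow_succ_eq m.1)
  central e he m := Subtype.ext (h.central e.1 (congrArg Subtype.val he) m.1)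

lemma IsCliffordWithExponent.mul_eq_of_eq_mul_mul {k : ℕ} (h : IsCliffordWithExponent M k)
    {x e a b : M} (hx : x * x = x) (he : e = a * x * b) : x * e = e := by
  rw [he, ← h.central x hx a, ← mul_assoc, ← mul_assoc, hx]

lemma IsApex.apply_eq_zero_of_lt {k : ℕ} (hk : IsCliffordWithExponent M k)
    {π : Representation ℂ M V} {e d : M} (h : IsApex π e) (hd : d * d = d) (hde : d * e = d)
    (hne : d ≠ e) : π d = 0 := by
  refine (h.2 d).2 ?_
  rintro ⟨a, b, hab⟩
  exact hne (hde.symm.trans (hk.mul_eq_of_eq_mul_mul hd hab))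

variable [FiniteDimensional ℂ V] {k : ℕ}
  {ρ : Representation ℂ M V} {e : M}

/-- The kernel of the central idempotent `ρ e` would contain an irreducible subrepresentation killed
by `e`; so `ρ e` is an injective idempotent. -/
lemma apply_eq_one_of_forall_isApex (hk : IsCliffordWithExponent M k) (he : e * e = e)
    (h : ∀ U : Subrepresentation ρ, U.toRepresentation.IsIrreducible →
      IsApex U.toRepresentation e) : ρ e = 1 := by
  have hker : LinearMap.ker (ρ e) = ⊥ := by
    by_contra hne
    obtain ⟨U, hU, hUK⟩ := exists_minimal_submodule ρ (LinearMap.ker (ρ e)) (fun m v hv => by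
      rw [LinearMap.mem_ker] at hv ⊢
      rw [← Module.End.mul_apply, ← map_mul, hk.central e he, map_mul, Module.End.mul_apply, hv,
        map_zero]) hne
    refine (h U hU).apply_ne_zero (LinearMap.ext fun u => Subtype.ext ?_)
    exact LinearMap.mem_ker.1 (hUK u.2)
  refine LinearMap.ext fun v => LinearMap.ker_eq_bot.1 hker ?_
  rw [← Module.End.mul_apply, ← map_mul, he]
  rfl

/-- An irreducible subrepresentation in the range of the central idempotent `ρ (m ^ k)` is fixed by
`m ^ k`, yet killed by `m` if the ideal of `m` misses the apex. -/
lemma exists_eq_mul_mul_of_forall_isApex (hk : IsCliffordWithExponent M k)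
    (h : ∀ U : Subrepresentation ρ, U.toRepresentation.IsIrreducible →
      IsApex U.toRepresentation e) {m : M} (hm : ρ m ≠ 0) : ∃ a b, e = a * m * b := by
  by_contra hcon
  refine hm ?_
  have hrange : LinearMap.range (ρ (m ^ k)) = ⊥ := by
    by_contra hne
    obtain ⟨U, hU, hUK⟩ := exists_minimal_submodule ρ (LinearMap.range (ρ (m ^ k))) (by
      rintro n _ ⟨v, rfl⟩
      refine ⟨ρ n v, ?_⟩
      rw [← Module.End.mul_apply, ← map_mul, hk.central _ (hk.pow_idem m), map_mul,
        Module.End.mul_apply]) hne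
    have hU0 : U.toRepresentation m = 0 := ((h U hU).2 m).2 hcon
    have := IsIrreducible.nontrivial hU
    obtain ⟨u, hu⟩ := exists_ne (0 : U.toSubmodule)
    refine hu (Subtype.ext ?_)
    obtain ⟨v, hv⟩ := hUK u.2
    have h1 : ρ (m ^ k) u.1 = u.1 := by
      rw [← hv, ← Module.End.mul_apply, ← map_mul, hk.pow_idem]
    have h2 : ρ m u.1 = 0 := congrArg Subtype.val (LinearMap.congr_fun hU0 u)
    rw [← h1, ← Nat.sub_add_cancel hk.pos, pow_succ, map_mul, Module.End.mul_apply, h2, map_zero]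
    rfl
  rw [LinearMap.range_eq_bot] at hrange
  rw [← hk.pow_mul_self m, map_mul, hrange, zero_mul]

end Apex

/-! ### Apexes of the irreducible quotients of the induced representation -/

section InducedApex

variable {M₁ M₂ W X : Type*} [Monoid M₁] [Monoid M₂] [AddCommGroup W] [Module ℂ W]
  [AddCommGroup X] [Module ℂ X] {Γ : Submonoid (M₁ × M₂)} {ρ : Representation ℂ Γ W}

open Representation

/-- Each of `e`, `e'` acts nontrivially where the other is the apex, so each absorbs the other;
commuting idempotents with this property are equal. -/
lemma eq_of_isApex_of_ind {k : ℕ} (hk : IsCliffordWithExponent (M₁ × M₂) k) {e e' : M₁ × M₂}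
    (he : e * e = e) (heΓ : e ∈ Γ) (hρ : ρ ⟨e, heΓ⟩ = 1)
    (hρ0 : ∀ γ : Γ, ρ γ ≠ 0 → ∃ a b : M₁ × M₂, e = a * γ * b)
    {ξ : Representation ℂ (M₁ × M₂) X} (hξ : ξ.IsIrreducible) (he' : e' ∈ Γ) (h : IsApex ξ e')
    (q : (Ind Γ ρ).IntertwiningMap ξ) (hq : q ≠ 0) : e' = e := by
  have hqs := (IsIrreducible.surjective_or_eq_zero q).resolve_right hq
  have h1 : ρ ⟨e', he'⟩ ≠ 0 := by
    intro h0
    refine h.apply_ne_zero (LinearMap.ext fun x => ?_)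
    obtain ⟨φ, rfl⟩ := hqs x
    have : Ind Γ ρ e' φ = 0 := by
      ext m
      rw [ind_apply_idem hk h.1 he', h0]
      rfl
    rw [← q.isIntertwining, this]
    exact map_zero q
  have h2 : ξ e ≠ 0 := by
    intro h0
    refine hq (IntertwiningMap.ext (LinearMap.ext fun φ => ?_))
    have : Ind Γ ρ e φ = φ := by
      ext m
      rw [ind_apply_idem hk he heΓ, hρ]
      rfl
    change q φ = 0
    rw [← this, q.isIntertwining, h0]
    rfl
  obtain ⟨a, b, hab⟩ := hρ0 _ h1
  have h3 : ∃ a b, e' = a * e * b := not_not.1 (mt (h.2 e).2 h2)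
  obtain ⟨a', b', hab'⟩ := h3
  rw [← hk.mul_eq_of_eq_mul_mul he hab', hk.central e he]
  exact hk.mul_eq_of_eq_mul_mul h.1 hab

end InducedApex

/-! ### The preimage of a graph at an idempotent -/

section Graph

variable {M₁ M₂ G₁ G₂ W : Type*} [Monoid M₁] [Monoid M₂] [Group G₁] [Group G₂]
  {N₁ : Submonoid M₁} {N₂ : Submonoid M₂} {h₁ : IsCentric N₁} {h₂ : IsCentric N₂}
  {f₁ : M₁} {f₂ : M₂}

open Representation

lemma exists_mul_eq_of_toQuotient_eq {x y : M₁} (h : toQuotient N₁ h₁ x = toQuotient N₁ h₁ y) :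
    ∃ n ∈ N₁, n * y = x := by
  have : (fun n => n * x) '' (N₁ : Set M₁) = (fun n => n * y) '' (N₁ : Set M₁) := (Con.eq _).1 h
  have hx : x ∈ (fun n => n * x) '' (N₁ : Set M₁) := ⟨1, N₁.one_mem, one_mul x⟩
  rwa [this] at hx

/-- Lifts of the images of `a` and `a⁻¹` multiply to an element equivalent to `f₂`, so the lift of
the first is invertible at `f₂`. This gives the surjectivity of `H` onto both factors. -/
lemma exists_incl_of_toQuotient (ι : CentricQuotient N₁ h₁ ≃* CentricQuotient N₂ h₂)
    (hf : ι (toQuotient N₁ h₁ f₁) = toQuotient N₂ h₂ f₂) (μ₁ : MaximalSubgroup f₁ G₁)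
    (μ₂ : MaximalSubgroup f₂ G₂) (a : G₁) :
    ∃ b, ι (toQuotient N₁ h₁ (μ₁.incl a)) = toQuotient N₂ h₂ (μ₂.incl b) := by
  obtain ⟨m, hm⟩ := Con.mk'_surjective (c := centricCon N₂ h₂)
    (ι (toQuotient N₁ h₁ (μ₁.incl a)))
  obtain ⟨m', hm'⟩ := Con.mk'_surjective (c := centricCon N₂ h₂)
    (ι (toQuotient N₁ h₁ (μ₁.incl a⁻¹)))
  have hmm : toQuotient N₂ h₂ f₂ = toQuotient N₂ h₂ (m * m') := by
    rw [map_mul, hm, hm', ← map_mul, ← map_mul, ← μ₁.incl_mul, mul_inv_cancel, μ₁.incl_one, hf]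
  obtain ⟨n, -, hn⟩ := exists_mul_eq_of_toQuotient_eq hmm
  obtain ⟨b, hb⟩ := μ₂.exists_ret_eq (m := m)
    (μ₂.ret_ne_zero_of_eq (a := n) (b := m') (by rw [mul_assoc, hn]))
  refine ⟨b, ?_⟩
  rw [μ₂.incl_of_ret m b hb, map_mul, hm, ← hf, ← map_mul, ← map_mul, μ₁.incl_mul_idem]

lemma exists_ret_eq_of_mem {e : M₁} (μ : MaximalSubgroup e G₁) (g : IsSubgroup N₁) {n : M₁}
    (hn : n ∈ N₁) : ∃ x : G₁, μ.ret n = x := by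
  obtain ⟨n', -, h, -⟩ := g n hn
  exact μ.exists_ret_eq (μ.ret_ne_zero_of_eq (a := 1) (b := n' * e) (by
    rw [one_mul, ← mul_assoc, h, one_mul]))

lemma exists_mem_ret_eq (μ : MaximalSubgroup f₁ G₁) {x : G₁}
    (h : toQuotient N₁ h₁ (μ.incl x) = toQuotient N₁ h₁ f₁) : ∃ n ∈ N₁, μ.ret n = x := by
  obtain ⟨n, hn, hnx⟩ := exists_mul_eq_of_toQuotient_eq h
  refine ⟨n, hn, ?_⟩
  rw [← μ.ret_incl, ← hnx, map_mul, μ.ret_idem, mul_one]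

variable (ι : CentricQuotient N₁ h₁ ≃* CentricQuotient N₂ h₂) [Finite G₁] [Finite G₂]
  [AddCommGroup W] [Module ℂ W] (μ₁ : MaximalSubgroup f₁ G₁) (μ₂ : MaximalSubgroup f₂ G₂)
  {hf : (f₁, f₂) ∈ graphPreimage ι} {ρ : Representation ℂ (graphPreimage ι) W}
  (hρ : ρ ⟨(f₁, f₂), hf⟩ = 1)

lemma exists_mem_unitSubgroup_left (a : G₁) : ∃ b, (a, b) ∈ unitSubgroup μ₁ μ₂ hf :=
  exists_incl_of_toQuotient ι hf μ₁ μ₂ a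

lemma exists_mem_unitSubgroup_right (b : G₂) : ∃ a, (a, b) ∈ unitSubgroup μ₁ μ₂ hf := by
  have hf' : ι (toQuotient N₁ h₁ f₁) = toQuotient N₂ h₂ f₂ := hf
  obtain ⟨a, ha⟩ := exists_incl_of_toQuotient ι.symm (by rw [← hf', ι.symm_apply_apply]) μ₂ μ₁ b
  refine ⟨a, ?_⟩
  change ι (toQuotient N₁ h₁ (μ₁.incl a)) = toQuotient N₂ h₂ (μ₂.incl b)
  rw [← ha, ι.apply_symm_apply]

/-- `N₁` and `N₂` map onto `H ∩ G₁` and `H ∩ G₂`: elements of these are congruent to the idempotent,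
hence are the idempotent times an element of `Nᵢ`. So the commutants on `W` coincide. -/
lemma commutantsCommute_comp_inclGraphPreimage_iff (g₁ : IsSubgroup N₁) (g₂ : IsSubgroup N₂) :
    CommutantsCommute (ρ.comp (inclGraphPreimage ι g₁ g₂)) ↔
      KernelCommutantsCommute (unitRep μ₁ μ₂ hf hρ) := by
  have hf' : ι (toQuotient N₁ h₁ f₁) = toQuotient N₂ h₂ f₂ := hf
  have hL : ∀ T : W →ₗ[ℂ] W,
      (∀ n w, T (ρ (inclGraphPreimage ι g₁ g₂ (n, 1)) w) =
        ρ (inclGraphPreimage ι g₁ g₂ (n, 1)) (T w)) ↔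
      ∀ x : unitSubgroup μ₁ μ₂ hf, x.1.2 = 1 → ∀ w,
        T (unitRep μ₁ μ₂ hf hρ x w) = unitRep μ₁ μ₂ hf hρ x (T w) := by
    intro T
    constructor
    · rintro h ⟨⟨x, y⟩, hx⟩ (rfl : y = 1) w
      have hx' : ι (toQuotient N₁ h₁ (μ₁.incl x)) = toQuotient N₂ h₂ (μ₂.incl 1) := hx
      rw [μ₂.incl_one, ← hf', ι.apply_eq_iff_eq] at hx'
      obtain ⟨n, hn, hnx⟩ := exists_mem_ret_eq μ₁ hx'
      rw [← apply_eq_unitRep μ₁ μ₂ hρ (inclGraphPreimage ι g₁ g₂ (⟨n, hn⟩, 1)) ⟨(x, 1), hx⟩ hnx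
        (map_one μ₂.ret)]
      exact h _ _
    · rintro h ⟨n, hn⟩ w
      obtain ⟨x, hx⟩ := exists_ret_eq_of_mem μ₁ g₁ hn
      have hmem := mem_unitSubgroup_of_coe μ₁ μ₂ (hf := hf) (g := (x, 1))
        (inclGraphPreimage ι g₁ g₂ (⟨n, hn⟩, 1)).2 hx (map_one μ₂.ret)
      rw [apply_eq_unitRep μ₁ μ₂ hρ (inclGraphPreimage ι g₁ g₂ (⟨n, hn⟩, 1)) ⟨(x, 1), hmem⟩ hx
        (map_one μ₂.ret)]
      exact h _ rfl _
  have hR : ∀ T : W →ₗ[ℂ] W,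
      (∀ n w, T (ρ (inclGraphPreimage ι g₁ g₂ (1, n)) w) =
        ρ (inclGraphPreimage ι g₁ g₂ (1, n)) (T w)) ↔
      ∀ x : unitSubgroup μ₁ μ₂ hf, x.1.1 = 1 → ∀ w,
        T (unitRep μ₁ μ₂ hf hρ x w) = unitRep μ₁ μ₂ hf hρ x (T w) := by
    intro T
    constructor
    · rintro h ⟨⟨y, x⟩, hx⟩ (rfl : y = 1) w
      have hx' : ι (toQuotient N₁ h₁ (μ₁.incl 1)) = toQuotient N₂ h₂ (μ₂.incl x) := hx
      rw [μ₁.incl_one, hf'] at hx'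
      obtain ⟨n, hn, hnx⟩ := exists_mem_ret_eq μ₂ hx'.symm
      rw [← apply_eq_unitRep μ₁ μ₂ hρ (inclGraphPreimage ι g₁ g₂ (1, ⟨n, hn⟩)) ⟨(1, x), hx⟩
        (map_one μ₁.ret) hnx]
      exact h _ _
    · rintro h ⟨n, hn⟩ w
      obtain ⟨x, hx⟩ := exists_ret_eq_of_mem μ₂ g₂ hn
      have hmem := mem_unitSubgroup_of_coe μ₁ μ₂ (hf := hf) (g := (1, x))
        (inclGraphPreimage ι g₁ g₂ (1, ⟨n, hn⟩)).2 (map_one μ₁.ret) hx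
      rw [apply_eq_unitRep μ₁ μ₂ hρ (inclGraphPreimage ι g₁ g₂ (1, ⟨n, hn⟩)) ⟨(1, x), hmem⟩
        (map_one μ₁.ret) hx]
      exact h _ rfl _
  exact forall₂_congr fun T S => by
    rw [← hL T, ← hR S]
    rfl

lemma isSemisimple_comp_inclGraphPreimage [Finite M₁] [Finite M₂] (g₁ : IsSubgroup N₁)
    (g₂ : IsSubgroup N₂) :
    Representation.IsSemisimpleRepresentation
      (ρ.comp (inclGraphPreimage ι g₁ g₂) : Representation ℂ (N₁ × N₂) W) := by
  refine isSemisimple_of_forall_isUnit ?_ _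
  rintro ⟨⟨a, ha⟩, ⟨b, hb⟩⟩
  obtain ⟨a', ha', h₁, h₁'⟩ := g₁ a ha
  obtain ⟨b', hb', h₂, h₂'⟩ := g₂ b hb
  exact ⟨⟨(⟨a, ha⟩, ⟨b, hb⟩), (⟨a', ha'⟩, ⟨b', hb'⟩),
    Prod.ext (Subtype.ext h₁) (Subtype.ext h₂), Prod.ext (Subtype.ext h₁') (Subtype.ext h₂')⟩, rfl⟩

/-- The constituents of the induced representation in `IrrE ι` are those of the inflation of the
representation of the maximal subgroup induced from its intersection with `Γ`. -/
lemma leftMultiplicityFree_ind_iff [Finite M₁] [Finite M₂] {k : ℕ}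
    (hk : IsCliffordWithExponent (M₁ × M₂) k)
    (hρ0 : ∀ γ : graphPreimage ι, ρ γ ≠ 0 → ∃ a b : M₁ × M₂, (f₁, f₂) = a * γ * b) :
    (LeftMultiplicityFree (Ind (graphPreimage ι) ρ) (fun σ τ => IrrE ι (extTensor σ τ)) ∧
      LeftMultiplicityFree (swapRep (Ind (graphPreimage ι) ρ))
        (fun τ σ => IrrE ι (extTensor σ τ))) ↔
    (LeftMultiplicityFree (inflate μ₁ μ₂
        (coind (unitSubgroup μ₁ μ₂ hf).subtype (unitRep μ₁ μ₂ hf hρ))) (fun _ _ => True) ∧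
      LeftMultiplicityFree (swapRep (inflate μ₁ μ₂
        (coind (unitSubgroup μ₁ μ₂ hf).subtype (unitRep μ₁ μ₂ hf hρ)))) (fun _ _ => True)) := by
  have hff := idem_mul_idem_prod μ₁ μ₂
  constructor
  · refine fun h => LeftMultiplicityFree.and_swap_of_nonempty_linearEquiv h ?_
    rintro X Y _ _ _ _ σ τ hσ hτ - ⟨p, hp⟩
    have := IsIrreducible.finiteDimensional hσ
    have := IsIrreducible.finiteDimensional hτ
    have hirr := isIrreducible_extTensor hσ hτ
    have hap := isApex_of_inflate μ₁ μ₂ _ hirr p hp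
    refine ⟨⟨hirr, f₁, f₂, μ₁.idem_mul_idem, μ₂.idem_mul_idem, hf, hap⟩, ?_⟩
    obtain ⟨e⟩ := nonempty_linearEquiv_of_vanish μ₁ μ₂ hρ hk hρ0 (extTensor σ τ)
      fun d hd hdf hne => hap.apply_eq_zero_of_lt hk hd hdf hne
    exact ⟨e.symm⟩
  · refine fun h => LeftMultiplicityFree.and_swap_of_nonempty_linearEquiv h ?_
    rintro X Y _ _ _ _ σ τ hσ hτ ⟨hirr, f₁', f₂', -, -, hf', hap⟩ ⟨q, hq⟩
    have heq := eq_of_isApex_of_ind hk hff hf hρ hρ0 hirr hf' hap q hq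
    rw [heq] at hap
    exact ⟨trivial, nonempty_linearEquiv_of_vanish μ₁ μ₂ hρ hk hρ0 (extTensor σ τ)
      fun d hd hdf hne => hap.apply_eq_zero_of_lt hk hd hdf hne⟩

end Graph
end ThetaMonoid
end

theorem proposition6
    {M₁ M₂ : Type*} [Monoid M₁] [Monoid M₂] [Finite M₁] [Finite M₂]
    (ss₁ : ThetaMonoid.IsSemisimpleMonoid M₁) (ss₂ : ThetaMonoid.IsSemisimpleMonoid M₂)
    (c₁ : ThetaMonoid.IsCentric (⊤ : Submonoid M₁))
    (c₂ : ThetaMonoid.IsCentric (⊤ : Submonoid M₂))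
    (N₁ : Submonoid M₁) (N₂ : Submonoid M₂)
    (h₁ : ThetaMonoid.IsCentric N₁) (h₂ : ThetaMonoid.IsCentric N₂)
    (g₁ : ThetaMonoid.IsSubgroup N₁) (g₂ : ThetaMonoid.IsSubgroup N₂)
    (ι : ThetaMonoid.CentricQuotient N₁ h₁ ≃* ThetaMonoid.CentricQuotient N₂ h₂)
    {W : Type*} [AddCommGroup W] [Module ℂ W] [FiniteDimensional ℂ W]
    (ρ : Representation ℂ (ThetaMonoid.graphPreimage ι) W)
    (f₁ : M₁) (f₂ : M₂) (hf₁ : IsIdempotentElem f₁) (hf₂ : IsIdempotentElem f₂)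
    (hf : (f₁, f₂) ∈ ThetaMonoid.graphPreimage ι)
    (apex : ∀ U : Subrepresentation ρ, U.toRepresentation.IsIrreducible →
      ThetaMonoid.IsApex U.toRepresentation ⟨(f₁, f₂), hf⟩) :
    ThetaMonoid.IsTheta (ρ.comp (ThetaMonoid.inclGraphPreimage ι g₁ g₂)) ↔
      ThetaMonoid.IsThetaWithRespectTo (ThetaMonoid.Ind (ThetaMonoid.graphPreimage ι) ρ)
        (ThetaMonoid.IrrE ι) := by
  obtain ⟨k₁, hk₁⟩ := ThetaMonoid.exists_isCliffordWithExponent ss₁ c₁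
  obtain ⟨k₂, hk₂⟩ := ThetaMonoid.exists_isCliffordWithExponent ss₂ c₂
  obtain ⟨G₁, _, _, ⟨μ₁⟩⟩ := hk₁.exists_maximalSubgroup hf₁
  obtain ⟨G₂, _, _, ⟨μ₂⟩⟩ := hk₂.exists_maximalSubgroup hf₂
  have hk := hk₁.prod hk₂
  have hkΓ := hk.submonoid (ThetaMonoid.graphPreimage ι)
  have hρ : ρ ⟨(f₁, f₂), hf⟩ = 1 :=
    ThetaMonoid.apply_eq_one_of_forall_isApex hkΓ (Subtype.ext (Prod.ext hf₁ hf₂)) apex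
  have hρ0 : ∀ γ : ThetaMonoid.graphPreimage ι, ρ γ ≠ 0 →
      ∃ a b : M₁ × M₂, (f₁, f₂) = a * γ * b := fun γ hγ => by
    obtain ⟨a, b, hab⟩ := ThetaMonoid.exists_eq_mul_mul_of_forall_isApex hkΓ apex hγ
    exact ⟨a, b, congrArg Subtype.val hab⟩
  -- The commutant criterion is applied only to the restriction to `N₁ × N₂` and to the inflated
  -- representation, both semisimple by Maschke; the full induced representation is never
  -- decomposed.
  rw [ThetaMonoid.isTheta_iff_isThetaWithRespectTo, ThetaMonoid.isThetaWithRespectTo_iff,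
    ThetaMonoid.isThetaWithRespectTo_iff, ThetaMonoid.leftMultiplicityFree_and_swap_iff
      (ThetaMonoid.isSemisimple_comp_inclGraphPreimage ι g₁ g₂),
    ThetaMonoid.commutantsCommute_comp_inclGraphPreimage_iff ι μ₁ μ₂ hρ g₁ g₂,
    ThetaMonoid.kernelCommutantsCommute_iff_coind
      (ThetaMonoid.exists_mem_unitSubgroup_left ι μ₁ μ₂)
      (ThetaMonoid.exists_mem_unitSubgroup_right ι μ₁ μ₂),
    ← ThetaMonoid.commutantsCommute_inflate_iff μ₁ μ₂,
    ← ThetaMonoid.leftMultiplicityFree_and_swap_iff (ThetaMonoid.isSemisimple_inflate μ₁ μ₂ _),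
    ThetaMonoid.leftMultiplicityFree_ind_iff ι μ₁ μ₂ hρ hk hρ0]
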